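/- Let $J$ be an irreducible continuous-time Markov chain on $\{1,\dots,d\}$ with transition rate matrix $Q$, invariant distribution $\pi$ and transition probabilities $p_{ij}(t)=\mathbb P(J(t)=j\mid J(0)=i)$, and let $J(0)\sim\pi$. In Model II, jobs arrive at an infinite-server queue according to a Poisson process of rate $\lambda_i\ge 0$ while $J$ is in state $i$, and the duration of a job that enters while $J$ is in state $i$ is sampled upon arrival from the exponential distribution with mean $1/\mu_i$, where $\mu_i>0$. Let $M(t)$ be the number of jobs present at time $t$, with $M(0)=0$. Then almost surely $M(t)<\infty$ for all $t\ge 0$, each $M(t)$ is square integrable, and for all $t,u\ge 0$ $$\operatorname{Cov}(M(t),M(t+u))=\sum_{i}\pi_i\frac{\lambda_i}{\mu_i}\left(1-e^{-\mu_i t}\right)e^{-\mu_i u}+\lambda^{\rm T}\mathscr K(t,u)\lambda+\lambda^{\rm T}\mathscr L(t,u)\lambda,$$ where $$\mathscr K_{ij}(t,u)=\int_0^t\!\int_0^s e^{-\mu_i(t+u-r)}e^{-\mu_j(t-s)}\,\pi_i\left(p_{ij}(s-r)-\pi_j\right)dr\,ds,$$ $$\mathscr L_{ij}(t,u)=\int_0^t\!\int_s^{t+u}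 e^{-\mu_i(t+u-r)}e^{-\mu_j(t-s)}\,\pi_j\left(p_{ji}(r-s)-\pi_i\right)dr\,ds.$$ Equivalently, $$\mathscr K_{ij}(t,u)=\frac{e^{-\mu_iu-\mu_jt}\pi_i}{\mu_i+\mu_j}\int_0^t\left(e^{-\mu_iw+\mu_jt}-e^{-\mu_it+\mu_jw}\right)\left(p_{ij}(w)-\pi_j\right)dw,$$ $$\mathscr L_{ij}(t,u)=\frac{e^{-\mu_iu}\pi_j}{\mu_i+\mu_j}\left(1-e^{-(\mu_i+\mu_j)t}\right)\int_0^ue^{\mu_iw}\left(p_{ji}(w)-\pi_i\right)dw+\frac{\pi_j}{\mu_i+\mu_j}\int_u^{t+u}\left(e^{\mu_j(u-w)}-e^{\mu_i(w-u-t)-\mu_jt}\right)\left(p_{ji}(w)-\pi_i\right)dw.$$ Let $D^{(\mu)}_{ij}=\int_0^\infty e^{-\mu_it}(p_{ij}(t)-\pi_j)\,dt$ be the exponentially weighted deviation matrix; these integrals converge absolutely. For every $u\ge0$, $$\lim_{t\to\infty}\operatorname{Cov}(M(t),M(t+u))=\sum_i\pi_i\frac{\lambda_i}{\mu_i}e^{-\mu_iu}+\sum_{i,j}\pi_i\frac{\lambda_i\lambda_j}{\mu_i+\mu_j}e^{-\mu_iu}D^{(\mu)}_{ij}+\sum_{i,j}\pi_j\frac{\lambda_i\lambda_j}{\mu_i+\mu_j}\int_0^ue^{-\mu_iu+\mu_iw}\left(p_{ji}(w)-\pi_i\right)dw+\sum_{i,j}\pi_j\frac{\lambda_i\lambda_j}{\mu_i+\mu_j}\int_u^\infty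 e^{\mu_ju-\mu_jw}\left(p_{ji}(w)-\pi_i\right)dw,$$ and $$\lim_{t\to\infty}\operatorname{Var}M(t)=\sum_i\pi_i\frac{\lambda_i}{\mu_i}+2\sum_{i,j}\pi_i\frac{\lambda_i\lambda_j}{\mu_i+\mu_j}D^{(\mu)}_{ij}.$$ -/

import Mathlib

open MeasureTheory ProbabilityTheory Filter Topology
open scoped NNReal ENNReal

noncomputable section

namespace ModulatedQueue

/-! ### The background chain -/

/-- `Q` is a transition rate matrix: nonnegative off the diagonal, with zero row sums. -/
structure IsRateMatrix {d : ℕ} (Q : Matrix (Fin d) (Fin d) ℝ) : Prop where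
  off_diag_nonneg : ∀ i j, i ≠ j → 0 ≤ Q i j
  row_sum : ∀ i, ∑ j, Q i j = 0

/-- Irreducibility: every state can be reached from every state through transitions of
positive rate. -/
def IsIrreducibleRate {d : ℕ} (Q : Matrix (Fin d) (Fin d) ℝ) : Prop :=
  ∀ i j, Relation.ReflTransGen (fun a b => 0 < Q a b) i j

/-- `ϖ` is an invariant probability vector of the rate matrix `Q`. -/
structure IsInvariantProb {d : ℕ} (Q : Matrix (Fin d) (Fin d) ℝ) (ϖ : Fin d → ℝ) : Prop where
  nonneg : ∀ i, 0 ≤ ϖ i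
  sum_eq_one : ∑ i, ϖ i = 1
  invariant : ∀ j, ∑ i, ϖ i * Q i j = 0

/-- The transition probability `p_ij(t)` of the Markov chain with transition rate matrix `Q`:
the `(i, j)` entry of the transition matrix `exp (t Q)`. -/
def transProb {d : ℕ} (Q : Matrix (Fin d) (Fin d) ℝ) (i j : Fin d) (t : ℝ) : ℝ :=
  NormedSpace.exp (t • Q) i j

/-- `J` is a continuous-time Markov chain with transition rate matrix `Q`, initial distribution
`ν` and right-continuous paths. -/
structure IsMarkovChain {d : ℕ} (Q : Matrix (Fin d) (Fin d) ℝ) (ν : Fin d → ℝ)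
    {Ω : Type*} [MeasurableSpace Ω] (P : Measure Ω) (J : ℝ≥0 → Ω → Fin d) : Prop where
  measurable : ∀ t, Measurable (J t)
  right_continuous : ∀ ω t, ContinuousWithinAt (fun s => J s ω) (Set.Ici t) t
  fdd : ∀ (m : ℕ) (τ : ℕ → ℝ≥0), τ 0 = 0 → Monotone τ → ∀ i : ℕ → Fin d,
    P.real {ω | ∀ l ≤ m, J (τ l) ω = i l} =
      ν (i 0) * ∏ l ∈ Finset.range m, transProb Q (i l) (i (l + 1)) ((τ (l + 1) : ℝ) - τ l)

/-! ### Model II -/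

/-- The σ-algebra generated by the whole path of the background process. -/
abbrev pathSigma {d : ℕ} {Ω : Type*} (J : ℝ≥0 → Ω → Fin d) : MeasurableSpace Ω :=
  MeasurableSpace.comap (fun ω t => J t ω) inferInstance

/-- The number of jobs that arrive in the time interval `(a, b]`. -/
def arrivalCount {Ω : Type*} (A : ℕ → Ω → ℝ≥0∞) (a b : ℝ≥0) (ω : Ω) : ℕ∞ :=
  {n : ℕ | (a : ℝ≥0∞) < A n ω ∧ A n ω ≤ b}.encard

/-- The integral of the arrival rate `lam (J s)` over the time interval `(a, b]`. -/
def cumulativeRate {d : ℕ} {Ω : Type*} (lam : Fin d → ℝ) (J : ℝ≥0 → Ω → Fin d)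
    (a b : ℝ≥0) (ω : Ω) : ℝ :=
  ∫ s in (a : ℝ)..b, lam (J s.toNNReal ω)

/-- Model II: while the background process `J` is in state `i`, jobs arrive according to a
Poisson process of rate `lam i`, and a job that enters while `J` is in state `i` has an
exponentially distributed duration with mean `1 / mu i`.

`A n` is the time of the `n`-th arrival, with the value `∞` if there are at most `n` arrivals
(the counting starts at `n = 0`), and `S n` is the duration of the job that arrives at that time.
* Conditionally on the whole path of `J`, the numbers of arrivals in successive time intervals are
  independent and Poisson distributed, with the integrals of `lam (J s)` as their means.
* Durations are sampled upon arrival: the normalised durations `mu (J (A n)) * S n` are independent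
  exponential variables of mean `1`, and they are independent of `J` and of the arrival times
  (if there is no `n`-th arrival, then `S n` is a dummy).
* No job is present at time `0`: all arrivals take place after time `0`. -/
structure IsModelII {d : ℕ} (Q : Matrix (Fin d) (Fin d) ℝ) (ϖ lam mu : Fin d → ℝ)
    {Ω : Type*} [MeasurableSpace Ω] (P : Measure Ω)
    (J : ℝ≥0 → Ω → Fin d) (A : ℕ → Ω → ℝ≥0∞) (S : ℕ → Ω → ℝ) : Prop where
  background : IsMarkovChain Q ϖ P J
  measurable_arrival : ∀ n, Measurable (A n)
  measurable_duration : ∀ n, Measurable (S n)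
  arrival_pos : ∀ n ω, 0 < A n ω
  arrival_mono : ∀ ω, Monotone fun n => A n ω
  arrival_poisson : ∀ (m : ℕ) (τ : ℕ → ℝ≥0), Monotone τ → ∀ k : ℕ → ℕ,
    P⟦{ω | ∀ l < m, arrivalCount A (τ l) (τ (l + 1)) ω = k l} | pathSigma J⟧ =ᵐ[P]
      fun ω => ∏ l ∈ Finset.range m,
        Real.exp (-cumulativeRate lam J (τ l) (τ (l + 1)) ω) *
          cumulativeRate lam J (τ l) (τ (l + 1)) ω ^ k l / (k l).factorial
  duration_exp : ∀ n, HasLaw (fun ω => mu (J (A n ω).toNNReal ω) * S n ω) (expMeasure 1) P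
  duration_iIndep : iIndepFun (fun n ω => mu (J (A n ω).toNNReal ω) * S n ω) P
  duration_indep : IndepFun (fun ω n => mu (J (A n ω).toNNReal ω) * S n ω)
    (fun ω => ((fun t => J t ω), (fun n => A n ω))) P

/-- The set of jobs that are in the system at time `t`: those that arrived at or before time `t`
and depart after time `t`. -/
def jobsPresent {Ω : Type*} (A : ℕ → Ω → ℝ≥0∞) (S : ℕ → Ω → ℝ) (t : ℝ≥0) (ω : Ω) : Set ℕ :=
  {n | A n ω ≤ t ∧ (t : ℝ) < (A n ω).toReal + S n ω}

/-- `M(t)`, the number of jobs in the system at time `t`. -/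
def numJobs {Ω : Type*} (A : ℕ → Ω → ℝ≥0∞) (S : ℕ → Ω → ℝ) (t : ℝ≥0) (ω : Ω) : ℝ :=
  ((jobsPresent A S t ω).ncard : ℝ)

/-! ### The matrices of the covariance formula -/

/-- The exponentially weighted deviation matrix `D^(γ)`. -/
def devMatrix {d : ℕ} (Q : Matrix (Fin d) (Fin d) ℝ) (ϖ γ : Fin d → ℝ) :
    Matrix (Fin d) (Fin d) ℝ :=
  Matrix.of fun i j => ∫ t in Set.Ioi (0 : ℝ), Real.exp (-γ i * t) * (transProb Q i j t - ϖ j)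

/-- The matrix `𝒦(t, u)`. -/
def kMatrix {d : ℕ} (Q : Matrix (Fin d) (Fin d) ℝ) (ϖ mu : Fin d → ℝ) (t u : ℝ) :
    Matrix (Fin d) (Fin d) ℝ :=
  Matrix.of fun i j => ∫ s in (0 : ℝ)..t, ∫ r in (0 : ℝ)..s,
    Real.exp (-mu i * (t + u - r)) * Real.exp (-mu j * (t - s)) *
      (ϖ i * (transProb Q i j (s - r) - ϖ j))

/-- The matrix `ℒ(t, u)`. -/
def lMatrix {d : ℕ} (Q : Matrix (Fin d) (Fin d) ℝ) (ϖ mu : Fin d → ℝ) (t u : ℝ) :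
    Matrix (Fin d) (Fin d) ℝ :=
  Matrix.of fun i j => ∫ s in (0 : ℝ)..t, ∫ r in s..(t + u),
    Real.exp (-mu i * (t + u - r)) * Real.exp (-mu j * (t - s)) *
      (ϖ j * (transProb Q j i (r - s) - ϖ i))

end ModulatedQueue

end

/-! Put `T = t + u`. Given the background path and the arrival times, distinct jobs are present
independently of each other, and a job that arrived at time `s ≤ T` in state `i` is present at `T`
with probability `exp (-μ_i (T - s))`. Expand `M(t) M(T)` over pairs of jobs. A pair of distinct
jobs contributes the product of its conditional probabilities. A single job contributes the
probability that it arrived by `t` and survives until `T`, since it is then also present at `t`.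
This is `IsModelII.lintegral_present_mul`.

What remains are expectations of sums over arrival times. Given the path, arrivals form a Poisson
process, so Campbell's formulas apply: the mean of `∑ φ` is that of `∫ φ λ`, and the mean of `(∑
φ)(∑ ψ)` is that of `∫ φ λ · ∫ ψ λ + ∫ φ ψ λ` (`IsModelII.integral_arrivalSum`,
`IsModelII.integral_arrivalSum_mul`). The hypothesis only gives Poisson counts on intervals. Hence
the formulas are first proved for step functions with path-dependent coefficients, from the first
two Poisson moments, and then carried over by dominated convergence along grids. The term `∫ φ ψ λ`
cancels against the diagonal missing from the pairs of distinct jobs, which gives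
`IsModelII.integral_numJobs_mul`.

The rest is averaging over the chain. Under stationarity the joint law of the states at two times is
`π_i π_j` plus `covKernel`. The product part is what the covariance subtracts. The kernel,
integrated over `[0, t] × [0, t + u]` and cut along the diagonal, gives `𝒦` and `ℒ`
(`integral_covKernel`). The single jobs give the first sum of the formula.

The single-integral forms follow by a shift of variable and an integration by parts
(`integral_triangle_lower`, `integral_triangle_upper`). In these forms the limit `t → ∞` needs only
that `p_ij - π_j` is bounded. That bound is read off the process itself; it uses `π_i > 0`, which
comes from irreducibility. -/

namespace ModulatedQueue

/-! ### Exponential double integrals over triangles, and their limits -/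

section Calculus

variable {q : ℝ → ℝ} {a b : ℝ}

lemma hasDerivAt_primitive_exp_mul (hq : Continuous q) (c x : ℝ) :
    HasDerivAt (fun x => ∫ w in (0 : ℝ)..x, Real.exp (c * w) * q w)
      (Real.exp (c * x) * q x) x :=
  intervalIntegral.integral_hasDerivAt_right
    (Continuous.intervalIntegrable (by fun_prop) _ _)
    (Continuous.stronglyMeasurableAtFilter (by fun_prop) _ _)
    (Continuous.continuousAt (by fun_prop))

lemma hasDerivAt_exp_const_mul_div (hab : a ≠ 0) (s : ℝ) :
    HasDerivAt (fun s => Real.exp (a * s) / a) (Real.exp (a * s)) s := by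
  have h := (((hasDerivAt_id s).const_mul a).exp).div_const a
  simp only [id, mul_one] at h
  rwa [mul_div_assoc, div_self hab, mul_one] at h

/-- Substituting `w = s - r` turns the inner integral into `exp ((a + b) s)` times a primitive `G`
of `exp (-a w) q w`. Integrating by parts in `s` then removes the outer integral. -/
lemma integral_triangle_lower (hq : Continuous q) (ha : 0 < a) (hb : 0 < b) (c t u : ℝ) :
    ∫ s in (0 : ℝ)..t, ∫ r in (0 : ℝ)..s,
      Real.exp (-a * (t + u - r)) * Real.exp (-b * (t - s)) * (c * q (s - r)) =
    1 / (a + b) * Real.exp (-a * u - b * t) * c *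
      ∫ w in (0 : ℝ)..t, (Real.exp (-a * w + b * t) - Real.exp (-a * t + b * w)) * q w := by
  set G : ℝ → ℝ := fun x => ∫ w in (0 : ℝ)..x, Real.exp (-a * w) * q w with hG
  have hGd : ∀ x, HasDerivAt G (Real.exp (-a * x) * q x) x := hasDerivAt_primitive_exp_mul hq _
  have hGc : Continuous G := continuous_iff_continuousAt.2 fun x => (hGd x).continuousAt
  have h1 : ∀ s, ∫ r in (0 : ℝ)..s,
      Real.exp (-a * (t + u - r)) * Real.exp (-b * (t - s)) * (c * q (s - r)) =
      c * Real.exp (-a * (t + u) - b * t) * (Real.exp ((a + b) * s) * G s) := by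
    intro s
    have := intervalIntegral.integral_comp_sub_left
      (fun w => Real.exp (-a * (t + u - (s - w))) * Real.exp (-b * (t - s)) * (c * q w))
      (a := 0) (b := s) s
    simp only [sub_sub_cancel, sub_self, sub_zero] at this
    rw [this, hG]
    simp only
    rw [← mul_assoc, ← intervalIntegral.integral_const_mul]
    refine intervalIntegral.integral_congr fun w _ => ?_
    have : Real.exp (-a * (t + u - (s - w))) * Real.exp (-b * (t - s)) =
        Real.exp (-a * (t + u) - b * t) * Real.exp ((a + b) * s) * Real.exp (-a * w) := by
      rw [← Real.exp_add, ← Real.exp_add, ← Real.exp_add]; ring_nf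
    linear_combination (c * q w) * this
  simp_rw [h1]
  rw [intervalIntegral.integral_const_mul]
  -- The boundary term at `0` vanishes since `G 0 = 0`.
  have hp := intervalIntegral.integral_deriv_mul_eq_sub (a := 0) (b := t)
    (u := fun s => Real.exp ((a + b) * s) / (a + b)) (v := G)
    (u' := fun s => Real.exp ((a + b) * s)) (v' := fun x => Real.exp (-a * x) * q x)
    (fun x _ => hasDerivAt_exp_const_mul_div (by positivity) x) (fun x _ => hGd x)
    (Continuous.intervalIntegrable (by fun_prop) _ _)
    (Continuous.intervalIntegrable (by fun_prop) _ _)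
  rw [intervalIntegral.integral_add (Continuous.intervalIntegrable (by fun_prop) _ _)
    (Continuous.intervalIntegrable (by fun_prop) _ _)] at hp
  have hG0 : G 0 = 0 := by simp [hG]
  have h2 : ∫ x in (0 : ℝ)..t, Real.exp ((a + b) * x) / (a + b) * (Real.exp (-a * x) * q x) =
      1 / (a + b) * ∫ x in (0 : ℝ)..t, Real.exp (b * x) * q x := by
    rw [← intervalIntegral.integral_const_mul]
    refine intervalIntegral.integral_congr fun w _ => ?_
    rw [show b * w = (a + b) * w + -a * w by ring, Real.exp_add]
    ring
  have h3 : ∫ w in (0 : ℝ)..t,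
      (Real.exp (-a * w + b * t) - Real.exp (-a * t + b * w)) * q w =
      Real.exp (b * t) * G t - Real.exp (-a * t) * ∫ x in (0 : ℝ)..t, Real.exp (b * x) * q x := by
    rw [hG]
    simp only
    rw [← intervalIntegral.integral_const_mul, ← intervalIntegral.integral_const_mul,
      ← intervalIntegral.integral_sub (Continuous.intervalIntegrable (by fun_prop) _ _)
      (Continuous.intervalIntegrable (by fun_prop) _ _)]
    refine intervalIntegral.integral_congr fun w _ => ?_
    simp only [Real.exp_add]
    ring
  rw [h2, hG0] at hp
  rw [h3, eq_sub_of_add_eq hp]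
  have e1 : Real.exp (-a * (t + u) - b * t) = Real.exp (-a * u - b * t) * Real.exp (-a * t) := by
    rw [← Real.exp_add]; ring_nf
  have e2 : Real.exp (-a * t) * Real.exp ((a + b) * t) = Real.exp (b * t) := by
    rw [← Real.exp_add]; ring_nf
  rw [e1, ← e2]
  ring

/-- The same method with `w = r - s`. Here both boundary terms survive: `s = t` gives `H u`, the
integral over `[0, u]`, and `s = 0` gives `H (t + u)`, which is regrouped as `H u` plus an integral
over `[u, t + u]`. -/
lemma integral_triangle_upper (hq : Continuous q) (ha : 0 < a) (hb : 0 < b) (c t u : ℝ) :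
    ∫ s in (0 : ℝ)..t, ∫ r in s..(t + u),
      Real.exp (-a * (t + u - r)) * Real.exp (-b * (t - s)) * (c * q (r - s)) =
    1 / (a + b) * Real.exp (-a * u) * c * (1 - Real.exp (-(a + b) * t)) *
        (∫ w in (0 : ℝ)..u, Real.exp (a * w) * q w)
      + 1 / (a + b) * c * ∫ w in u..(t + u),
        (Real.exp (b * (u - w)) - Real.exp (a * (w - u - t) - b * t)) * q w := by
  set H : ℝ → ℝ := fun x => ∫ w in (0 : ℝ)..x, Real.exp (a * w) * q w with hH
  have hHd : ∀ x, HasDerivAt H (Real.exp (a * x) * q x) x := hasDerivAt_primitive_exp_mul hq _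
  have hHc : Continuous H := continuous_iff_continuousAt.2 fun x => (hHd x).continuousAt
  have h1 : ∀ s, ∫ r in s..(t + u),
      Real.exp (-a * (t + u - r)) * Real.exp (-b * (t - s)) * (c * q (r - s)) =
      c * Real.exp (-a * (t + u) - b * t) * (Real.exp ((a + b) * s) * H (t + u - s)) := by
    intro s
    have := intervalIntegral.integral_comp_sub_right
      (fun w => Real.exp (-a * (t + u - (w + s))) * Real.exp (-b * (t - s)) * (c * q w))
      (a := s) (b := t + u) s
    simp only [sub_add_cancel, sub_self] at this
    rw [this, hH]
    simp only
    rw [← mul_assoc, ← intervalIntegral.integral_const_mul]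
    refine intervalIntegral.integral_congr fun w _ => ?_
    have : Real.exp (-a * (t + u - (w + s))) * Real.exp (-b * (t - s)) =
        Real.exp (-a * (t + u) - b * t) * Real.exp ((a + b) * s) * Real.exp (a * w) := by
      rw [← Real.exp_add, ← Real.exp_add, ← Real.exp_add]; ring_nf
    linear_combination (c * q w) * this
  simp_rw [h1]
  rw [intervalIntegral.integral_const_mul]
  have hvd : ∀ s, HasDerivAt (fun s => H (t + u - s))
      (-(Real.exp (a * (t + u - s)) * q (t + u - s))) s := by
    intro s
    have := (hHd (t + u - s)).comp_const_sub (t + u) s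
    exact this
  have hp := intervalIntegral.integral_deriv_mul_eq_sub (a := 0) (b := t)
    (u := fun s => Real.exp ((a + b) * s) / (a + b)) (v := fun s => H (t + u - s))
    (u' := fun s => Real.exp ((a + b) * s))
    (v' := fun s => -(Real.exp (a * (t + u - s)) * q (t + u - s)))
    (fun x _ => hasDerivAt_exp_const_mul_div (by positivity) x) (fun x _ => hvd x)
    (Continuous.intervalIntegrable (by fun_prop) _ _)
    (Continuous.intervalIntegrable (by fun_prop) _ _)
  rw [intervalIntegral.integral_add (Continuous.intervalIntegrable (by fun_prop) _ _)
    (Continuous.intervalIntegrable (by fun_prop) _ _)] at hp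
  have h2 : ∫ s in (0 : ℝ)..t, Real.exp ((a + b) * s) / (a + b) *
      -(Real.exp (a * (t + u - s)) * q (t + u - s)) =
      -(1 / (a + b) * Real.exp ((a + b) * t + a * u) *
        ∫ w in u..(t + u), Real.exp (b * (u - w)) * q w) := by
    have := intervalIntegral.integral_comp_sub_left
      (fun w => Real.exp ((a + b) * (t + u - w)) / (a + b) *
      -(Real.exp (a * w) * q w)) (a := 0) (b := t) (t + u)
    simp only [sub_sub_cancel, sub_zero, add_sub_cancel_left] at this
    rw [this, ← intervalIntegral.integral_const_mul, ← intervalIntegral.integral_neg]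
    refine intervalIntegral.integral_congr fun w _ => ?_
    have : Real.exp ((a + b) * (t + u - w)) * Real.exp (a * w) =
      Real.exp ((a + b) * t + a * u) * Real.exp (b * (u - w)) := by
      rw [← Real.exp_add, ← Real.exp_add]; ring_nf
    linear_combination (-q w / (a + b)) * this
  have h3 : ∫ w in u..(t + u),
      (Real.exp (b * (u - w)) - Real.exp (a * (w - u - t) - b * t)) * q w =
      (∫ w in u..(t + u), Real.exp (b * (u - w)) * q w) -
        Real.exp (-a * (u + t) - b * t) * (H (t + u) - H u) := by
    rw [hH]
    simp only
    rw [intervalIntegral.integral_interval_sub_left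
      (Continuous.intervalIntegrable (by fun_prop) _ _)
      (Continuous.intervalIntegrable (by fun_prop) _ _),
      ← intervalIntegral.integral_const_mul,
      ← intervalIntegral.integral_sub (Continuous.intervalIntegrable (by fun_prop) _ _)
      (Continuous.intervalIntegrable (by fun_prop) _ _)]
    refine intervalIntegral.integral_congr fun w _ => ?_
    rw [sub_mul, ← mul_assoc, ← Real.exp_add]
    ring_nf
  rw [h2] at hp
  simp only [sub_zero, mul_zero, Real.exp_zero, add_sub_cancel_left] at hp
  rw [h3, eq_sub_of_add_eq hp]
  have e1 : Real.exp (-a * (t + u) - b * t) = Real.exp (-a * u) * Real.exp (-(a + b) * t) := by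
    rw [← Real.exp_add]; ring_nf
  have e2 : Real.exp (-a * (u + t) - b * t) = Real.exp (-a * u) * Real.exp (-(a + b) * t) := by
    rw [← Real.exp_add]; ring_nf
  have e3 : Real.exp ((a + b) * t + a * u) = Real.exp ((a + b) * t) * Real.exp (a * u) := by
    rw [← Real.exp_add]
  have e4 : Real.exp (-(a + b) * t) * Real.exp ((a + b) * t) = 1 := by
    rw [← Real.exp_add, ← Real.exp_zero]; ring_nf
  have e5 : Real.exp (-a * u) * Real.exp (a * u) = 1 := by
    rw [← Real.exp_add, ← Real.exp_zero]; ring_nf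
  have hab : a + b ≠ 0 := by positivity
  rw [e1, e2, e3]
  -- With the exponentials as atoms, the identity is algebraic modulo the inverse relations `e4` and
  -- `e5`.
  generalize Real.exp (-a * u) = x1 at *
  generalize Real.exp (-(a + b) * t) = x2 at *
  generalize Real.exp ((a + b) * t) = x3 at *
  generalize Real.exp (a * u) = x4 at *
  generalize (∫ w in u..(t + u), Real.exp (b * (u - w)) * q w) = I
  field_simp
  linear_combination (c * x1 * H u + c * x1 * x4 * I) * e4 + c * I * e5

lemma integrableOn_exp_neg_mul_bounded (hq : Continuous q) {C : ℝ}
    (hC : ∀ w, 0 ≤ w → |q w| ≤ C) (ha : 0 < a) (v : ℝ) (hv : 0 ≤ v) :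
    IntegrableOn (fun w => Real.exp (-a * w) * q w) (Set.Ioi v) := by
  refine Integrable.mul_bdd (c := C) (integrableOn_exp_mul_Ioi (by linarith) v)
    hq.aestronglyMeasurable ?_
  filter_upwards [ae_restrict_mem measurableSet_Ioi] with w hw
  exact hC w (hv.trans (le_of_lt hw))

/-- The growth `exp (a * y)` of this bound is exactly cancelled by the decaying prefactor of the
remainder terms in the two limits below. -/
lemma abs_integral_exp_mul_le {C : ℝ}
    (hC : ∀ w, 0 ≤ w → |q w| ≤ C) (ha : 0 < a) {x y : ℝ} (hx : 0 ≤ x) (hxy : x ≤ y) :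
    |∫ w in x..y, Real.exp (a * w) * q w| ≤ Real.exp (a * y) / a * C := by
  have hC0 : 0 ≤ C := (abs_nonneg _).trans (hC 0 le_rfl)
  calc |∫ w in x..y, Real.exp (a * w) * q w|
      ≤ ∫ w in x..y, Real.exp (a * w) * C := by
        have hi : IntervalIntegrable (fun w : ℝ => Real.exp (a * w) * C) volume x y :=
          Continuous.intervalIntegrable (by fun_prop) _ _
        rw [← Real.norm_eq_abs]
        refine intervalIntegral.norm_integral_le_of_norm_le hxy ?_ hi
        refine ae_of_all _ fun w hw => ?_
        rw [norm_mul, Real.norm_of_nonneg (Real.exp_pos _).le]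
        exact mul_le_mul_of_nonneg_left (hC w (hx.trans hw.1.le)) (Real.exp_pos _).le
    _ = (Real.exp (a * y) / a - Real.exp (a * x) / a) * C := by
        rw [intervalIntegral.integral_mul_const,
          intervalIntegral.integral_eq_sub_of_hasDerivAt
            (fun s _ => hasDerivAt_exp_const_mul_div ha.ne' s)
            (Continuous.intervalIntegrable (by fun_prop) _ _)]
    _ ≤ Real.exp (a * y) / a * C := by
        gcongr
        have : 0 ≤ Real.exp (a * x) / a := by positivity
        linarith

lemma tendsto_exp_neg_mul_atTop (ha : 0 < a) :
    Tendsto (fun t : ℝ => Real.exp (-a * t)) atTop (𝓝 0) := by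
  refine Real.tendsto_exp_atBot.comp ?_
  exact tendsto_id.const_mul_atTop_of_neg (by linarith)

/-- Once the prefactor is distributed, one integral converges to the improper one, and the other is
`exp (-a t)` times a quantity bounded by `C / b`. No decay of `q` is needed. -/
lemma tendsto_triangle_lower (hq : Continuous q) {C : ℝ} (hC : ∀ w, 0 ≤ w → |q w| ≤ C)
    (ha : 0 < a) (hb : 0 < b) (c u : ℝ) :
    Tendsto (fun t : ℝ => 1 / (a + b) * Real.exp (-a * u - b * t) * c *
      ∫ w in (0 : ℝ)..t, (Real.exp (-a * w + b * t) - Real.exp (-a * t + b * w)) * q w) atTop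
      (𝓝 (c * (1 / (a + b)) * Real.exp (-a * u) *
        ∫ w in Set.Ioi (0 : ℝ), Real.exp (-a * w) * q w)) := by
  have key : ∀ t : ℝ, 1 / (a + b) * Real.exp (-a * u - b * t) * c *
      ∫ w in (0 : ℝ)..t, (Real.exp (-a * w + b * t) - Real.exp (-a * t + b * w)) * q w =
      c * (1 / (a + b)) * Real.exp (-a * u) * ((∫ w in (0 : ℝ)..t, Real.exp (-a * w) * q w)
        - Real.exp (-a * t) * (Real.exp (-b * t) * ∫ w in (0 : ℝ)..t, Real.exp (b * w) * q w)) := by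
    intro t
    have : ∫ w in (0 : ℝ)..t, (Real.exp (-a * w + b * t) - Real.exp (-a * t + b * w)) * q w =
        Real.exp (b * t) * (∫ w in (0 : ℝ)..t, Real.exp (-a * w) * q w) -
        Real.exp (-a * t) * ∫ w in (0 : ℝ)..t, Real.exp (b * w) * q w := by
      rw [← intervalIntegral.integral_const_mul, ← intervalIntegral.integral_const_mul,
        ← intervalIntegral.integral_sub (Continuous.intervalIntegrable (by fun_prop) _ _)
        (Continuous.intervalIntegrable (by fun_prop) _ _)]
      refine intervalIntegral.integral_congr fun w _ => ?_
      simp only [Real.exp_add]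
      ring
    rw [this]
    have e1 : Real.exp (-a * u - b * t) = Real.exp (-a * u) * Real.exp (-b * t) := by
      rw [← Real.exp_add]; ring_nf
    have e2 : Real.exp (-b * t) * Real.exp (b * t) = 1 := by
      rw [← Real.exp_add, ← Real.exp_zero]; ring_nf
    rw [e1]
    linear_combination (c * (1 / (a + b)) * Real.exp (-a * u) *
      ∫ w in (0 : ℝ)..t, Real.exp (-a * w) * q w) * e2
  simp_rw [key]
  refine Tendsto.const_mul _ ?_
  rw [← sub_zero (∫ w in Set.Ioi (0 : ℝ), Real.exp (-a * w) * q w)]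
  refine Tendsto.sub ?_ ?_
  · exact intervalIntegral_tendsto_integral_Ioi 0
      (integrableOn_exp_neg_mul_bounded hq hC ha 0 le_rfl) tendsto_id
  · refine Tendsto.zero_mul_isBoundedUnder_le (tendsto_exp_neg_mul_atTop ha) ?_
    refine ⟨C / b, eventually_map.2 ?_⟩
    filter_upwards [eventually_ge_atTop 0] with t ht
    simp only [Function.comp, Real.norm_eq_abs, abs_mul, Real.abs_exp]
    calc _ ≤ Real.exp (-b * t) * (Real.exp (b * t) / b * C) := by
            gcongr
            exact abs_integral_exp_mul_le hC hb le_rfl ht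
      _ = C / b := by
            have e2 : Real.exp (-b * t) * Real.exp (b * t) = 1 := by
              rw [← Real.exp_add, ← Real.exp_zero]; ring_nf
            linear_combination (C / b) * e2

lemma tendsto_triangle_upper (hq : Continuous q) {C : ℝ} (hC : ∀ w, 0 ≤ w → |q w| ≤ C)
    (ha : 0 < a) (hb : 0 < b) (c : ℝ) {u : ℝ} (hu : 0 ≤ u) :
    Tendsto (fun t : ℝ => 1 / (a + b) * Real.exp (-a * u) * c * (1 - Real.exp (-(a + b) * t)) *
        (∫ w in (0 : ℝ)..u, Real.exp (a * w) * q w)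
      + 1 / (a + b) * c * ∫ w in u..(t + u),
        (Real.exp (b * (u - w)) - Real.exp (a * (w - u - t) - b * t)) * q w) atTop
      (𝓝 (c * (1 / (a + b)) * (∫ w in (0 : ℝ)..u, Real.exp (-a * u + a * w) * q w)
        + c * (1 / (a + b)) * ∫ w in Set.Ioi u, Real.exp (b * u - b * w) * q w)) := by
  refine Tendsto.add ?_ ?_
  · have e : ∫ w in (0 : ℝ)..u, Real.exp (-a * u + a * w) * q w =
        Real.exp (-a * u) * ∫ w in (0 : ℝ)..u, Real.exp (a * w) * q w := by
      rw [← intervalIntegral.integral_const_mul]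
      simp only [Real.exp_add, mul_assoc]
    rw [e]
    have := (((tendsto_exp_neg_mul_atTop (add_pos ha hb)).const_sub 1).const_mul
      (1 / (a + b) * Real.exp (-a * u) * c)).mul_const
      (∫ w in (0 : ℝ)..u, Real.exp (a * w) * q w)
    convert this using 2
    ring
  · have key : ∀ t : ℝ, ∫ w in u..(t + u),
        (Real.exp (b * (u - w)) - Real.exp (a * (w - u - t) - b * t)) * q w =
        (∫ w in u..(t + u), Real.exp (b * u) * (Real.exp (-b * w) * q w)) -
        Real.exp (-b * t) * (Real.exp (-a * (u + t)) *
          ∫ w in u..(t + u), Real.exp (a * w) * q w) := by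
      intro t
      rw [← mul_assoc, ← intervalIntegral.integral_const_mul,
        ← intervalIntegral.integral_sub (Continuous.intervalIntegrable (by fun_prop) _ _)
        (Continuous.intervalIntegrable (by fun_prop) _ _)]
      refine intervalIntegral.integral_congr fun w _ => ?_
      rw [sub_mul, ← mul_assoc, ← mul_assoc, ← Real.exp_add, ← Real.exp_add, ← Real.exp_add]
      ring_nf
    simp_rw [key]
    have e : ∫ w in Set.Ioi u, Real.exp (b * u - b * w) * q w =
        ∫ w in Set.Ioi u, Real.exp (b * u) * (Real.exp (-b * w) * q w) := by
      congr 1 with w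
      rw [← mul_assoc, ← Real.exp_add]
      ring_nf
    rw [e, mul_comm c]
    refine Tendsto.const_mul _ ?_
    rw [← sub_zero (∫ w in Set.Ioi u, _)]
    refine Tendsto.sub ?_ ?_
    · exact intervalIntegral_tendsto_integral_Ioi u
        ((integrableOn_exp_neg_mul_bounded hq hC hb u hu).const_mul _)
        (tendsto_atTop_add_const_right _ _ tendsto_id)
    · refine Tendsto.zero_mul_isBoundedUnder_le (tendsto_exp_neg_mul_atTop hb) ?_
      refine ⟨C / a, eventually_map.2 ?_⟩
      filter_upwards [eventually_ge_atTop 0] with t ht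
      simp only [Function.comp, Real.norm_eq_abs, abs_mul, Real.abs_exp]
      calc _ ≤ Real.exp (-a * (u + t)) * (Real.exp (a * (t + u)) / a * C) := by
              gcongr
              exact abs_integral_exp_mul_le hC ha hu (by linarith)
        _ = C / a := by
              have e2 : Real.exp (-a * (u + t)) * Real.exp (a * (t + u)) = 1 := by
                rw [← Real.exp_add]; ring_nf; simp
              linear_combination (C / a) * e2

end Calculus

/-! ### The transition matrix and the invariant vector -/

section TransitionMatrix

variable {d : ℕ} {Q : Matrix (Fin d) (Fin d) ℝ} {ϖ : Fin d → ℝ}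

lemma continuous_transProb (Q : Matrix (Fin d) (Fin d) ℝ) (i j : Fin d) :
    Continuous (transProb Q i j) := by
  -- The norm is auxiliary: it makes the matrices a Banach algebra, where the exponential is
  -- continuous.
  let _ : NormedRing (Matrix (Fin d) (Fin d) ℝ) := Matrix.linftyOpNormedRing
  let _ : NormedAlgebra ℝ (Matrix (Fin d) (Fin d) ℝ) := Matrix.linftyOpNormedAlgebra
  let _ : NormedAlgebra ℚ (Matrix (Fin d) (Fin d) ℝ) := NormedAlgebra.restrictScalars ℚ ℝ _
  have h : Continuous fun t : ℝ => NormedSpace.exp (t • Q) :=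
    NormedSpace.exp_continuous.comp (continuous_id.smul continuous_const)
  exact (continuous_apply j).comp ((continuous_apply i).comp h)

lemma transProb_zero (Q : Matrix (Fin d) (Fin d) ℝ) (i j : Fin d) :
    transProb Q i j 0 = if i = j then 1 else 0 := by
  let _ : NormedRing (Matrix (Fin d) (Fin d) ℝ) := Matrix.linftyOpNormedRing
  let _ : NormedAlgebra ℝ (Matrix (Fin d) (Fin d) ℝ) := Matrix.linftyOpNormedAlgebra
  let _ : NormedAlgebra ℚ (Matrix (Fin d) (Fin d) ℝ) := NormedAlgebra.restrictScalars ℚ ℝ _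
  rw [transProb, zero_smul, NormedSpace.exp_zero, Matrix.one_apply]

/-- Since `ϖ Q = 0`, every term of the exponential series except the zeroth is annihilated by `ϖ`.
-/
lemma IsInvariantProb.sum_mul_transProb (h : IsInvariantProb Q ϖ) (j : Fin d) (t : ℝ) :
    ∑ i, ϖ i * transProb Q i j t = ϖ j := by
  let _ : NormedRing (Matrix (Fin d) (Fin d) ℝ) := Matrix.linftyOpNormedRing
  let _ : NormedAlgebra ℝ (Matrix (Fin d) (Fin d) ℝ) := Matrix.linftyOpNormedAlgebra
  have hs := NormedSpace.exp_series_hasSum_exp' (𝕂 := ℝ) (t • Q)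
  have hs2 : HasSum (fun n : ℕ => ∑ i, ϖ i * ((n.factorial : ℝ)⁻¹ • (t • Q) ^ n) i j)
      (∑ i, ϖ i * transProb Q i j t) := by
    refine hasSum_sum fun i _ => HasSum.mul_left _ ?_
    exact hs.map (⟨⟨fun M : Matrix (Fin d) (Fin d) ℝ => M i j, rfl⟩, fun _ _ => rfl⟩ :
      Matrix (Fin d) (Fin d) ℝ →+ ℝ) ((continuous_apply j).comp (continuous_apply i))
  refine hs2.unique ?_
  have h0 : ϖ j = ∑ i, ϖ i * (((0 : ℕ).factorial : ℝ)⁻¹ • (t • Q) ^ 0) i j := by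
    simp [Matrix.one_apply]
  rw [h0]
  refine hasSum_single 0 fun n hn => ?_
  obtain ⟨n, rfl⟩ := Nat.exists_eq_succ_of_ne_zero hn
  have hv : Matrix.vecMul ϖ Q = 0 := by
    ext k
    simpa [Matrix.vecMul, dotProduct] using h.invariant k
  have : Matrix.vecMul ϖ ((((n + 1).factorial : ℝ)⁻¹) • (t • Q) ^ (n + 1)) = 0 := by
    rw [Matrix.vecMul_smul, pow_succ', ← Matrix.vecMul_vecMul, Matrix.vecMul_smul, hv]
    simp
  simpa [Matrix.vecMul, dotProduct] using congrFun this j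

/-- Zeros of `ϖ` propagate backwards along positive rates: if `ϖ b = 0`, the balance equation at `b`
is a vanishing sum of nonnegative terms. By irreducibility one zero would force `ϖ = 0`, against
total mass `1`. -/
lemma IsInvariantProb.pos (h : IsInvariantProb Q ϖ) (hQ : IsRateMatrix Q)
    (hirr : IsIrreducibleRate Q) (i : Fin d) : 0 < ϖ i := by
  by_contra hi
  have hi0 : ϖ i = 0 := le_antisymm (not_lt.1 hi) (h.nonneg i)
  have step : ∀ a b, 0 < Q a b → ϖ b = 0 → ϖ a = 0 := by
    intro a b hab hb
    have hinv := h.invariant b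
    have hnn : ∀ k ∈ Finset.univ, 0 ≤ ϖ k * Q k b := by
      intro k _
      rcases eq_or_ne k b with rfl | hk
      · simp [hb]
      · exact mul_nonneg (h.nonneg k) (hQ.off_diag_nonneg k b hk)
    have := (Finset.sum_eq_zero_iff_of_nonneg hnn).1 hinv a (Finset.mem_univ _)
    exact (mul_eq_zero.1 this).resolve_right hab.ne'
  have hall : ∀ k, ϖ k = 0 := by
    intro k
    have hr := hirr k i
    induction hr using Relation.ReflTransGen.head_induction_on with
    | refl => exact hi0
    | head hab _ ih => exact step _ _ hab ih
  have := h.sum_eq_one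
  simp [hall] at this

end TransitionMatrix

/-! ### One- and two-time laws of the stationary chain -/

section Chain

variable {d : ℕ} {Q : Matrix (Fin d) (Fin d) ℝ} {ϖ : Fin d → ℝ}
  {Ω : Type*} [MeasurableSpace Ω] {P : Measure Ω}
  {J : ℝ≥0 → Ω → Fin d}

lemma IsMarkovChain.prob_zero_and (h : IsMarkovChain Q ϖ P J) (s : ℝ≥0) (k i : Fin d) :
    P.real {ω | J 0 ω = k ∧ J s ω = i} = ϖ k * transProb Q k i s := by
  have := h.fdd 1 (fun l => if l = 0 then 0 else s) rfl
    (by intro a b hab; dsimp only; split_ifs <;> first | omega | simp)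
    (fun l => if l = 0 then k else i)
  simp only [Finset.prod_range_one] at this
  simp only [if_true, zero_add, one_ne_zero, if_false, NNReal.coe_zero, sub_zero] at this
  rw [← this]
  congr 1 with ω
  simp only [Set.mem_ofPred_eq]
  constructor
  · rintro ⟨h0, h1⟩ l hl
    interval_cases l <;> simpa
  · intro hl
    exact ⟨by simpa using hl 0 (by norm_num), by simpa using hl 1 le_rfl⟩

lemma IsMarkovChain.prob_zero_and_and (h : IsMarkovChain Q ϖ P J) {s r : ℝ≥0} (hsr : s ≤ r)
    (k i j : Fin d) : P.real {ω | J 0 ω = k ∧ J s ω = i ∧ J r ω = j} =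
      ϖ k * transProb Q k i s * transProb Q i j (r - s) := by
  have := h.fdd 2 (fun l => if l = 0 then 0 else if l = 1 then s else r) rfl
    (by intro a b hab; dsimp only; split_ifs <;> first | omega | simp)
    (fun l => if l = 0 then k else if l = 1 then i else j)
  simp only [Finset.prod_range_succ, Finset.prod_range_zero, one_mul] at this
  simp only [if_true, zero_add, one_ne_zero, if_false, NNReal.coe_zero, sub_zero,
    Nat.reduceAdd, OfNat.ofNat_ne_zero, OfNat.ofNat_ne_one] at this
  rw [mul_assoc, ← this]
  congr 1 with ω
  simp only [Set.mem_ofPred_eq]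
  constructor
  · rintro ⟨h0, h1, h2⟩ l hl
    interval_cases l <;> simpa
  · intro hl
    exact ⟨by simpa using hl 0 (by norm_num), by simpa using hl 1 (by norm_num),
      by simpa using hl 2 le_rfl⟩

lemma measurableSet_state (hJ : ∀ t, Measurable (J t)) (t : ℝ≥0) (i : Fin d) :
    MeasurableSet {ω | J t ω = i} := hJ t (measurableSet_singleton i)

/-- Finite-dimensional laws are given only for time vectors that start at `0`; summing over the
initial state removes it. -/
lemma measureReal_eq_sum_state [IsFiniteMeasure P] (hJ : ∀ t, Measurable (J t)) (t : ℝ≥0) (B : Set Ω) :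
    P.real B = ∑ k, P.real {ω | J t ω = k ∧ ω ∈ B} := by
  have := sum_measureReal_preimage_singleton (μ := P.restrict B) (f := J t) Finset.univ
    (fun k _ => measurableSet_state hJ t k)
  simp only [Finset.coe_univ, Set.preimage_univ] at this
  rw [measureReal_restrict_apply MeasurableSet.univ, Set.univ_inter] at this
  rw [← this]
  refine Finset.sum_congr rfl fun k _ => ?_
  exact measureReal_restrict_apply (measurableSet_state hJ t k)

lemma IsMarkovChain.prob_eq [IsFiniteMeasure P] (h : IsMarkovChain Q ϖ P J) (hϖ : IsInvariantProb Q ϖ)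
    (s : ℝ≥0) (i : Fin d) : P.real {ω | J s ω = i} = ϖ i := by
  rw [measureReal_eq_sum_state h.measurable 0]
  exact (Finset.sum_congr rfl fun k _ => h.prob_zero_and s k i).trans
    (hϖ.sum_mul_transProb i s)

lemma IsMarkovChain.prob_and [IsFiniteMeasure P] (h : IsMarkovChain Q ϖ P J) (hϖ : IsInvariantProb Q ϖ)
    {s r : ℝ≥0} (hsr : s ≤ r) (i j : Fin d) :
    P.real {ω | J s ω = i ∧ J r ω = j} = ϖ i * transProb Q i j (r - s) := by
  rw [measureReal_eq_sum_state h.measurable 0]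
  refine (Finset.sum_congr rfl fun k _ => h.prob_zero_and_and hsr k i j).trans ?_
  rw [← Finset.sum_mul, hϖ.sum_mul_transProb]

/-- No analysis of the matrix exponential is needed: `ϖ i * transProb Q i j t` is the probability of
a subevent of `{J 0 = i}`, which has probability `ϖ i > 0`. -/
lemma IsMarkovChain.transProb_mem_Icc [IsFiniteMeasure P] (h : IsMarkovChain Q ϖ P J) {i : Fin d} (hi : 0 < ϖ i)
    (j : Fin d) {t : ℝ} (ht : 0 ≤ t) : transProb Q i j t ∈ Set.Icc 0 1 := by
  lift t to ℝ≥0 using ht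
  have h0 := h.prob_zero_and t i j
  have hϖi : P.real {ω | J 0 ω = i ∧ J 0 ω = i} = ϖ i := by
    rw [h.prob_zero_and 0 i i, NNReal.coe_zero, transProb_zero, if_pos rfl, mul_one]
  have hnn : 0 ≤ ϖ i * transProb Q i j t := by rw [← h0]; exact measureReal_nonneg
  have hle : ϖ i * transProb Q i j t ≤ ϖ i := by
    rw [← h0]
    exact (measureReal_mono (fun ω hω => ⟨hω.1, hω.1⟩ :
      {ω | J 0 ω = i ∧ J t ω = j} ⊆ {ω | J 0 ω = i ∧ J 0 ω = i})).trans hϖi.le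
  constructor
  · exact nonneg_of_mul_nonneg_right hnn hi
  · exact le_of_mul_le_mul_left (by rwa [mul_one]) hi

end Chain

/-! ### Approximation of times from the right, and joint measurability -/

section Grid

/-- The point of the grid `(k + 1)⁻¹ ℕ` that follows `s`. -/
noncomputable def gridCeil (k : ℕ) (s : ℝ≥0) : ℝ≥0 := (⌈s * (k + 1)⌉₊ : ℝ≥0) / (k + 1)

lemma le_gridCeil (k : ℕ) (s : ℝ≥0) : s ≤ gridCeil k s := by
  rw [gridCeil, le_div_iff₀ (by positivity)]
  exact Nat.le_ceil _

lemma gridCeil_le (k : ℕ) (s : ℝ≥0) : gridCeil k s ≤ s + 1 / (k + 1) := by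
  rw [gridCeil, div_le_iff₀ (by positivity), add_mul, one_div, inv_mul_cancel₀ (by positivity)]
  exact (Nat.ceil_lt_add_one (by positivity)).le

lemma tendsto_gridCeil (s : ℝ≥0) :
    Tendsto (fun k => gridCeil k s) atTop (𝓝[Set.Ici s] s) := by
  refine tendsto_nhdsWithin_iff.2 ⟨?_, Eventually.of_forall fun k => le_gridCeil k s⟩
  refine tendsto_of_tendsto_of_tendsto_of_le_of_le tendsto_const_nhds ?_
    (fun k => le_gridCeil k s) (fun k => gridCeil_le k s)
  have : Tendsto (fun k : ℕ => 1 / ((k : ℝ≥0) + 1)) atTop (𝓝 0) :=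
    tendsto_one_div_add_atTop_nhds_zero_nat
  simpa using this.const_add s

variable {d : ℕ} {Ω : Type*} {J : ℝ≥0 → Ω → Fin d}

lemma eventually_gridCeil_state
    (hr : ∀ ω t, ContinuousWithinAt (fun s => J s ω) (Set.Ici t) t) (ω : Ω) (s : ℝ≥0) :
    ∀ᶠ k in atTop, J (gridCeil k s) ω = J s ω := by
  have := (hr ω s).tendsto.comp (tendsto_gridCeil s)
  -- The state space is discrete, so convergence is eventual equality.
  rw [nhds_discrete, tendsto_pure] at this
  exact this

/-- Reading the path at the next grid point involves only countably many times, hence is jointly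
measurable; right-continuity gives the limit. The σ-algebra is a parameter because the result is
also used for those generated by the path and by the path with the arrival times. -/
lemma measurable_uncurry_of_right_continuous (m : MeasurableSpace Ω)
    (hJ : ∀ t, Measurable (J t))
    (hr : ∀ ω t, ContinuousWithinAt (fun s => J s ω) (Set.Ici t) t) :
    Measurable fun p : ℝ≥0 × Ω => J p.1 p.2 := by
  refine measurable_of_tendsto_metrizable
    (f := fun (k : ℕ) (p : ℝ≥0 × Ω) => J (gridCeil k p.1) p.2) (fun k => ?_) ?_
  · have h1 : Measurable fun p : ℕ × Ω => J ((p.1 : ℝ≥0) / (k + 1)) p.2 :=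
      measurable_from_prod_countable_right fun n => hJ ((n : ℝ≥0) / (k + 1))
    have h2 : Measurable fun p : ℝ≥0 × Ω => (⌈p.1 * (k + 1)⌉₊, p.2) :=
      (Nat.measurable_ceil.comp (measurable_fst.mul_const _)).prodMk measurable_snd
    have h := h1.comp h2
    simp only [Function.comp_def] at h
    simpa only [gridCeil] using h
  · refine tendsto_pi_nhds.2 fun p => tendsto_nhds_of_eventually_eq ?_
    exact eventually_gridCeil_state hr p.2 p.1

end Grid

/-! ### First two moments of the Poisson distribution -/

section PoissonMoments

/-- The weights of the Poisson distribution with mean `x`. -/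
noncomputable def poissonWeight (x : ℝ) (k : ℕ) : ℝ := Real.exp (-x) * x ^ k / k.factorial

lemma poissonWeight_nonneg {x : ℝ} (hx : 0 ≤ x) (k : ℕ) : 0 ≤ poissonWeight x k := by
  unfold poissonWeight; positivity

lemma hasSum_poissonWeight {x : ℝ} (hx : 0 ≤ x) : HasSum (poissonWeight x) 1 :=
  hasSum_one_poissonMeasure ⟨x, hx⟩

lemma hasSum_natCast_mul_poissonWeight {x : ℝ} (hx : 0 ≤ x) :
    HasSum (fun k : ℕ => (k : ℝ) * poissonWeight x k) x := by
  rw [← hasSum_nat_add_iff' 1]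
  simp only [Finset.sum_range_one, Nat.cast_zero, zero_mul, sub_zero]
  have h := (hasSum_poissonWeight hx).mul_left x
  rw [mul_one] at h
  refine h.congr_fun fun k => ?_
  simp only [poissonWeight, Nat.factorial_succ]
  push_cast
  have : ((k : ℝ) + 1) ≠ 0 := by positivity
  have : (k.factorial : ℝ) ≠ 0 := by positivity
  field_simp
  ring

/-- Shifting the index, `(k + 1)² w(k + 1) = x (k + 1) w(k)` reduces the claim to the mean and the
total mass. -/
lemma hasSum_sq_mul_poissonWeight {x : ℝ} (hx : 0 ≤ x) :
    HasSum (fun k : ℕ => (k : ℝ) ^ 2 * poissonWeight x k) (x ^ 2 + x) := by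
  rw [← hasSum_nat_add_iff' 1]
  simp only [Finset.sum_range_one, Nat.cast_zero, ne_eq, OfNat.ofNat_ne_zero, not_false_eq_true,
    zero_pow, zero_mul, sub_zero]
  have h := ((hasSum_natCast_mul_poissonWeight hx).add (hasSum_poissonWeight hx)).mul_left x
  rw [show x * (x + 1) = x ^ 2 + x by ring] at h
  refine h.congr_fun fun k => ?_
  simp only [poissonWeight, Nat.factorial_succ]
  push_cast
  have : ((k : ℝ) + 1) ≠ 0 := by positivity
  have : (k.factorial : ℝ) ≠ 0 := by positivity
  field_simp
  ring

end PoissonMoments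

/-! ### The cumulative arrival rate -/

section Rate

variable {d : ℕ} {lam : Fin d → ℝ} {Ω : Type*} {J : ℝ≥0 → Ω → Fin d}

lemma pathSigma_le [mΩ : MeasurableSpace Ω] (hJ : ∀ t, Measurable (J t)) :
    pathSigma J ≤ mΩ :=
  (measurable_pi_lambda _ hJ).comap_le

lemma measurable_state_pathSigma (t : ℝ≥0) : Measurable[pathSigma J] (J t) :=
  (measurable_pi_apply t).comp (comap_measurable fun ω t => J t ω)

lemma measurable_rate (lam : Fin d → ℝ) (m : MeasurableSpace Ω)
    (hJ : ∀ t, Measurable (J t))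
    (hr : ∀ ω t, ContinuousWithinAt (fun s => J s ω) (Set.Ici t) t) :
    Measurable fun p : ℝ × Ω => lam (J p.1.toNNReal p.2) :=
  (measurable_of_finite lam).comp ((measurable_uncurry_of_right_continuous m hJ hr).comp
    ((measurable_real_toNNReal.comp measurable_fst).prodMk measurable_snd))

lemma measurable_rate_path
    (hr : ∀ ω t, ContinuousWithinAt (fun s => J s ω) (Set.Ici t) t) (lam : Fin d → ℝ) (ω : Ω) :
    Measurable fun s : ℝ => lam (J s.toNNReal ω) := by
  -- For a fixed path the σ-algebra on `Ω` is irrelevant, and `⊤` makes every state map measurable.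
  have := measurable_rate lam ⊤ (fun t => measurable_from_top) hr
  exact this.comp (measurable_id.prodMk measurable_const)

lemma measurable_cumulativeRate (lam : Fin d → ℝ) (m : MeasurableSpace Ω)
    (hJ : ∀ t, Measurable (J t))
    (hr : ∀ ω t, ContinuousWithinAt (fun s => J s ω) (Set.Ici t) t) {a b : ℝ≥0} (hab : a ≤ b) :
    Measurable (cumulativeRate lam J a b) := by
  unfold cumulativeRate
  simp only [intervalIntegral.integral_of_le (NNReal.coe_le_coe.2 hab)]
  have h := measurable_rate lam m hJ hr
  exact ((h.comp measurable_swap).stronglyMeasurable.integral_prod_right'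
    (ν := volume.restrict (Set.Ioc (a : ℝ) b))).measurable

lemma le_sum_rate (hlam : ∀ i, 0 ≤ lam i) (i : Fin d) : lam i ≤ ∑ i, lam i :=
  Finset.single_le_sum (fun i _ => hlam i) (Finset.mem_univ i)

lemma intervalIntegrable_rate (hlam : ∀ i, 0 ≤ lam i)
    (hr : ∀ ω t, ContinuousWithinAt (fun s => J s ω) (Set.Ici t) t) (ω : Ω) (a b : ℝ) :
    IntervalIntegrable (fun s : ℝ => lam (J s.toNNReal ω)) volume a b := by
  refine (intervalIntegrable_const (c := ∑ i, lam i)).mono_fun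
    (measurable_rate_path hr lam ω).aestronglyMeasurable (ae_of_all _ fun s => ?_)
  dsimp only
  rw [Real.norm_of_nonneg (hlam _), Real.norm_of_nonneg (Finset.sum_nonneg fun i _ => hlam i)]
  exact le_sum_rate hlam _

lemma cumulativeRate_nonneg (hlam : ∀ i, 0 ≤ lam i) {a b : ℝ≥0} (hab : a ≤ b) (ω : Ω) :
    0 ≤ cumulativeRate lam J a b ω :=
  intervalIntegral.integral_nonneg (NNReal.coe_le_coe.2 hab) fun _ _ => hlam _

lemma cumulativeRate_add (hlam : ∀ i, 0 ≤ lam i)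
    (hr : ∀ ω t, ContinuousWithinAt (fun s => J s ω) (Set.Ici t) t) (a b c : ℝ≥0) (ω : Ω) :
    cumulativeRate lam J a b ω + cumulativeRate lam J b c ω = cumulativeRate lam J a c ω :=
  intervalIntegral.integral_add_adjacent_intervals
    (intervalIntegrable_rate hlam hr ω _ _) (intervalIntegrable_rate hlam hr ω _ _)

lemma cumulativeRate_le (hlam : ∀ i, 0 ≤ lam i)
    (hr : ∀ ω t, ContinuousWithinAt (fun s => J s ω) (Set.Ici t) t) {a b : ℝ≥0} (hab : a ≤ b)
    (ω : Ω) : cumulativeRate lam J a b ω ≤ (b - a) * ∑ i, lam i := by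
  have h := intervalIntegral.integral_mono_on (NNReal.coe_le_coe.2 hab)
    (intervalIntegrable_rate hlam hr ω a b) (intervalIntegrable_const (c := ∑ i, lam i))
    fun s _ => le_sum_rate hlam (J s.toNNReal ω)
  rw [intervalIntegral.integral_const, smul_eq_mul] at h
  exact h

end Rate

/-! ### Measurability of arrival counts -/

section Counts

variable {Ω : Type*} {A : ℕ → Ω → ℝ≥0∞}

lemma arrivalCount_eq_tsum (a b : ℝ≥0) (ω : Ω) :
    (arrivalCount A a b ω : ℝ≥0∞) =
      ∑' n, ({ω | (a : ℝ≥0∞) < A n ω ∧ A n ω ≤ b}.indicator (fun _ => (1 : ℝ≥0∞)) ω) := by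
  rw [arrivalCount, ← ENNReal.tsum_set_one,
    tsum_subtype {n : ℕ | (a : ℝ≥0∞) < A n ω ∧ A n ω ≤ b} (fun _ => (1 : ℝ≥0∞))]
  rfl

lemma measurableSet_arrivalCount_eq [MeasurableSpace Ω] (hA : ∀ n, Measurable (A n))
    (a b : ℝ≥0) (k : ℕ) : MeasurableSet {ω | arrivalCount A a b ω = k} := by
  have h : Measurable fun ω => (arrivalCount A a b ω : ℝ≥0∞) := by
    simp only [arrivalCount_eq_tsum]
    refine Measurable.tsum fun n => measurable_const.indicator ?_
    exact (measurableSet_lt measurable_const (hA n)).inter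
      (measurableSet_le (hA n) measurable_const)
  have h2 := h (measurableSet_singleton (k : ℝ≥0∞))
  convert h2 using 1
  ext ω
  change arrivalCount A a b ω = (k : ℕ∞) ↔ (arrivalCount A a b ω : ℝ≥0∞) = (k : ℝ≥0∞)
  rw [← ENat.toENNReal_coe k, ENat.toENNReal_inj]

/-- The number of arrivals in `(a, b]`, with the junk value `0` if it is infinite. -/
noncomputable def natArrivals (A : ℕ → Ω → ℝ≥0∞) (a b : ℝ≥0) (ω : Ω) : ℕ :=
  (arrivalCount A a b ω).toNat

lemma measurable_natArrivals [MeasurableSpace Ω] (hA : ∀ n, Measurable (A n)) (a b : ℝ≥0) :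
    Measurable (natArrivals A a b) := by
  have key : ∀ k : ℕ, k ≠ 0 → MeasurableSet (natArrivals A a b ⁻¹' {k}) := by
    intro k hk
    convert measurableSet_arrivalCount_eq hA a b k using 1
    ext ω
    simp only [natArrivals, Set.mem_preimage, Set.mem_singleton_iff, Set.mem_ofPred_eq]
    exact ENat.toNat_eq_iff hk
  refine measurable_to_countable' fun k => ?_
  -- The value `0` also stands for an infinite count, so its preimage is obtained as a complement.
  rcases eq_or_ne k 0 with rfl | hk
  · have : natArrivals A a b ⁻¹' {0} = (⋃ k : ℕ, natArrivals A a b ⁻¹' {k + 1})ᶜ := by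
      ext ω
      simp only [Set.mem_preimage, Set.mem_singleton_iff, Set.mem_compl_iff, Set.mem_iUnion,
        not_exists]
      constructor
      · intro h k; omega
      · intro h
        by_contra h0
        exact h (natArrivals A a b ω - 1) (by omega)
    rw [this]
    exact (MeasurableSet.iUnion fun k => key _ (by omega)).compl
  · exact key k hk

end Counts

/-! ### Expectations of counts on two adjacent intervals, given the path -/

section CondPoisson

variable {d : ℕ} {Q : Matrix (Fin d) (Fin d) ℝ} {ϖ lam mu : Fin d → ℝ}
  {Ω : Type*} [MeasurableSpace Ω] {P : Measure Ω} [IsProbabilityMeasure P]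
  {J : ℝ≥0 → Ω → Fin d} {A : ℕ → Ω → ℝ≥0∞} {S : ℕ → Ω → ℝ}

lemma IsModelII.condProb_two (hM : IsModelII Q ϖ lam mu P J A S) {a b : ℝ≥0} (hab : a ≤ b)
    (k l : ℕ) :
    P⟦{ω | arrivalCount A 0 a ω = k ∧ arrivalCount A a b ω = l} | pathSigma J⟧ =ᵐ[P]
      fun ω => poissonWeight (cumulativeRate lam J 0 a ω) k *
        poissonWeight (cumulativeRate lam J a b ω) l := by
  have h := hM.arrival_poisson 2 (fun n => if n = 0 then 0 else if n = 1 then a else b)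
    (by intro x y hxy; dsimp only; split_ifs <;> first | omega | simp)
    (fun n => if n = 0 then k else l)
  have hs : {ω | ∀ n < 2, arrivalCount A (if n = 0 then 0 else if n = 1 then a else b)
      (if n + 1 = 0 then 0 else if n + 1 = 1 then a else b) ω =
      ((if n = 0 then k else l : ℕ) : ℕ∞)} =
      {ω | arrivalCount A 0 a ω = k ∧ arrivalCount A a b ω = l} := by
    ext ω
    simp only [Set.mem_ofPred_eq]
    constructor
    · intro hl
      exact ⟨by simpa using hl 0 (by norm_num), by simpa using hl 1 (by norm_num)⟩
    · rintro ⟨h0, h1⟩ n hn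
      interval_cases n <;> simpa
  rw [hs] at h
  refine h.trans (ae_of_all _ fun ω => ?_)
  simp [Finset.prod_range_succ, poissonWeight, div_mul_div_comm]

/-- A factor determined by the path can be pulled out of the conditional expectation. The result is
phrased with `∫⁻` so that it can be summed over `k` and `l` before any integrability is known. -/
lemma IsModelII.lintegral_mul_indicator (hM : IsModelII Q ϖ lam mu P J A S)
    (hlam : ∀ i, 0 ≤ lam i) {a b : ℝ≥0} (hab : a ≤ b)
    (k l : ℕ) {X : Ω → ℝ} (hX : Measurable[pathSigma J] X) (hX0 : ∀ ω, 0 ≤ X ω) {C : ℝ}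
    (hXC : ∀ ω, X ω ≤ C) :
    ∫⁻ ω, ENNReal.ofReal (X ω) *
        {ω | arrivalCount A 0 a ω = k ∧ arrivalCount A a b ω = l}.indicator 1 ω ∂P =
      ∫⁻ ω, ENNReal.ofReal (X ω) *
        (ENNReal.ofReal (poissonWeight (cumulativeRate lam J 0 a ω) k) *
        ENNReal.ofReal (poissonWeight (cumulativeRate lam J a b ω) l)) ∂P := by
  set B : Set Ω := {ω | arrivalCount A 0 a ω = k ∧ arrivalCount A a b ω = l} with hB
  have hBm : MeasurableSet B := (measurableSet_arrivalCount_eq hM.measurable_arrival 0 a k).inter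
    (measurableSet_arrivalCount_eq hM.measurable_arrival a b l)
  have hle := pathSigma_le hM.background.measurable
  have hgi : Integrable (B.indicator fun _ => (1 : ℝ)) P := (integrable_const 1).indicator hBm
  have hfg : Integrable (X * B.indicator fun _ => (1 : ℝ)) P := by
    refine hgi.bdd_mul (c := C) (hX.mono hle le_rfl).aestronglyMeasurable (ae_of_all _ fun ω => ?_)
    rw [Real.norm_of_nonneg (hX0 ω)]
    exact hXC ω
  have hpull := condExp_mul_of_stronglyMeasurable_left (m := pathSigma J) (μ := P)
    hX.stronglyMeasurable hfg hgi
  have hcond := hM.condProb_two hab k l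
  have hae : P[X * B.indicator (fun _ => (1 : ℝ)) | pathSigma J] =ᵐ[P] fun ω =>
      X ω * (poissonWeight (cumulativeRate lam J 0 a ω) k *
        poissonWeight (cumulativeRate lam J a b ω) l) := by
    filter_upwards [hpull, hcond] with ω h1 h2
    rw [h1, Pi.mul_apply]
    congr 1
  have hp1 : ∀ ω, 0 ≤ poissonWeight (cumulativeRate lam J 0 a ω) k := fun ω =>
    poissonWeight_nonneg (cumulativeRate_nonneg hlam zero_le ω) k
  have hp2 : ∀ ω, 0 ≤ poissonWeight (cumulativeRate lam J a b ω) l := fun ω =>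
    poissonWeight_nonneg (cumulativeRate_nonneg hlam hab ω) l
  have hint : Integrable (fun ω => X ω * (poissonWeight (cumulativeRate lam J 0 a ω) k *
        poissonWeight (cumulativeRate lam J a b ω) l)) P :=
    integrable_condExp.congr hae
  have heq : ∫ ω, (X * B.indicator fun _ => (1 : ℝ)) ω ∂P =
      ∫ ω, X ω * (poissonWeight (cumulativeRate lam J 0 a ω) k *
        poissonWeight (cumulativeRate lam J a b ω) l) ∂P := by
    rw [← integral_condExp hle]
    exact integral_congr_ae hae
  calc _ = ∫⁻ ω, ENNReal.ofReal ((X * B.indicator fun _ => (1 : ℝ)) ω) ∂P := by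
        refine lintegral_congr fun ω => ?_
        by_cases h : ω ∈ B <;> simp [h]
    _ = _ := by
        rw [← ofReal_integral_eq_lintegral_ofReal hfg, heq,
          ofReal_integral_eq_lintegral_ofReal hint]
        · refine lintegral_congr fun ω => ?_
          rw [ENNReal.ofReal_mul (hX0 ω), ENNReal.ofReal_mul (hp1 ω)]
        · exact ae_of_all _ fun ω => mul_nonneg (hX0 ω) (mul_nonneg (hp1 ω) (hp2 ω))
        · refine ae_of_all _ fun ω => mul_nonneg (hX0 ω) ?_
          exact Set.indicator_nonneg (fun _ _ => zero_le_one) ω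

lemma tsum_ofReal_mul_of_hasSum {f p : ℕ → ℝ} (hf : ∀ k, 0 ≤ f k) (hp : ∀ k, 0 ≤ p k) {x : ℝ}
    (h : HasSum (fun k => f k * p k) x) :
    ∑' k, ENNReal.ofReal (f k) * ENNReal.ofReal (p k) = ENNReal.ofReal x := by
  rw [← h.tsum_eq, ENNReal.ofReal_tsum_of_nonneg (fun k => mul_nonneg (hf k) (hp k)) h.summable]
  exact tsum_congr fun k => (ENNReal.ofReal_mul (hf k)).symm

/-- The Poisson weights sum to `1`, so the events with prescribed finite counts already exhaust the
probability. -/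
lemma IsModelII.ae_arrivalCount_ne_top (hM : IsModelII Q ϖ lam mu P J A S)
    (hlam : ∀ i, 0 ≤ lam i) {a b : ℝ≥0} (hab : a ≤ b) :
    ∀ᵐ ω ∂P, arrivalCount A 0 a ω ≠ ⊤ ∧ arrivalCount A a b ω ≠ ⊤ := by
  have hBm : ∀ p : ℕ × ℕ, MeasurableSet
      {ω | arrivalCount A 0 a ω = p.1 ∧ arrivalCount A a b ω = p.2} := fun p =>
    (measurableSet_arrivalCount_eq hM.measurable_arrival 0 a p.1).inter
    (measurableSet_arrivalCount_eq hM.measurable_arrival a b p.2)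
  have hone : P (⋃ p : ℕ × ℕ,
      {ω | arrivalCount A 0 a ω = p.1 ∧ arrivalCount A a b ω = p.2}) = 1 := by
    rw [measure_iUnion _ hBm]
    · have h1 : ∀ p : ℕ × ℕ, P {ω | arrivalCount A 0 a ω = p.1 ∧ arrivalCount A a b ω = p.2} =
          ∫⁻ ω, ENNReal.ofReal (poissonWeight (cumulativeRate lam J 0 a ω) p.1) *
            ENNReal.ofReal (poissonWeight (cumulativeRate lam J a b ω) p.2) ∂P := by
        intro p
        have := hM.lintegral_mul_indicator hlam hab p.1 p.2 (X := fun _ => 1)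
          measurable_const (fun _ => zero_le_one) (fun _ => le_rfl)
        simp only [ENNReal.ofReal_one, one_mul] at this
        rw [← this, lintegral_indicator_one (hBm p)]
      simp_rw [h1]
      rw [← lintegral_tsum]
      · have h2 : ∀ ω, ∑' p : ℕ × ℕ,
            ENNReal.ofReal (poissonWeight (cumulativeRate lam J 0 a ω) p.1) *
            ENNReal.ofReal (poissonWeight (cumulativeRate lam J a b ω) p.2) = 1 := by
          intro ω
          have hw : ∀ {x : ℝ}, 0 ≤ x → ∑' k, ENNReal.ofReal (poissonWeight x k) = 1 := by
            intro x hx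
            rw [← ENNReal.ofReal_tsum_of_nonneg (poissonWeight_nonneg hx)
              (hasSum_poissonWeight hx).summable, (hasSum_poissonWeight hx).tsum_eq,
              ENNReal.ofReal_one]
          rw [ENNReal.tsum_prod']
          simp only
          simp_rw [ENNReal.tsum_mul_left]
          rw [hw (cumulativeRate_nonneg hlam hab ω)]
          simp only [mul_one]
          exact hw (cumulativeRate_nonneg hlam zero_le ω)
        simp [h2]
      · intro p
        have m1 := measurable_cumulativeRate lam _ hM.background.measurable
          hM.background.right_continuous (zero_le : 0 ≤ a)
        have m2 := measurable_cumulativeRate lam _ hM.background.measurable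
          hM.background.right_continuous hab
        unfold poissonWeight
        fun_prop
    · intro p p' hpp
      refine Set.disjoint_left.2 fun ω h h' => hpp ?_
      exact Prod.ext (by exact_mod_cast h.1.symm.trans h'.1)
        (by exact_mod_cast h.2.symm.trans h'.2)
  have hae := (prob_compl_eq_zero_iff (MeasurableSet.iUnion hBm)).2 hone
  rw [← mem_ae_iff] at hae
  filter_upwards [hae] with ω hω
  obtain ⟨p, h1, h2⟩ := Set.mem_iUnion.1 hω
  rw [h1, h2]
  exact ⟨ENat.natCast_ne_top _, ENat.natCast_ne_top _⟩

lemma IsModelII.lintegral_mul_counts (hM : IsModelII Q ϖ lam mu P J A S)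
    (hlam : ∀ i, 0 ≤ lam i) {a b : ℝ≥0} (hab : a ≤ b) {X : Ω → ℝ}
    (hX : Measurable[pathSigma J] X) (hX0 : ∀ ω, 0 ≤ X ω) {C : ℝ} (hXC : ∀ ω, X ω ≤ C)
    {f g : ℕ → ℝ} (hf : ∀ k, 0 ≤ f k) (hg : ∀ k, 0 ≤ g k) {F G : ℝ → ℝ}
    (hF : ∀ {x}, 0 ≤ x → HasSum (fun k => f k * poissonWeight x k) (F x))
    (hG : ∀ {x}, 0 ≤ x → HasSum (fun k => g k * poissonWeight x k) (G x)) :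
    ∫⁻ ω, ENNReal.ofReal (X ω) * (ENNReal.ofReal (f (natArrivals A 0 a ω)) *
      ENNReal.ofReal (g (natArrivals A a b ω))) ∂P =
    ∫⁻ ω, ENNReal.ofReal (X ω) * (ENNReal.ofReal (F (cumulativeRate lam J 0 a ω)) *
      ENNReal.ofReal (G (cumulativeRate lam J a b ω))) ∂P := by
  have hle := pathSigma_le hM.background.measurable
  have hXm : Measurable X := hX.mono hle le_rfl
  have hBm : ∀ p : ℕ × ℕ, MeasurableSet
      {ω | arrivalCount A 0 a ω = p.1 ∧ arrivalCount A a b ω = p.2} := fun p =>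
    (measurableSet_arrivalCount_eq hM.measurable_arrival 0 a p.1).inter
    (measurableSet_arrivalCount_eq hM.measurable_arrival a b p.2)
  have m1 := measurable_cumulativeRate lam _ hM.background.measurable
    hM.background.right_continuous (zero_le : 0 ≤ a)
  have m2 := measurable_cumulativeRate lam _ hM.background.measurable
    hM.background.right_continuous hab
  calc _ = ∫⁻ ω, ∑' p : ℕ × ℕ, (ENNReal.ofReal (f p.1) * ENNReal.ofReal (g p.2)) *
        (ENNReal.ofReal (X ω) *
          {ω | arrivalCount A 0 a ω = p.1 ∧ arrivalCount A a b ω = p.2}.indicator 1 ω) ∂P := by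
        refine lintegral_congr_ae ?_
        filter_upwards [hM.ae_arrivalCount_ne_top hlam hab] with ω hω
        -- Where both counts are finite, exactly one pair of values contributes.
        rw [tsum_eq_single (natArrivals A 0 a ω, natArrivals A a b ω)]
        · rw [Set.indicator_of_mem]
          · simp only [Pi.one_apply]; ring
          · exact ⟨(ENat.natCast_toNat hω.1).symm, (ENat.natCast_toNat hω.2).symm⟩
        · intro p hp
          rw [Set.indicator_of_notMem, mul_zero, mul_zero]
          rintro ⟨h1, h2⟩
          refine hp (Prod.ext ?_ ?_)
          · simp [natArrivals, h1]
          · simp [natArrivals, h2]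
    _ = ∑' p : ℕ × ℕ, (ENNReal.ofReal (f p.1) * ENNReal.ofReal (g p.2)) *
        ∫⁻ ω, (ENNReal.ofReal (X ω) *
        (ENNReal.ofReal (poissonWeight (cumulativeRate lam J 0 a ω) p.1) *
        ENNReal.ofReal (poissonWeight (cumulativeRate lam J a b ω) p.2))) ∂P := by
        rw [lintegral_tsum]
        · refine tsum_congr fun p => ?_
          rw [← hM.lintegral_mul_indicator hlam hab p.1 p.2 hX hX0 hXC, lintegral_const_mul]
          exact hXm.ennreal_ofReal.mul (measurable_one.indicator (hBm p))
        · intro p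
          exact ((hXm.ennreal_ofReal.mul (measurable_one.indicator (hBm p))).const_mul
            _).aemeasurable
    _ = ∫⁻ ω, ∑' p : ℕ × ℕ, (ENNReal.ofReal (f p.1) * ENNReal.ofReal (g p.2)) *
        (ENNReal.ofReal (X ω) *
        (ENNReal.ofReal (poissonWeight (cumulativeRate lam J 0 a ω) p.1) *
        ENNReal.ofReal (poissonWeight (cumulativeRate lam J a b ω) p.2))) ∂P := by
        rw [lintegral_tsum]
        · refine tsum_congr fun p => ?_
          rw [lintegral_const_mul]
          unfold poissonWeight
          fun_prop
        · intro p
          unfold poissonWeight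
          fun_prop
    _ = _ := by
        refine lintegral_congr fun ω => ?_
        have n1 := cumulativeRate_nonneg (J := J) hlam (zero_le : 0 ≤ a) ω
        have n2 := cumulativeRate_nonneg (J := J) hlam hab ω
        rw [← tsum_ofReal_mul_of_hasSum hf (poissonWeight_nonneg n1) (hF n1),
          ← tsum_ofReal_mul_of_hasSum hg (poissonWeight_nonneg n2) (hG n2),
          ← ENNReal.tsum_mul_right, ← ENNReal.tsum_mul_left, ENNReal.tsum_prod']
        refine tsum_congr fun k => ?_
        rw [← ENNReal.tsum_mul_left, ← ENNReal.tsum_mul_left]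
        refine tsum_congr fun l => ?_
        ring

/-- The cumulative rates range in compact intervals, so continuity of `F` and `G` bounds the
right-hand side; equality of the lower integrals transfers integrability to the unbounded counts. -/
lemma IsModelII.integral_mul_counts (hM : IsModelII Q ϖ lam mu P J A S)
    (hlam : ∀ i, 0 ≤ lam i) {a b : ℝ≥0} (hab : a ≤ b) {X : Ω → ℝ}
    (hX : Measurable[pathSigma J] X) (hX0 : ∀ ω, 0 ≤ X ω) {C : ℝ} (hXC : ∀ ω, X ω ≤ C)
    {f g : ℕ → ℝ} (hf : ∀ k, 0 ≤ f k) (hg : ∀ k, 0 ≤ g k) {F G : ℝ → ℝ}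
    (hF : ∀ {x}, 0 ≤ x → HasSum (fun k => f k * poissonWeight x k) (F x))
    (hG : ∀ {x}, 0 ≤ x → HasSum (fun k => g k * poissonWeight x k) (G x))
    (hFc : Continuous F) (hGc : Continuous G) :
    Integrable (fun ω => X ω * (f (natArrivals A 0 a ω) * g (natArrivals A a b ω))) P ∧
    ∫ ω, X ω * (f (natArrivals A 0 a ω) * g (natArrivals A a b ω)) ∂P =
    ∫ ω, X ω * (F (cumulativeRate lam J 0 a ω) * G (cumulativeRate lam J a b ω)) ∂P := by
  have h := hM.lintegral_mul_counts hlam hab hX hX0 hXC hf hg hF hG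
  have hr := hM.background.right_continuous
  have hle := pathSigma_le hM.background.measurable
  have hXm : Measurable X := hX.mono hle le_rfl
  have m1 := measurable_cumulativeRate lam _ hM.background.measurable hr (zero_le : 0 ≤ a)
  have m2 := measurable_cumulativeRate lam _ hM.background.measurable hr hab
  have hF0 : ∀ {x}, 0 ≤ x → 0 ≤ F x := fun hx =>
    (hF hx).nonneg fun k => mul_nonneg (hf k) (poissonWeight_nonneg hx k)
  have hG0 : ∀ {x}, 0 ≤ x → 0 ≤ G x := fun hx =>
    (hG hx).nonneg fun k => mul_nonneg (hg k) (poissonWeight_nonneg hx k)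
  have hFG0 : ∀ ω, 0 ≤ F (cumulativeRate lam J 0 a ω) * G (cumulativeRate lam J a b ω) :=
    fun ω => mul_nonneg (hF0 (cumulativeRate_nonneg hlam zero_le ω))
      (hG0 (cumulativeRate_nonneg hlam hab ω))
  obtain ⟨CF, hCF⟩ := (isCompact_Icc (a := (0 : ℝ)) (b := (a - (0 : ℝ≥0)) * ∑ i, lam i)
    ).exists_bound_of_continuousOn hFc.continuousOn
  obtain ⟨CG, hCG⟩ := (isCompact_Icc (a := (0 : ℝ)) (b := (b - a) * ∑ i, lam i)
    ).exists_bound_of_continuousOn hGc.continuousOn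
  have hbF : ∀ ω, ‖F (cumulativeRate lam J 0 a ω)‖ ≤ CF := fun ω =>
    hCF _ ⟨cumulativeRate_nonneg hlam zero_le ω, cumulativeRate_le hlam hr zero_le ω⟩
  have hbG : ∀ ω, ‖G (cumulativeRate lam J a b ω)‖ ≤ CG := fun ω =>
    hCG _ ⟨cumulativeRate_nonneg hlam hab ω, cumulativeRate_le hlam hr hab ω⟩
  have hRi : Integrable
      (fun ω => X ω * (F (cumulativeRate lam J 0 a ω) * G (cumulativeRate lam J a b ω))) P := by
    refine Integrable.of_bound (C := C * (CF * CG)) ?_ (ae_of_all _ fun ω => ?_)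
    · exact (hXm.mul ((hFc.measurable.comp m1).mul (hGc.measurable.comp m2))).aestronglyMeasurable
    · rw [norm_mul, norm_mul, Real.norm_of_nonneg (hX0 ω)]
      exact mul_le_mul (hXC ω) (mul_le_mul (hbF ω) (hbG ω) (norm_nonneg _)
        ((norm_nonneg _).trans (hbF ω))) (by positivity) ((hX0 ω).trans (hXC ω))
  have hRn : 0 ≤ᵐ[P]
      fun ω => X ω * (F (cumulativeRate lam J 0 a ω) * G (cumulativeRate lam J a b ω)) :=
    ae_of_all _ fun ω => mul_nonneg (hX0 ω) (hFG0 ω)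
  have hLn : 0 ≤ᵐ[P] fun ω => X ω * (f (natArrivals A 0 a ω) * g (natArrivals A a b ω)) :=
    ae_of_all _ fun ω => mul_nonneg (hX0 ω) (mul_nonneg (hf _) (hg _))
  have hLm : AEStronglyMeasurable
      (fun ω => X ω * (f (natArrivals A 0 a ω) * g (natArrivals A a b ω))) P := by
    have a1 := measurable_natArrivals hM.measurable_arrival 0 a
    have a2 := measurable_natArrivals hM.measurable_arrival a b
    exact (hXm.mul (((measurable_of_countable f).comp a1).mul
      ((measurable_of_countable g).comp a2))).aestronglyMeasurable
  have h' : ∫⁻ ω, ENNReal.ofReal (X ω * (f (natArrivals A 0 a ω) * g (natArrivals A a b ω))) ∂P =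
      ∫⁻ ω, ENNReal.ofReal
        (X ω * (F (cumulativeRate lam J 0 a ω) * G (cumulativeRate lam J a b ω))) ∂P := by
    convert h using 2
    · ext ω
      rw [ENNReal.ofReal_mul (hX0 ω), ENNReal.ofReal_mul (hf _)]
    · ext ω
      rw [ENNReal.ofReal_mul (hX0 ω),
        ENNReal.ofReal_mul (hF0 (cumulativeRate_nonneg hlam zero_le ω))]
  constructor
  · refine ⟨hLm, ?_⟩
    rw [hasFiniteIntegral_iff_ofReal hLn, h', ← hasFiniteIntegral_iff_ofReal hRn]
    exact hRi.2
  · rw [integral_eq_lintegral_of_nonneg_ae hLn hLm, h',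
      ← integral_eq_lintegral_of_nonneg_ae hRn hRi.1]

end CondPoisson

/-! ### Sums over arrival times as finite sums -/

section ArrivalSums

variable {Ω : Type*} {A : ℕ → Ω → ℝ≥0∞} {ω : Ω}

/-- The sum of `F` over the arrival times up to time `R`. -/
noncomputable def arrivalSum (A : ℕ → Ω → ℝ≥0∞) (F : ℝ≥0 → Ω → ℝ) (R : ℝ≥0) (ω : Ω) : ℝ :=
  ∑' n, if A n ω ≤ R then F (A n ω).toNNReal ω else 0

lemma arrivalSum_eq_sum {R : ℝ≥0} (h : {n | A n ω ≤ R}.Finite) (F : ℝ≥0 → Ω → ℝ) :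
    arrivalSum A F R ω = ∑ n ∈ h.toFinset, F (A n ω).toNNReal ω := by
  rw [arrivalSum, tsum_eq_sum (s := h.toFinset)]
  · refine Finset.sum_congr rfl fun n hn => if_pos ?_
    simpa using hn
  · intro n hn
    exact if_neg (by simpa using hn)

lemma arrivalCount_zero (hpos : ∀ n ω, 0 < A n ω) (a : ℝ≥0) (ω : Ω) :
    arrivalCount A 0 a ω = {n | A n ω ≤ a}.encard := by
  simp [arrivalCount, hpos]

lemma natArrivals_zero_eq_card (hpos : ∀ n ω, 0 < A n ω) {a : ℝ≥0}
    (h : {n | A n ω ≤ a}.Finite) : natArrivals A 0 a ω = h.toFinset.card := by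
  rw [natArrivals, arrivalCount_zero hpos, h.encard_eq_coe_toFinset_card, ENat.toNat_natCast]

lemma arrivalSum_indicator (hpos : ∀ n ω, 0 < A n ω) {a R : ℝ≥0} (haR : a ≤ R)
    (h : {n | A n ω ≤ R}.Finite) :
    ∑ n ∈ h.toFinset, (if (A n ω).toNNReal ≤ a then (1 : ℝ) else 0) = natArrivals A 0 a ω := by
  have hle : {n | A n ω ≤ a} ⊆ {n | A n ω ≤ R} := fun n hn =>
    le_trans (show A n ω ≤ a from hn) (by exact_mod_cast haR)
  rw [natArrivals_zero_eq_card hpos (h.subset hle), Finset.sum_boole]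
  congr 2
  ext n
  simp only [Finset.mem_filter, Set.Finite.mem_toFinset, Set.mem_ofPred_eq]
  constructor
  · rintro ⟨h1, h2⟩
    rw [← ENNReal.coe_toNNReal (ne_top_of_le_ne_top ENNReal.coe_ne_top h1)]
    exact_mod_cast h2
  · intro h1
    exact ⟨hle h1, by simpa using ENNReal.toNNReal_mono ENNReal.coe_ne_top h1⟩

lemma natArrivals_add (hpos : ∀ n ω, 0 < A n ω) {a b : ℝ≥0} (hab : a ≤ b)
    (h : {n | A n ω ≤ b}.Finite) :
    natArrivals A 0 a ω + natArrivals A a b ω = natArrivals A 0 b ω := by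
  have hle : {n | A n ω ≤ a} ⊆ {n | A n ω ≤ b} := fun n hn =>
    le_trans (show A n ω ≤ a from hn) (by exact_mod_cast hab)
  have hle2 : {n | (a : ℝ≥0∞) < A n ω ∧ A n ω ≤ b} ⊆ {n | A n ω ≤ b} := fun n hn => hn.2
  have hu : {n | A n ω ≤ b} = {n | A n ω ≤ a} ∪ {n | (a : ℝ≥0∞) < A n ω ∧ A n ω ≤ b} := by
    ext n
    constructor
    · intro hn
      rcases le_or_gt (A n ω) a with h1 | h1
      · exact Or.inl h1
      · exact Or.inr ⟨h1, hn⟩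
    · rintro (hn | hn)
      · exact hle hn
      · exact hle2 hn
  have hd : Disjoint {n | A n ω ≤ a} {n | (a : ℝ≥0∞) < A n ω ∧ A n ω ≤ b} :=
    Set.disjoint_left.2 fun n h1 h2 => absurd h2.1 (not_lt.2 h1)
  unfold natArrivals
  rw [arrivalCount_zero hpos, arrivalCount_zero hpos, arrivalCount, hu,
    Set.encard_union_eq hd, ENat.toNat_add]
  · exact Set.encard_ne_top_iff.2 (h.subset hle)
  · exact Set.encard_ne_top_iff.2 (h.subset hle2)

end ArrivalSums

/-! ### Weighted first and second moments of arrival counts -/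

section SecondMoments

variable {d : ℕ} {Q : Matrix (Fin d) (Fin d) ℝ} {ϖ lam mu : Fin d → ℝ}
  {Ω : Type*} [MeasurableSpace Ω] {P : Measure Ω} [IsProbabilityMeasure P]
  {J : ℝ≥0 → Ω → Fin d} {A : ℕ → Ω → ℝ≥0∞} {S : ℕ → Ω → ℝ}

lemma IsModelII.ae_finite (hM : IsModelII Q ϖ lam mu P J A S) (hlam : ∀ i, 0 ≤ lam i) :
    ∀ᵐ ω ∂P, ∀ a : ℝ≥0, {n | A n ω ≤ a}.Finite := by
  -- Integer horizons suffice by monotonicity, and they give one null set for all times.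
  have h : ∀ k : ℕ, ∀ᵐ ω ∂P, {n | A n ω ≤ ((k : ℝ≥0) : ℝ≥0∞)}.Finite := by
    intro k
    filter_upwards [hM.ae_arrivalCount_ne_top hlam (le_refl (k : ℝ≥0))] with ω hω
    rw [arrivalCount_zero hM.arrival_pos] at hω
    exact Set.encard_ne_top_iff.1 hω.1
  filter_upwards [ae_all_iff.2 h] with ω hω a
  obtain ⟨k, hk⟩ := exists_nat_ge a
  exact (hω k).subset fun n hn => le_trans (show A n ω ≤ a from hn) (by exact_mod_cast hk)

lemma IsModelII.measurable_cumulativeRate_path (hM : IsModelII Q ϖ lam mu P J A S)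
    (lam : Fin d → ℝ) (a : ℝ≥0) : Measurable[pathSigma J] (cumulativeRate lam J 0 a) :=
  measurable_cumulativeRate lam _ measurable_state_pathSigma
    hM.background.right_continuous zero_le

lemma IsModelII.measurable_cumulativeRate_zero (hM : IsModelII Q ϖ lam mu P J A S)
    (lam : Fin d → ℝ) (a : ℝ≥0) : Measurable (cumulativeRate lam J 0 a) :=
  (hM.measurable_cumulativeRate_path lam a).mono (pathSigma_le hM.background.measurable) le_rfl

lemma IsModelII.abs_cumulativeRate_le (hM : IsModelII Q ϖ lam mu P J A S)
    (hlam : ∀ i, 0 ≤ lam i) (a : ℝ≥0) (ω : Ω) :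
    |cumulativeRate lam J 0 a ω| ≤ a * ∑ i, lam i := by
  rw [abs_of_nonneg (cumulativeRate_nonneg hlam zero_le ω)]
  simpa using cumulativeRate_le hlam hM.background.right_continuous (zero_le : 0 ≤ a) ω

/-- Write `N_b = N_a + N_(a,b]`. Then `N_a N_b = N_a² + N_a N_(a,b]` has conditional mean `Λ_a² +
Λ_a + Λ_a Λ_(a,b] = Λ_a Λ_b + Λ_a`. -/
lemma IsModelII.moments_of_le (hM : IsModelII Q ϖ lam mu P J A S)
    (hlam : ∀ i, 0 ≤ lam i) {a b : ℝ≥0} (hab : a ≤ b) {X : Ω → ℝ}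
    (hX : Measurable[pathSigma J] X) (hX0 : ∀ ω, 0 ≤ X ω) {C : ℝ} (hXC : ∀ ω, X ω ≤ C) :
    Integrable (fun ω => X ω * ((natArrivals A 0 a ω : ℝ) * natArrivals A 0 b ω)) P ∧
    ∫ ω, X ω * ((natArrivals A 0 a ω : ℝ) * natArrivals A 0 b ω) ∂P =
      ∫ ω, X ω * (cumulativeRate lam J 0 a ω * cumulativeRate lam J 0 b ω +
        cumulativeRate lam J 0 a ω) ∂P := by
  have hr := hM.background.right_continuous
  have hone : ∀ {x : ℝ}, 0 ≤ x → HasSum (fun k => (1 : ℝ) * poissonWeight x k) 1 := fun hx => by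
    simpa using hasSum_poissonWeight hx
  obtain ⟨i1, e1⟩ := hM.integral_mul_counts hlam hab hX hX0 hXC
    (f := fun k => (k : ℝ) ^ 2) (g := fun _ => 1) (fun k => by positivity) (fun k => zero_le_one)
    (F := fun x => x ^ 2 + x) (G := fun _ => 1) (fun hx => hasSum_sq_mul_poissonWeight hx)
    hone (by fun_prop) (by fun_prop)
  obtain ⟨i2, e2⟩ := hM.integral_mul_counts hlam hab hX hX0 hXC
    (f := fun k => (k : ℝ)) (g := fun k => (k : ℝ)) (fun k => by positivity)
    (fun k => by positivity)
    (F := fun x => x) (G := fun x => x) (fun hx => hasSum_natCast_mul_poissonWeight hx)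
    (fun hx => hasSum_natCast_mul_poissonWeight hx) (by fun_prop) (by fun_prop)
  have hXm : Measurable X := hX.mono (pathSigma_le hM.background.measurable) le_rfl
  have hbdd : ∀ {Y : Ω → ℝ} {D : ℝ}, Measurable Y → (∀ ω, |Y ω| ≤ D) →
      Integrable (fun ω => X ω * Y ω) P := by
    intro Y D hY hD
    refine Integrable.of_bound (C := C * D) (hXm.mul hY).aestronglyMeasurable
      (ae_of_all _ fun ω => ?_)
    rw [norm_mul, Real.norm_of_nonneg (hX0 ω)]
    exact mul_le_mul (hXC ω) (hD ω) (norm_nonneg _) ((hX0 ω).trans (hXC ω))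
  have mΛ := measurable_cumulativeRate lam _ hM.background.measurable hr hab
  have bΛ : ∀ ω, |cumulativeRate lam J a b ω| ≤ (b - a) * ∑ i, lam i := fun ω => by
    rw [abs_of_nonneg (cumulativeRate_nonneg hlam hab ω)]
    exact cumulativeRate_le hlam hr hab ω
  have i3 : Integrable (fun ω => X ω * ((cumulativeRate lam J 0 a ω ^ 2 +
      cumulativeRate lam J 0 a ω) * 1)) P := by
    refine hbdd (D := (a * ∑ i, lam i) ^ 2 + a * ∑ i, lam i)
      ((((hM.measurable_cumulativeRate_zero lam a).pow_const 2).add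
        (hM.measurable_cumulativeRate_zero lam a)).mul_const 1) fun ω => ?_
    rw [mul_one]
    refine (abs_add_le _ _).trans (add_le_add ?_ (hM.abs_cumulativeRate_le hlam a ω))
    rw [abs_pow]
    exact pow_le_pow_left₀ (abs_nonneg _) (hM.abs_cumulativeRate_le hlam a ω) 2
  have i4 : Integrable (fun ω => X ω * (cumulativeRate lam J 0 a ω *
      cumulativeRate lam J a b ω)) P := by
    refine hbdd (D := (a * ∑ i, lam i) * ((b - a) * ∑ i, lam i))
      ((hM.measurable_cumulativeRate_zero lam a).mul mΛ) fun ω => ?_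
    rw [abs_mul]
    exact mul_le_mul (hM.abs_cumulativeRate_le hlam a ω) (bΛ ω) (abs_nonneg _)
      ((abs_nonneg _).trans (hM.abs_cumulativeRate_le hlam a ω))
  have hL : (fun ω => X ω * ((natArrivals A 0 a ω : ℝ) * natArrivals A 0 b ω)) =ᵐ[P]
      fun ω => X ω * ((natArrivals A 0 a ω : ℝ) ^ 2 * 1) +
        X ω * ((natArrivals A 0 a ω : ℝ) * natArrivals A a b ω) := by
    filter_upwards [hM.ae_finite hlam] with ω hω
    rw [← natArrivals_add hM.arrival_pos hab (hω b)]
    push_cast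
    ring
  refine ⟨(i1.add i2).congr hL.symm, ?_⟩
  rw [integral_congr_ae hL, integral_add i1 i2, e1, e2, ← integral_add i3 i4]
  refine integral_congr_ae (ae_of_all _ fun ω => ?_)
  simp only
  rw [← cumulativeRate_add hlam hr 0 a b]
  ring

lemma IsModelII.moments (hM : IsModelII Q ϖ lam mu P J A S)
    (hlam : ∀ i, 0 ≤ lam i) (a b : ℝ≥0) {X : Ω → ℝ}
    (hX : Measurable[pathSigma J] X) {C : ℝ} (hXC : ∀ ω, |X ω| ≤ C) :
    Integrable (fun ω => X ω * ((natArrivals A 0 a ω : ℝ) * natArrivals A 0 b ω)) P ∧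
    Integrable (fun ω => X ω * (cumulativeRate lam J 0 a ω * cumulativeRate lam J 0 b ω +
        cumulativeRate lam J 0 (a ⊓ b) ω)) P ∧
    ∫ ω, X ω * ((natArrivals A 0 a ω : ℝ) * natArrivals A 0 b ω) ∂P =
      ∫ ω, X ω * (cumulativeRate lam J 0 a ω * cumulativeRate lam J 0 b ω +
        cumulativeRate lam J 0 (a ⊓ b) ω) ∂P := by
  wlog hab : a ≤ b generalizing a b
  · have := this b a (le_of_not_ge hab)
    simpa only [mul_comm (natArrivals A 0 b _ : ℝ), inf_comm b a,
      mul_comm (cumulativeRate lam J 0 b _)] using this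
  rw [inf_of_le_left hab]
  have hbd : ∀ {Y : Ω → ℝ} {C : ℝ}, Measurable[pathSigma J] Y → (∀ ω, |Y ω| ≤ C) →
      Integrable (fun ω => Y ω * (cumulativeRate lam J 0 a ω * cumulativeRate lam J 0 b ω +
        cumulativeRate lam J 0 a ω)) P := by
    intro Y C hY hC
    have hYm : Measurable Y := hY.mono (pathSigma_le hM.background.measurable) le_rfl
    refine Integrable.of_bound
      (C := C * ((a * ∑ i, lam i) * (b * ∑ i, lam i) + a * ∑ i, lam i))
      (hYm.mul (((hM.measurable_cumulativeRate_zero lam a).mul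
        (hM.measurable_cumulativeRate_zero lam b)).add
        (hM.measurable_cumulativeRate_zero lam a))).aestronglyMeasurable
      (ae_of_all _ fun ω => ?_)
    have ha := hM.abs_cumulativeRate_le hlam a ω
    have hb := hM.abs_cumulativeRate_le hlam b ω
    rw [norm_mul]
    refine mul_le_mul (hC ω) ((norm_add_le _ _).trans (add_le_add ?_ ha)) (norm_nonneg _)
      ((abs_nonneg _).trans (hC ω))
    rw [norm_mul]
    exact mul_le_mul ha hb (norm_nonneg _) ((abs_nonneg _).trans ha)
  -- A signed weight is the difference of the nonnegative weights `X + C` and `C`.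
  have hX1 : Measurable[pathSigma J] fun ω => X ω + C := hX.add_const C
  obtain ⟨i1, e1⟩ := hM.moments_of_le hlam hab hX1
    (fun ω => by have := (abs_le.1 (hXC ω)).1; linarith) (C := C + C)
    (fun ω => by have := (abs_le.1 (hXC ω)).2; linarith)
  obtain ⟨i2, e2⟩ := hM.moments_of_le hlam hab (X := fun _ => |C|) measurable_const
    (fun ω => abs_nonneg _) (fun ω => le_rfl)
  -- A point of `Ω` is needed to deduce `0 ≤ C` from `hXC`.
  by_cases hne : Nonempty Ω
  swap
  · have : IsEmpty Ω := not_nonempty_iff.1 hne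
    have : P = 0 := Measure.eq_zero_of_isEmpty P
    simp [this]
  obtain ⟨ω₀⟩ := hne
  have hC : |C| = C := abs_of_nonneg ((abs_nonneg _).trans (hXC ω₀))
  simp only [hC] at i2 e2
  have hb1 := hbd hX1 (C := C + C) fun ω =>
    (abs_add_le _ _).trans (add_le_add (hXC ω) hC.le)
  have hb2 := hbd (Y := fun _ => C) measurable_const (fun ω => hC.le)
  have hf : ∀ Y : Ω → ℝ, (fun ω => X ω * Y ω) = fun ω => (X ω + C) * Y ω - C * Y ω := by
    intro Y; ext ω; ring
  refine ⟨?_, hbd hX hXC, ?_⟩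
  · rw [hf]; exact i1.sub i2
  · rw [hf, hf, integral_sub i1 i2, integral_sub hb1 hb2, e1, e2]

lemma IsModelII.first_moment (hM : IsModelII Q ϖ lam mu P J A S)
    (hlam : ∀ i, 0 ≤ lam i) (a : ℝ≥0) {X : Ω → ℝ}
    (hX : Measurable[pathSigma J] X) {C : ℝ} (hXC : ∀ ω, |X ω| ≤ C) :
    Integrable (fun ω => X ω * (natArrivals A 0 a ω : ℝ)) P ∧
    Integrable (fun ω => X ω * cumulativeRate lam J 0 a ω) P ∧
    ∫ ω, X ω * (natArrivals A 0 a ω : ℝ) ∂P = ∫ ω, X ω * cumulativeRate lam J 0 a ω ∂P := by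
  have hbd : ∀ {Y : Ω → ℝ} {C : ℝ}, Measurable[pathSigma J] Y → (∀ ω, |Y ω| ≤ C) →
      Integrable (fun ω => Y ω * cumulativeRate lam J 0 a ω) P := by
    intro Y C hY hC
    have hYm : Measurable Y := hY.mono (pathSigma_le hM.background.measurable) le_rfl
    refine Integrable.of_bound (C := C * (a * ∑ i, lam i))
      (hYm.mul (hM.measurable_cumulativeRate_zero lam a)).aestronglyMeasurable
      (ae_of_all _ fun ω => ?_)
    rw [norm_mul]
    exact mul_le_mul (hC ω) (hM.abs_cumulativeRate_le hlam a ω) (norm_nonneg _)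
      ((abs_nonneg _).trans (hC ω))
  have key : ∀ {Y : Ω → ℝ} {C : ℝ}, Measurable[pathSigma J] Y → (∀ ω, 0 ≤ Y ω) →
      (∀ ω, Y ω ≤ C) → Integrable (fun ω => Y ω * (natArrivals A 0 a ω : ℝ)) P ∧
      ∫ ω, Y ω * (natArrivals A 0 a ω : ℝ) ∂P = ∫ ω, Y ω * cumulativeRate lam J 0 a ω ∂P := by
    intro Y C hY h0 hC
    simpa only [mul_one] using hM.integral_mul_counts hlam (le_refl a) hY h0 hC
      (f := fun k => (k : ℝ)) (g := fun _ => 1) (fun k => by positivity) (fun k => zero_le_one)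
      (F := fun x => x) (G := fun _ => 1) (fun hx => hasSum_natCast_mul_poissonWeight hx)
      (fun hx => by simpa using hasSum_poissonWeight hx) (by fun_prop) (by fun_prop)
  have hX1 : Measurable[pathSigma J] fun ω => X ω + C := hX.add_const C
  obtain ⟨i1, e1⟩ := key hX1
    (fun ω => by have := (abs_le.1 (hXC ω)).1; linarith) (C := C + C)
    (fun ω => by have := (abs_le.1 (hXC ω)).2; linarith)
  obtain ⟨i2, e2⟩ := key (Y := fun _ => |C|) measurable_const
    (fun ω => abs_nonneg _) (fun ω => le_rfl)
  by_cases hne : Nonempty Ω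
  swap
  · have : IsEmpty Ω := not_nonempty_iff.1 hne
    have : P = 0 := Measure.eq_zero_of_isEmpty P
    simp [this]
  obtain ⟨ω₀⟩ := hne
  have hC : |C| = C := abs_of_nonneg ((abs_nonneg _).trans (hXC ω₀))
  simp only [hC] at i2 e2
  have hb1 := hbd hX1 (C := C + C) fun ω =>
    (abs_add_le _ _).trans (add_le_add (hXC ω) hC.le)
  have hb2 := hbd (Y := fun _ => C) measurable_const (fun ω => hC.le)
  have hf : ∀ Y : Ω → ℝ, (fun ω => X ω * Y ω) = fun ω => (X ω + C) * Y ω - C * Y ω := by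
    intro Y; ext ω; ring
  refine ⟨?_, hbd hX hXC, ?_⟩
  · rw [hf]; exact i1.sub i2
  · rw [hf, hf, integral_sub i1 i2, integral_sub hb1 hb2, e1, e2]

lemma IsModelII.memLp_natArrivals (hM : IsModelII Q ϖ lam mu P J A S)
    (hlam : ∀ i, 0 ≤ lam i) (a : ℝ≥0) :
    MemLp (fun ω => (natArrivals A 0 a ω : ℝ)) 2 P := by
  rw [memLp_two_iff_integrable_sq]
  · simpa [sq] using (hM.moments hlam a a (X := fun _ => 1) measurable_const (C := 1)
      (fun _ => by simp)).1
  · exact ((measurable_of_countable (fun k : ℕ => (k : ℝ))).comp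
      (measurable_natArrivals hM.measurable_arrival 0 a)).aestronglyMeasurable

end SecondMoments

/-! ### Step functions of time with random coefficients -/

section StepFunctions

variable {d : ℕ} {lam : Fin d → ℝ} {Ω : Type*} {J : ℝ≥0 → Ω → Fin d} {A : ℕ → Ω → ℝ≥0∞}

/-- The integral of `F` with respect to the arrival rate over `(0, R]`. -/
noncomputable def rateIntegral (lam : Fin d → ℝ) (J : ℝ≥0 → Ω → Fin d) (F : ℝ≥0 → Ω → ℝ)
    (R : ℝ≥0) (ω : Ω) : ℝ :=
  ∫ s in (0 : ℝ)..R, F s.toNNReal ω * lam (J s.toNNReal ω)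

/-- The step function `∑ i ∈ I, c i 1_{[0, a i]}` with random coefficients. -/
noncomputable def stepFun {ι : Type*} (I : Finset ι) (c : ι → Ω → ℝ) (a : ι → ℝ≥0) (s : ℝ≥0) (ω : Ω) : ℝ :=
  ∑ i ∈ I, c i ω * if s ≤ a i then 1 else 0

variable {ι κ : Type*} (I : Finset ι) (c : ι → Ω → ℝ) (a : ι → ℝ≥0)
  (K : Finset κ) (e : κ → Ω → ℝ) (b : κ → ℝ≥0)

lemma arrivalSum_stepFun (hpos : ∀ n ω, 0 < A n ω) {R : ℝ≥0} (ha : ∀ i ∈ I, a i ≤ R) {ω : Ω}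
    (h : {n | A n ω ≤ R}.Finite) :
    arrivalSum A (stepFun I c a) R ω = ∑ i ∈ I, c i ω * (natArrivals A 0 (a i) ω : ℝ) := by
  rw [arrivalSum_eq_sum h]
  simp only [stepFun]
  rw [Finset.sum_comm]
  refine Finset.sum_congr rfl fun i hi => ?_
  rw [← Finset.mul_sum, arrivalSum_indicator hpos (ha i hi) h]

lemma integral_ite_toNNReal_le {x R : ℝ≥0} (hx : x ≤ R) (f : ℝ → ℝ) :
    ∫ s in (0 : ℝ)..R, (if s.toNNReal ≤ x then f s else 0) = ∫ s in (0 : ℝ)..x, f s := by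
  rw [intervalIntegral.integral_of_le R.coe_nonneg, intervalIntegral.integral_of_le x.coe_nonneg]
  have hxR : (x : ℝ) ≤ R := hx
  have : Set.Ioc (0 : ℝ) x = Set.Ioc (0 : ℝ) R ∩ Set.Iic (x : ℝ) := by
    ext s
    simp only [Set.mem_Ioc, Set.mem_inter_iff, Set.mem_Iic]
    constructor
    · rintro ⟨h1, h2⟩; exact ⟨⟨h1, h2.trans hxR⟩, h2⟩
    · rintro ⟨⟨h1, _⟩, h2⟩; exact ⟨h1, h2⟩
  rw [this, ← setIntegral_indicator measurableSet_Iic]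
  refine integral_congr_ae (ae_of_all _ fun s => ?_)
  simp only [Set.indicator_apply, Set.mem_Iic, Real.toNNReal_le_iff_le_coe]

lemma integral_indicator_rate {R x : ℝ≥0} (hx : x ≤ R) (ω : Ω) :
    ∫ s in (0 : ℝ)..R, (if s.toNNReal ≤ x then (1 : ℝ) else 0) * lam (J s.toNNReal ω) =
      cumulativeRate lam J 0 x ω := by
  simp only [ite_mul, one_mul, zero_mul]
  exact integral_ite_toNNReal_le hx _

lemma intervalIntegrable_indicator_rate (hlam : ∀ i, 0 ≤ lam i)
    (hr : ∀ ω t, ContinuousWithinAt (fun s => J s ω) (Set.Ici t) t) (x R : ℝ≥0) (ω : Ω) :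
    IntervalIntegrable
      (fun s : ℝ => (if s.toNNReal ≤ x then (1 : ℝ) else 0) * lam (J s.toNNReal ω))
      volume 0 R := by
  refine (intervalIntegrable_rate hlam hr ω 0 R).mono_fun ?_ (ae_of_all _ fun s => ?_)
  · refine Measurable.aestronglyMeasurable
      (Measurable.mul ?_ (measurable_rate_path hr lam ω))
    exact Measurable.ite (measurable_real_toNNReal measurableSet_Iic) measurable_const
      measurable_const
  · dsimp only
    split_ifs <;> simp

lemma rateIntegral_stepFun (hlam : ∀ i, 0 ≤ lam i)
    (hr : ∀ ω t, ContinuousWithinAt (fun s => J s ω) (Set.Ici t) t) {R : ℝ≥0}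
    (ha : ∀ i ∈ I, a i ≤ R) (ω : Ω) :
    rateIntegral lam J (stepFun I c a) R ω = ∑ i ∈ I, c i ω * cumulativeRate lam J 0 (a i) ω := by
  simp only [rateIntegral, stepFun, Finset.sum_mul, mul_assoc]
  rw [intervalIntegral.integral_finsetSum fun i _ =>
    (intervalIntegrable_indicator_rate hlam hr (a i) R ω).const_mul (c i ω)]
  refine Finset.sum_congr rfl fun i hi => ?_
  rw [intervalIntegral.integral_const_mul, integral_indicator_rate (ha i hi)]

/-- Indicators of `[0, a]` and `[0, b]` multiply to that of `[0, a ⊓ b]`. This identifies the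
minimum in the second moments with the integral of the product. -/
lemma stepFun_mul_stepFun (s : ℝ≥0) (ω : Ω) :
    stepFun I c a s ω * stepFun K e b s ω =
      stepFun (I ×ˢ K) (fun p ω => c p.1 ω * e p.2 ω) (fun p => a p.1 ⊓ b p.2) s ω := by
  simp only [stepFun, Finset.sum_mul_sum, Finset.sum_product, le_inf_iff]
  refine Finset.sum_congr rfl fun i _ => Finset.sum_congr rfl fun j _ => ?_
  split_ifs <;> simp_all

end StepFunctions

/-! ### Campbell's formulas for step functions -/

section CampbellStep

variable {d : ℕ} {Q : Matrix (Fin d) (Fin d) ℝ} {ϖ lam mu : Fin d → ℝ}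
  {Ω : Type*} [MeasurableSpace Ω] {P : Measure Ω} [IsProbabilityMeasure P]
  {J : ℝ≥0 → Ω → Fin d} {A : ℕ → Ω → ℝ≥0∞} {S : ℕ → Ω → ℝ}
  {ι κ : Type*} {I : Finset ι} {c : ι → Ω → ℝ} {a : ι → ℝ≥0}
  {K : Finset κ} {e : κ → Ω → ℝ} {b : κ → ℝ≥0} {C R : ℝ≥0}

lemma IsModelII.integral_arrivalSum_stepFun (hM : IsModelII Q ϖ lam mu P J A S)
    (hlam : ∀ i, 0 ≤ lam i) (hc : ∀ i, Measurable[pathSigma J] (c i))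
    (hcC : ∀ i ω, |c i ω| ≤ C) (ha : ∀ i ∈ I, a i ≤ R) :
    ∫ ω, arrivalSum A (stepFun I c a) R ω ∂P =
      ∫ ω, rateIntegral lam J (stepFun I c a) R ω ∂P := by
  have hm := fun i => hM.first_moment hlam (a i) (hc i) (hcC i)
  have h1 : (fun ω => arrivalSum A (stepFun I c a) R ω) =ᵐ[P]
      fun ω => ∑ i ∈ I, c i ω * (natArrivals A 0 (a i) ω : ℝ) := by
    filter_upwards [hM.ae_finite hlam] with ω hω
    exact arrivalSum_stepFun I c a hM.arrival_pos ha (hω R)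
  rw [integral_congr_ae h1, integral_finsetSum _ fun i _ => (hm i).1]
  simp only [rateIntegral_stepFun I c a hlam hM.background.right_continuous ha]
  rw [integral_finsetSum _ fun i _ => (hm i).2.1]
  exact Finset.sum_congr rfl fun i _ => (hm i).2.2

/-- Both sides are bilinear in the coefficients, so the claim reduces to `IsModelII.moments` with
weight `c i * e j`, which is determined by the path. -/
lemma IsModelII.integral_arrivalSum_mul_stepFun (hM : IsModelII Q ϖ lam mu P J A S)
    (hlam : ∀ i, 0 ≤ lam i) (hc : ∀ i, Measurable[pathSigma J] (c i))
    (hcC : ∀ i ω, |c i ω| ≤ C) (ha : ∀ i ∈ I, a i ≤ R)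
    (he : ∀ i, Measurable[pathSigma J] (e i))
    (heC : ∀ i ω, |e i ω| ≤ C) (hb : ∀ i ∈ K, b i ≤ R) :
    ∫ ω, arrivalSum A (stepFun I c a) R ω * arrivalSum A (stepFun K e b) R ω ∂P =
      ∫ ω, (rateIntegral lam J (stepFun I c a) R ω * rateIntegral lam J (stepFun K e b) R ω +
        rateIntegral lam J (fun s ω => stepFun I c a s ω * stepFun K e b s ω) R ω) ∂P := by
  have hm := fun i j => hM.moments hlam (a i) (b j) (X := fun ω => c i ω * e j ω)
    ((hc i).mul (he j)) (C := C * C) fun ω => by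
      rw [abs_mul]; exact mul_le_mul (hcC i ω) (heC j ω) (abs_nonneg _) C.coe_nonneg
  have h1 : (fun ω => arrivalSum A (stepFun I c a) R ω * arrivalSum A (stepFun K e b) R ω) =ᵐ[P]
      fun ω => ∑ i ∈ I, ∑ j ∈ K, (c i ω * e j ω) *
        ((natArrivals A 0 (a i) ω : ℝ) * natArrivals A 0 (b j) ω) := by
    filter_upwards [hM.ae_finite hlam] with ω hω
    rw [arrivalSum_stepFun I c a hM.arrival_pos ha (hω R),
      arrivalSum_stepFun K e b hM.arrival_pos hb (hω R), Finset.sum_mul_sum]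
    exact Finset.sum_congr rfl fun i _ => Finset.sum_congr rfl fun j _ => by ring
  have h2 : ∀ ω, rateIntegral lam J (stepFun I c a) R ω * rateIntegral lam J (stepFun K e b) R ω +
        rateIntegral lam J (fun s ω => stepFun I c a s ω * stepFun K e b s ω) R ω =
      ∑ i ∈ I, ∑ j ∈ K, (c i ω * e j ω) *
        (cumulativeRate lam J 0 (a i) ω * cumulativeRate lam J 0 (b j) ω +
        cumulativeRate lam J 0 (a i ⊓ b j) ω) := by
    intro ω
    have h3 : (fun s ω => stepFun I c a s ω * stepFun K e b s ω) =
        stepFun (I ×ˢ K) (fun p ω => c p.1 ω * e p.2 ω) (fun p => a p.1 ⊓ b p.2) := by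
      ext s ω
      exact stepFun_mul_stepFun I c a K e b s ω
    have hr := hM.background.right_continuous
    rw [h3, rateIntegral_stepFun I c a hlam hr ha, rateIntegral_stepFun K e b hlam hr hb,
      rateIntegral_stepFun _ _ _ hlam hr fun p hp =>
        inf_le_left.trans (ha p.1 (Finset.mem_product.1 hp).1),
      Finset.sum_mul_sum, Finset.sum_product, ← Finset.sum_add_distrib]
    refine Finset.sum_congr rfl fun i _ => ?_
    rw [← Finset.sum_add_distrib]
    exact Finset.sum_congr rfl fun j _ => by ring
  simp only [h2]
  rw [integral_congr_ae h1,
    integral_finsetSum _ fun i _ => integrable_finsetSum _ fun j _ => (hm i j).1,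
    integral_finsetSum _ fun i _ => integrable_finsetSum _ fun j _ => (hm i j).2.1]
  refine Finset.sum_congr rfl fun i _ => ?_
  rw [integral_finsetSum _ fun j _ => (hm i j).1, integral_finsetSum _ fun j _ => (hm i j).2.1]
  exact Finset.sum_congr rfl fun j _ => (hm i j).2.2

end CampbellStep

/-! ### Grid approximation of functions of time and state -/

section Discretization

variable {d : ℕ} {Ω : Type*}

/-- The function of the state of the chain that is given by `φ` up to time `t`. -/
noncomputable def cutFun (J : ℝ≥0 → Ω → Fin d) (φ : ℝ≥0 → Fin d → ℝ) (t s : ℝ≥0) (ω : Ω) : ℝ :=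
  if s ≤ t then φ s (J s ω) else 0

/-- The approximation of `cutFun` by a step function on the grid `(k + 1)⁻¹ ℕ`. -/
noncomputable def gridFun (J : ℝ≥0 → Ω → Fin d) (φ : ℝ≥0 → Fin d → ℝ) (t : ℝ≥0) (k : ℕ) :
    ℝ≥0 → Ω → ℝ :=
  stepFun (Finset.range ((k + 1) * ⌈t⌉₊) ×ˢ (Finset.univ : Finset Bool))
    (fun p ω => (if p.2 then 1 else -1) *
      φ (((p.1 + 1 : ℕ) : ℝ≥0) / (k + 1)) (J (((p.1 + 1 : ℕ) : ℝ≥0) / (k + 1)) ω))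
    (fun p => ((p.1 + if p.2 then 1 else 0 : ℕ) : ℝ≥0) / (k + 1) ⊓ t)

/-- The two Boolean values form the difference of two indicators, which is the indicator of a
half-open grid cell cut at `t`; the coefficient is read at the cell's right endpoint. Looking ahead
is harmless because the conditioning is on the whole path. Time `0` lies in no cell, hence `0 < s`;
arrivals are positive, so nothing is lost. -/
lemma gridFun_eq (J : ℝ≥0 → Ω → Fin d) (φ : ℝ≥0 → Fin d → ℝ) (t : ℝ≥0) (k : ℕ) {s : ℝ≥0}
    (hs : 0 < s) (ω : Ω) :
    gridFun J φ t k s ω = if s ≤ t then φ (gridCeil k s) (J (gridCeil k s) ω) else 0 := by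
  have hle : ∀ l : ℕ, s ≤ (l : ℝ≥0) / (k + 1) ⊓ t ↔ ⌈s * (k + 1)⌉₊ ≤ l ∧ s ≤ t := by
    intro l
    rw [le_inf_iff, le_div_iff₀ (by positivity), Nat.ceil_le]
  simp only [gridFun, stepFun, Finset.sum_product, Fintype.sum_bool, if_true, hle,
    Bool.false_eq_true, if_false, add_zero]
  by_cases hst : s ≤ t
  · simp only [hst, and_true, if_true]
    have hj : 0 < ⌈s * (k + 1)⌉₊ := Nat.ceil_pos.2 (by positivity)
    obtain ⟨j, hj'⟩ := Nat.exists_eq_succ_of_ne_zero hj.ne'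
    have hjt : j < (k + 1) * ⌈t⌉₊ := by
      have : ⌈s * (k + 1)⌉₊ ≤ (k + 1) * ⌈t⌉₊ := by
        rw [Nat.ceil_le]
        push_cast
        rw [mul_comm]
        exact mul_le_mul_right (hst.trans (Nat.le_ceil t)) _
      omega
    -- For `l < j` both indicators are `0`, for `l > j` both are `1` and cancel.
    rw [Finset.sum_eq_single_of_mem j (Finset.mem_range.2 hjt)]
    · simp [gridCeil, hj']
    · intro l _ hl
      rcases Nat.lt_or_gt_of_ne hl with h | h
      · rw [if_neg (by omega), if_neg (by omega)]; simp
      · rw [if_pos (by omega), if_pos (by omega)]; simp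
  · simp [hst]

variable {J : ℝ≥0 → Ω → Fin d} {φ : ℝ≥0 → Fin d → ℝ}

lemma abs_gridFun_le (hφ : ∀ s i, |φ s i| ≤ 1) (t : ℝ≥0) (k : ℕ) {s : ℝ≥0}
    (hs : 0 < s) (ω : Ω) : |gridFun J φ t k s ω| ≤ 1 := by
  rw [gridFun_eq J φ t k hs]
  split_ifs
  · exact hφ _ _
  · simp

lemma tendsto_gridFun (hφc : ∀ i, Continuous fun s => φ s i)
    (hr : ∀ ω t, ContinuousWithinAt (fun s => J s ω) (Set.Ici t) t) (t : ℝ≥0) {s : ℝ≥0}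
    (hs : 0 < s) (ω : Ω) :
    Tendsto (fun k => gridFun J φ t k s ω) atTop (𝓝 (cutFun J φ t s ω)) := by
  simp only [gridFun_eq J φ t _ hs, cutFun]
  split_ifs
  · have h1 : Tendsto (fun k => φ (gridCeil k s) (J s ω)) atTop (𝓝 (φ s (J s ω))) :=
      ((hφc (J s ω)).tendsto s).comp
        ((tendsto_gridCeil s).mono_right nhdsWithin_le_nhds)
    refine h1.congr' ?_
    filter_upwards [eventually_gridCeil_state hr ω s] with k hk
    rw [hk]
  · exact tendsto_const_nhds

end Discretization

/-! ### Campbell's formulas for functions of time and state -/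

section Campbell

variable {d : ℕ} {Q : Matrix (Fin d) (Fin d) ℝ} {ϖ lam mu : Fin d → ℝ}
  {Ω : Type*} [MeasurableSpace Ω] {P : Measure Ω} [IsProbabilityMeasure P]
  {J : ℝ≥0 → Ω → Fin d} {A : ℕ → Ω → ℝ≥0∞} {S : ℕ → Ω → ℝ}

lemma abs_arrivalSum_le {F : ℝ≥0 → Ω → ℝ} (hpos : ∀ n ω, 0 < A n ω) {R : ℝ≥0} {ω : Ω}
    (hF : ∀ s, 0 < s → |F s ω| ≤ 1) (h : {n | A n ω ≤ R}.Finite) :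
    |arrivalSum A F R ω| ≤ natArrivals A 0 R ω := by
  rw [arrivalSum_eq_sum h, natArrivals_zero_eq_card hpos h, Finset.card_eq_sum_ones,
    Nat.cast_sum]
  refine (Finset.abs_sum_le_sum_abs _ _).trans (Finset.sum_le_sum fun n hn => ?_)
  rw [Nat.cast_one]
  refine hF _ (ENNReal.toNNReal_pos (hpos n ω).ne' ?_)
  have : A n ω ≤ R := by simpa using hn
  exact ne_top_of_le_ne_top ENNReal.coe_ne_top this

lemma tendsto_arrivalSum {F : ℕ → ℝ≥0 → Ω → ℝ} {G : ℝ≥0 → Ω → ℝ} (hpos : ∀ n ω, 0 < A n ω)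
    {R : ℝ≥0} {ω : Ω} (hF : ∀ s, 0 < s → Tendsto (fun k => F k s ω) atTop (𝓝 (G s ω)))
    (h : {n | A n ω ≤ R}.Finite) :
    Tendsto (fun k => arrivalSum A (F k) R ω) atTop (𝓝 (arrivalSum A G R ω)) := by
  simp only [arrivalSum_eq_sum h]
  refine tendsto_finsetSum _ fun n hn => hF _ (ENNReal.toNNReal_pos (hpos n ω).ne' ?_)
  have : A n ω ≤ R := by simpa using hn
  exact ne_top_of_le_ne_top ENNReal.coe_ne_top this

lemma abs_rateIntegral_le (hlam : ∀ i, 0 ≤ lam i) {F : ℝ≥0 → Ω → ℝ} {R : ℝ≥0} {ω : Ω}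
    (hF : ∀ s, 0 < s → |F s ω| ≤ 1) :
    |rateIntegral lam J F R ω| ≤ R * ∑ i, lam i := by
  have := intervalIntegral.norm_integral_le_of_norm_le_const (a := (0 : ℝ)) (b := R)
    (f := fun s : ℝ => F s.toNNReal ω * lam (J s.toNNReal ω)) (C := ∑ i, lam i) fun s hs => by
      rw [Set.uIoc_of_le R.coe_nonneg] at hs
      rw [norm_mul, Real.norm_of_nonneg (hlam _)]
      calc _ ≤ 1 * lam (J s.toNNReal ω) :=
            mul_le_mul_of_nonneg_right (hF _ (Real.toNNReal_pos.2 hs.1)) (hlam _)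
        _ ≤ _ := by rw [one_mul]; exact le_sum_rate hlam _
  rw [sub_zero, abs_of_nonneg R.coe_nonneg, mul_comm] at this
  exact this

lemma tendsto_rateIntegral (hlam : ∀ i, 0 ≤ lam i) {F : ℕ → ℝ≥0 → Ω → ℝ} {G : ℝ≥0 → Ω → ℝ}
    {R : ℝ≥0} {ω : Ω}
    (hm : ∀ k, Measurable fun s : ℝ => F k s.toNNReal ω * lam (J s.toNNReal ω))
    (hF1 : ∀ k s, 0 < s → |F k s ω| ≤ 1)
    (hF : ∀ s, 0 < s → Tendsto (fun k => F k s ω) atTop (𝓝 (G s ω))) :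
    Tendsto (fun k => rateIntegral lam J (F k) R ω) atTop (𝓝 (rateIntegral lam J G R ω)) := by
  refine intervalIntegral.tendsto_integral_filter_of_dominated_convergence
    (fun _ => ∑ i, lam i) (Eventually.of_forall fun k => (hm k).aestronglyMeasurable)
    (Eventually.of_forall fun k => ae_of_all _ fun s hs => ?_) intervalIntegrable_const
    (ae_of_all _ fun s hs => ?_)
  · rw [Set.uIoc_of_le R.coe_nonneg] at hs
    rw [norm_mul, Real.norm_of_nonneg (hlam _)]
    calc _ ≤ 1 * lam (J s.toNNReal ω) :=
          mul_le_mul_of_nonneg_right (hF1 k _ (Real.toNNReal_pos.2 hs.1)) (hlam _)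
      _ ≤ _ := by rw [one_mul]; exact le_sum_rate hlam _
  · rw [Set.uIoc_of_le R.coe_nonneg] at hs
    exact (hF _ (Real.toNNReal_pos.2 hs.1)).mul_const _

lemma measurable_stepFun_path {ι : Type*} (I : Finset ι) (c : ι → Ω → ℝ) (a : ι → ℝ≥0) (ω : Ω) :
    Measurable fun s : ℝ≥0 => stepFun I c a s ω := by
  unfold stepFun
  exact Finset.measurable_fun_sum _ fun i _ => measurable_const.mul
    (Measurable.ite measurableSet_Iic measurable_const measurable_const)

lemma measurable_gridCoeff (φ : ℝ≥0 → Fin d → ℝ) (k : ℕ)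
    (p : ℕ × Bool) : Measurable[pathSigma J] fun ω => (if p.2 then (1 : ℝ) else -1) *
      φ (((p.1 + 1 : ℕ) : ℝ≥0) / (k + 1)) (J (((p.1 + 1 : ℕ) : ℝ≥0) / (k + 1)) ω) :=
  measurable_const.mul ((measurable_of_finite _).comp (measurable_state_pathSigma _))

lemma IsModelII.aestronglyMeasurable_arrivalSum_stepFun (hM : IsModelII Q ϖ lam mu P J A S)
    (hlam : ∀ i, 0 ≤ lam i) {ι : Type*} {I : Finset ι} {c : ι → Ω → ℝ} {a : ι → ℝ≥0}
    (hc : ∀ i, Measurable (c i)) {R : ℝ≥0} (ha : ∀ i ∈ I, a i ≤ R) :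
    AEStronglyMeasurable (arrivalSum A (stepFun I c a) R) P := by
  have h1 : arrivalSum A (stepFun I c a) R =ᵐ[P]
      fun ω => ∑ i ∈ I, c i ω * (natArrivals A 0 (a i) ω : ℝ) := by
    filter_upwards [hM.ae_finite hlam] with ω hω
    exact arrivalSum_stepFun I c a hM.arrival_pos ha (hω R)
  refine AEStronglyMeasurable.congr ?_ h1.symm
  refine Measurable.aestronglyMeasurable
    (Finset.measurable_fun_sum _ fun i _ => (hc i).mul ?_)
  exact (measurable_of_countable (fun k : ℕ => (k : ℝ))).comp
    (measurable_natArrivals hM.measurable_arrival 0 _)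

lemma IsModelII.aestronglyMeasurable_arrivalSum_gridFun (hM : IsModelII Q ϖ lam mu P J A S)
    (hlam : ∀ i, 0 ≤ lam i) (φ : ℝ≥0 → Fin d → ℝ) {t R : ℝ≥0} (ht : t ≤ R) (k : ℕ) :
    AEStronglyMeasurable (arrivalSum A (gridFun J φ t k) R) P :=
  hM.aestronglyMeasurable_arrivalSum_stepFun hlam
    (fun i => (measurable_gridCoeff φ k i).mono (pathSigma_le hM.background.measurable) le_rfl)
    fun _ _ => inf_le_right.trans ht

lemma measurable_uncurry_stepFun {ι : Type*} {I : Finset ι} {c : ι → Ω → ℝ} {a : ι → ℝ≥0}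
    (hc : ∀ i, Measurable (c i)) : Measurable fun p : ℝ≥0 × Ω => stepFun I c a p.1 p.2 := by
  unfold stepFun
  exact Finset.measurable_fun_sum _ fun i _ => ((hc i).comp measurable_snd).mul
    (Measurable.ite (measurable_fst measurableSet_Iic) measurable_const measurable_const)

lemma IsModelII.measurable_gridFun (hM : IsModelII Q ϖ lam mu P J A S)
    (φ : ℝ≥0 → Fin d → ℝ) (t : ℝ≥0) (k : ℕ) :
    Measurable fun p : ℝ≥0 × Ω => gridFun J φ t k p.1 p.2 :=
  measurable_uncurry_stepFun fun i => (measurable_gridCoeff φ k i).mono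
      (pathSigma_le hM.background.measurable) le_rfl

lemma IsModelII.measurable_rateIntegral (hM : IsModelII Q ϖ lam mu P J A S)
    {F : ℝ≥0 → Ω → ℝ} (hF : Measurable fun p : ℝ≥0 × Ω => F p.1 p.2) (R : ℝ≥0) :
    Measurable (rateIntegral lam J F R) := by
  unfold rateIntegral
  simp only [intervalIntegral.integral_of_le R.coe_nonneg]
  have h := measurable_rate lam _ hM.background.measurable hM.background.right_continuous
  have h2 : Measurable fun p : Ω × ℝ => F p.2.toNNReal p.1 * lam (J p.2.toNNReal p.1) :=
    (hF.comp ((measurable_real_toNNReal.comp measurable_snd).prodMk measurable_fst)).mul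
      (h.comp measurable_swap)
  exact (h2.stronglyMeasurable.integral_prod_right'
    (ν := volume.restrict (Set.Ioc (0 : ℝ) R))).measurable

/-- The first moment formula for sums over the arrival times. -/
theorem IsModelII.integral_arrivalSum (hM : IsModelII Q ϖ lam mu P J A S)
    (hlam : ∀ i, 0 ≤ lam i) {φ : ℝ≥0 → Fin d → ℝ} (hφ : ∀ s i, |φ s i| ≤ 1)
    (hφc : ∀ i, Continuous fun s => φ s i) {t R : ℝ≥0} (ht : t ≤ R) :
    ∫ ω, arrivalSum A (cutFun J φ t) R ω ∂P =
      ∫ ω, rateIntegral lam J (cutFun J φ t) R ω ∂P := by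
  have hr := hM.background.right_continuous
  have hfin := hM.ae_finite hlam
  have hmJ := measurable_rate_path hr lam
  have hstep : ∀ k, ∫ ω, arrivalSum A (gridFun J φ t k) R ω ∂P =
      ∫ ω, rateIntegral lam J (gridFun J φ t k) R ω ∂P := fun k =>
    hM.integral_arrivalSum_stepFun hlam (measurable_gridCoeff φ k)
      (C := 1) (fun p ω => by
        rw [abs_mul]
        exact mul_le_one₀ (by split_ifs <;> simp) (abs_nonneg _) (hφ _ _))
      (fun i _ => inf_le_right.trans ht)
  -- Both sides are limits of the same sequence: the sums are dominated by the number of arrivals up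
  -- to `R`, the rate integrals by the constant `R * ∑ i, lam i`.
  refine tendsto_nhds_unique (f := fun k => ∫ ω, arrivalSum A (gridFun J φ t k) R ω ∂P)
    (l := atTop) ?_ ?_
  · refine tendsto_integral_of_dominated_convergence (fun ω => (natArrivals A 0 R ω : ℝ))
      (fun k => hM.aestronglyMeasurable_arrivalSum_gridFun hlam φ ht k)
      ((hM.memLp_natArrivals hlam R).integrable (by norm_num)) (fun k => ?_) ?_
    · filter_upwards [hfin] with ω hω
      exact abs_arrivalSum_le hM.arrival_pos (fun s hs => abs_gridFun_le hφ t k hs ω) (hω R)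
    · filter_upwards [hfin] with ω hω
      exact tendsto_arrivalSum hM.arrival_pos (fun s hs => tendsto_gridFun hφc hr t hs ω) (hω R)
  · simp only [hstep]
    refine tendsto_integral_of_dominated_convergence (fun ω => (R * ∑ i, lam i : ℝ))
      (fun k => (hM.measurable_rateIntegral
        (hM.measurable_gridFun φ t k) R).aestronglyMeasurable)
      (integrable_const _)
      (fun k => ae_of_all _ fun ω => abs_rateIntegral_le hlam
        fun s hs => abs_gridFun_le hφ t k hs ω) (ae_of_all _ fun ω => ?_)
    exact tendsto_rateIntegral hlam
      (fun k => ((measurable_stepFun_path _ _ _ ω).comp measurable_real_toNNReal).mul (hmJ ω))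
      (fun k s hs => abs_gridFun_le hφ t k hs ω) fun s hs => tendsto_gridFun hφc hr t hs ω

/-- The second moment formula for sums over the arrival times. -/
theorem IsModelII.integral_arrivalSum_mul (hM : IsModelII Q ϖ lam mu P J A S)
    (hlam : ∀ i, 0 ≤ lam i) {φ ψ : ℝ≥0 → Fin d → ℝ} (hφ : ∀ s i, |φ s i| ≤ 1)
    (hφc : ∀ i, Continuous fun s => φ s i) (hψ : ∀ s i, |ψ s i| ≤ 1)
    (hψc : ∀ i, Continuous fun s => ψ s i) {t T R : ℝ≥0} (ht : t ≤ R) (hT : T ≤ R) :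
    ∫ ω, arrivalSum A (cutFun J φ t) R ω * arrivalSum A (cutFun J ψ T) R ω ∂P =
      ∫ ω, (rateIntegral lam J (cutFun J φ t) R ω * rateIntegral lam J (cutFun J ψ T) R ω +
        rateIntegral lam J (fun s ω => cutFun J φ t s ω * cutFun J ψ T s ω) R ω) ∂P := by
  have hr := hM.background.right_continuous
  have hfin := hM.ae_finite hlam
  have hmJ := measurable_rate_path hr lam
  have hcoef : ∀ {φ : ℝ≥0 → Fin d → ℝ}, (∀ s i, |φ s i| ≤ 1) → ∀ (k : ℕ) (p : ℕ × Bool) ω,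
      |(if p.2 then (1 : ℝ) else -1) *
      φ (((p.1 + 1 : ℕ) : ℝ≥0) / (k + 1)) (J (((p.1 + 1 : ℕ) : ℝ≥0) / (k + 1)) ω)| ≤
      (1 : ℝ≥0) := by
    intro φ hφ k p ω
    rw [abs_mul]
    exact mul_le_one₀ (by split_ifs <;> simp) (abs_nonneg _) (hφ _ _)
  have hstep : ∀ k, ∫ ω, arrivalSum A (gridFun J φ t k) R ω *
        arrivalSum A (gridFun J ψ T k) R ω ∂P =
      ∫ ω, (rateIntegral lam J (gridFun J φ t k) R ω * rateIntegral lam J (gridFun J ψ T k) R ω +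
        rateIntegral lam J (fun s ω => gridFun J φ t k s ω * gridFun J ψ T k s ω) R ω) ∂P :=
    fun k => hM.integral_arrivalSum_mul_stepFun hlam
      (measurable_gridCoeff φ k)
      (hcoef hφ k) (fun i _ => inf_le_right.trans ht)
      (measurable_gridCoeff ψ k)
      (hcoef hψ k) (fun i _ => inf_le_right.trans hT)
  -- The dominating function for the products is now the squared number of arrivals, integrable by
  -- the second Poisson moment.
  refine tendsto_nhds_unique (f := fun k => ∫ ω, arrivalSum A (gridFun J φ t k) R ω *
    arrivalSum A (gridFun J ψ T k) R ω ∂P) (l := atTop) ?_ ?_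
  · refine tendsto_integral_of_dominated_convergence
      (fun ω => (natArrivals A 0 R ω : ℝ) * natArrivals A 0 R ω)
      (fun k => (hM.aestronglyMeasurable_arrivalSum_gridFun hlam φ ht k).mul
        (hM.aestronglyMeasurable_arrivalSum_gridFun hlam ψ hT k))
      ((hM.memLp_natArrivals hlam R).integrable_mul (hM.memLp_natArrivals hlam R))
      (fun k => ?_) ?_
    · filter_upwards [hfin] with ω hω
      rw [norm_mul]
      exact mul_le_mul
        (abs_arrivalSum_le hM.arrival_pos (fun s hs => abs_gridFun_le hφ t k hs ω) (hω R))
        (abs_arrivalSum_le hM.arrival_pos (fun s hs => abs_gridFun_le hψ T k hs ω) (hω R))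
        (norm_nonneg _) (Nat.cast_nonneg _)
    · filter_upwards [hfin] with ω hω
      exact (tendsto_arrivalSum hM.arrival_pos
        (fun s hs => tendsto_gridFun hφc hr t hs ω) (hω R)).mul
        (tendsto_arrivalSum hM.arrival_pos (fun s hs => tendsto_gridFun hψc hr T hs ω) (hω R))
  · simp only [hstep]
    have hprod : ∀ k ω s, 0 < s → |gridFun J φ t k s ω * gridFun J ψ T k s ω| ≤ 1 := by
      intro k ω s hs
      rw [abs_mul]
      exact mul_le_one₀ (abs_gridFun_le hφ t k hs ω) (abs_nonneg _) (abs_gridFun_le hψ T k hs ω)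
    refine tendsto_integral_of_dominated_convergence
      (fun ω => ((R * ∑ i, lam i) * (R * ∑ i, lam i) + R * ∑ i, lam i : ℝ))
      (fun k => (((hM.measurable_rateIntegral (hM.measurable_gridFun φ t k) R).mul
        (hM.measurable_rateIntegral (hM.measurable_gridFun ψ T k) R)).add
        (hM.measurable_rateIntegral ((hM.measurable_gridFun φ t k).mul
          (hM.measurable_gridFun ψ T k)) R)).aestronglyMeasurable)
      (integrable_const _)
      (fun k => ae_of_all _ fun ω => ?_) (ae_of_all _ fun ω => ?_)
    · have h1 := abs_rateIntegral_le (J := J) (F := gridFun J φ t k) (ω := ω) (R := R) hlam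
        fun s hs => abs_gridFun_le hφ t k hs ω
      have h2 := abs_rateIntegral_le (J := J) (F := gridFun J ψ T k) (ω := ω) (R := R) hlam
        fun s hs => abs_gridFun_le hψ T k hs ω
      refine (norm_add_le _ _).trans (add_le_add ?_ (abs_rateIntegral_le hlam (hprod k ω)))
      rw [norm_mul]
      exact mul_le_mul h1 h2 (norm_nonneg _) ((abs_nonneg _).trans h1)
    · have m1 := fun k => (measurable_stepFun_path (Ω := Ω) _ _ _ ω :
        Measurable fun s => gridFun J φ t k s ω).comp measurable_real_toNNReal
      have m2 := fun k => (measurable_stepFun_path (Ω := Ω) _ _ _ ω :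
        Measurable fun s => gridFun J ψ T k s ω).comp measurable_real_toNNReal
      refine ((tendsto_rateIntegral hlam (fun k => (m1 k).mul (hmJ ω))
        (fun k s hs => abs_gridFun_le hφ t k hs ω)
        fun s hs => tendsto_gridFun hφc hr t hs ω).mul
        (tendsto_rateIntegral hlam (fun k => (m2 k).mul (hmJ ω))
        (fun k s hs => abs_gridFun_le hψ T k hs ω)
        fun s hs => tendsto_gridFun hψc hr T hs ω)).add ?_
      exact tendsto_rateIntegral (F := fun k s ω => gridFun J φ t k s ω * gridFun J ψ T k s ω)
        hlam (fun k => ((m1 k).mul (m2 k)).mul (hmJ ω))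
        (fun k => hprod k ω)
        fun s hs => (tendsto_gridFun hφc hr t hs ω).mul (tendsto_gridFun hψc hr T hs ω)

end Campbell

/-! ### Exponential variables exceeding independent thresholds -/

section Exponential

lemma expMeasure_one_Ioi {x : ℝ} (hx : 0 ≤ x) :
    expMeasure 1 (Set.Ioi x) = ENNReal.ofReal (Real.exp (-x)) := by
  have := isProbabilityMeasure_expMeasure (r := 1) one_pos
  have h := cdf_expMeasure_eq (r := 1) one_pos x
  rw [cdf_eq_real, if_pos hx, one_mul] at h
  rw [← Set.compl_Iic, ← ofReal_measureReal, probReal_compl_eq_one_sub measurableSet_Iic, h,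
    sub_sub_cancel]

variable {Ω ζ : Type*} [MeasurableSpace Ω] [MeasurableSpace ζ] {P : Measure Ω}
  [IsProbabilityMeasure P] {X Y : Ω → ℝ} {Z : Ω → ζ} {B : Set ζ} {f g : ζ → ℝ}

/-- By independence the law of `(Z, X)` is a product; integrating out `X` first leaves the
exponential tail at `f z`. -/
lemma measure_lt_exp (hZ : Measurable Z) (hX : HasLaw X (expMeasure 1) P)
    (hXZ : IndepFun X Z P) (hB : MeasurableSet B) (hf : Measurable f) (hf0 : ∀ z, 0 ≤ f z) :
    P {ω | Z ω ∈ B ∧ f (Z ω) < X ω} =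
      ∫⁻ ω, B.indicator (fun z => ENNReal.ofReal (Real.exp (-f z))) (Z ω) ∂P := by
  have := isProbabilityMeasure_expMeasure (r := 1) one_pos
  have hmap := hXZ.symm.map_prod_eq_prod_map_map hZ.aemeasurable hX.aemeasurable
  rw [hX.map_eq] at hmap
  have hD : MeasurableSet {p : ζ × ℝ | p.1 ∈ B ∧ f p.1 < p.2} :=
    (measurable_fst hB).inter (measurableSet_lt (hf.comp measurable_fst) measurable_snd)
  have h1 : P {ω | Z ω ∈ B ∧ f (Z ω) < X ω} =
      (P.map fun ω => (Z ω, X ω)) {p : ζ × ℝ | p.1 ∈ B ∧ f p.1 < p.2} := by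
    rw [Measure.map_apply_of_aemeasurable (hZ.aemeasurable.prodMk hX.aemeasurable) hD]
    rfl
  rw [h1, hmap, Measure.prod_apply hD,
    ← lintegral_map (f := B.indicator fun z => ENNReal.ofReal (Real.exp (-f z)))
      ((hf.neg.exp.ennreal_ofReal).indicator hB) hZ]
  refine lintegral_congr fun z => ?_
  by_cases hz : z ∈ B
  · rw [Set.indicator_of_mem hz, ← expMeasure_one_Ioi (hf0 z)]
    congr 1
    ext x
    simp [hz]
  · rw [Set.indicator_of_notMem hz]
    convert measure_empty (μ := expMeasure 1)
    ext x
    simp [hz]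

lemma measure_lt_exp_and_lt_exp (hZ : Measurable Z) (hX : HasLaw X (expMeasure 1) P)
    (hY : HasLaw Y (expMeasure 1) P) (hXY : IndepFun X Y P)
    (hXYZ : IndepFun (fun ω => (X ω, Y ω)) Z P) (hB : MeasurableSet B)
    (hf : Measurable f) (hf0 : ∀ z, 0 ≤ f z) (hg : Measurable g) (hg0 : ∀ z, 0 ≤ g z) :
    P {ω | Z ω ∈ B ∧ f (Z ω) < X ω ∧ g (Z ω) < Y ω} =
      ∫⁻ ω, B.indicator (fun z => ENNReal.ofReal (Real.exp (-f z)) *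
        ENNReal.ofReal (Real.exp (-g z))) (Z ω) ∂P := by
  have := isProbabilityMeasure_expMeasure (r := 1) one_pos
  have hXYm := hX.aemeasurable.prodMk hY.aemeasurable
  have hmap := hXYZ.symm.map_prod_eq_prod_map_map hZ.aemeasurable hXYm
  rw [hXY.map_prod_eq_prod_map_map hX.aemeasurable hY.aemeasurable, hX.map_eq, hY.map_eq] at hmap
  have hD : MeasurableSet {p : ζ × (ℝ × ℝ) | p.1 ∈ B ∧ f p.1 < p.2.1 ∧ g p.1 < p.2.2} :=
    (measurable_fst hB).inter
      ((measurableSet_lt (hf.comp measurable_fst) (measurable_fst.comp measurable_snd)).inter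
      (measurableSet_lt (hg.comp measurable_fst) (measurable_snd.comp measurable_snd)))
  have h1 : P {ω | Z ω ∈ B ∧ f (Z ω) < X ω ∧ g (Z ω) < Y ω} =
      (P.map fun ω => (Z ω, (X ω, Y ω)))
        {p : ζ × (ℝ × ℝ) | p.1 ∈ B ∧ f p.1 < p.2.1 ∧ g p.1 < p.2.2} := by
    rw [Measure.map_apply_of_aemeasurable (hZ.aemeasurable.prodMk hXYm) hD]
    rfl
  rw [h1, hmap, Measure.prod_apply hD,
    ← lintegral_map (f := B.indicator fun z => ENNReal.ofReal (Real.exp (-f z)) *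
        ENNReal.ofReal (Real.exp (-g z)))
      ((hf.neg.exp.ennreal_ofReal.mul hg.neg.exp.ennreal_ofReal).indicator hB) hZ]
  refine lintegral_congr fun z => ?_
  by_cases hz : z ∈ B
  · rw [Set.indicator_of_mem hz, ← expMeasure_one_Ioi (hf0 z), ← expMeasure_one_Ioi (hg0 z),
      ← Measure.prod_prod]
    congr 1
    ext x
    simp [hz]
  · rw [Set.indicator_of_notMem hz]
    convert measure_empty (μ := (expMeasure 1).prod (expMeasure 1))
    ext x
    simp [hz]

end Exponential

/-! ### Arrival times marked by the state of the chain -/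

section Marks

variable {d : ℕ} {Ω : Type*} {J : ℝ≥0 → Ω → Fin d} {A : ℕ → Ω → ℝ≥0∞}

/-- The arrival time of a job and the state of the background process at that time. -/
def arrivalMark (J : ℝ≥0 → Ω → Fin d) (A : ℕ → Ω → ℝ≥0∞) (n : ℕ) (ω : Ω) : ℝ≥0∞ × Fin d :=
  (A n ω, J (A n ω).toNNReal ω)

/-- The σ-algebra of the background process and the arrival times. -/
abbrev arrivalSigma (J : ℝ≥0 → Ω → Fin d) (A : ℕ → Ω → ℝ≥0∞) : MeasurableSpace Ω :=
  MeasurableSpace.comap (fun ω => ((fun t => J t ω), (fun n => A n ω))) inferInstance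

lemma measurable_arrivalMark (m : MeasurableSpace Ω) (hJ : ∀ t, Measurable (J t))
    (hr : ∀ ω t, ContinuousWithinAt (fun s => J s ω) (Set.Ici t) t)
    (hA : ∀ n, Measurable (A n)) (n : ℕ) : Measurable (arrivalMark J A n) :=
  (hA n).prodMk ((measurable_uncurry_of_right_continuous m hJ hr).comp
    ((hA n).ennreal_toNNReal.prodMk measurable_id))

/-- The mark evaluates the path at a random time, but is still a measurable function of path and
arrival times. This passes the independence of the durations on to the marks. -/
lemma measurable_arrivalMark_arrivalSigma
    (hr : ∀ ω t, ContinuousWithinAt (fun s => J s ω) (Set.Ici t) t) (n : ℕ) :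
    Measurable[arrivalSigma J A] (arrivalMark J A n) := by
  have hc : Measurable[arrivalSigma J A] fun ω => ((fun t => J t ω), (fun n => A n ω)) :=
    comap_measurable _
  refine measurable_arrivalMark _ (fun t => ?_) hr (fun n => ?_) n
  · exact (measurable_pi_apply t).comp (measurable_fst.comp hc)
  · exact (measurable_pi_apply n).comp (measurable_snd.comp hc)

end Marks

/-! ### Presence of jobs and its conditional probability -/

section Jobs

variable {d : ℕ} {Q : Matrix (Fin d) (Fin d) ℝ} {ϖ lam mu : Fin d → ℝ}
  {Ω : Type*} [MeasurableSpace Ω] {P : Measure Ω} [IsProbabilityMeasure P]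
  {J : ℝ≥0 → Ω → Fin d} {A : ℕ → Ω → ℝ≥0∞} {S : ℕ → Ω → ℝ}

/-- The normalised duration of a job. -/
def normDuration (mu : Fin d → ℝ) (J : ℝ≥0 → Ω → Fin d) (A : ℕ → Ω → ℝ≥0∞) (S : ℕ → Ω → ℝ)
    (n : ℕ) (ω : Ω) : ℝ := mu (J (A n ω).toNNReal ω) * S n ω

/-- The normalised duration that a job needs in order to be present at time `t`. -/
noncomputable def threshold (mu : Fin d → ℝ) (t : ℝ≥0) (z : ℝ≥0∞ × Fin d) : ℝ :=
  mu z.2 * ((t - z.1.toNNReal : ℝ≥0) : ℝ)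

/-- The probability that a job which arrives at time `s` in state `i` is present at time `t`. -/
noncomputable def survival (mu : Fin d → ℝ) (t s : ℝ≥0) (i : Fin d) : ℝ :=
  Real.exp (-(mu i * ((t - s : ℝ≥0) : ℝ)))

/-- The event that job `n` arrives before time `t` and, if it does, is present at time `T`. -/
def presentEvent (mu : Fin d → ℝ) (J : ℝ≥0 → Ω → Fin d) (A : ℕ → Ω → ℝ≥0∞) (S : ℕ → Ω → ℝ)
    (t T : ℝ≥0) (n : ℕ) : Set Ω :=
  {ω | A n ω ≤ t ∧ threshold mu T (arrivalMark J A n ω) < normDuration mu J A S n ω}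

/-- The conditional probability of `presentEvent` given the arrival times and the background
process. -/
noncomputable def presentProb (mu : Fin d → ℝ) (J : ℝ≥0 → Ω → Fin d) (A : ℕ → Ω → ℝ≥0∞)
    (t T : ℝ≥0) (n : ℕ) (ω : Ω) : ℝ≥0∞ :=
  {z : ℝ≥0∞ × Fin d | z.1 ≤ t}.indicator
    (fun z => ENNReal.ofReal (Real.exp (-threshold mu T z))) (arrivalMark J A n ω)

lemma measurable_threshold (mu : Fin d → ℝ) (t : ℝ≥0) : Measurable (threshold mu t) := by
  unfold threshold
  refine ((measurable_of_finite mu).comp measurable_snd).mul ?_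
  exact (measurable_const.sub (measurable_fst.ennreal_toNNReal)).coe_nnreal_real

lemma threshold_nonneg (hmu : ∀ i, 0 < mu i) (t : ℝ≥0) (z : ℝ≥0∞ × Fin d) :
    0 ≤ threshold mu t z := mul_nonneg (hmu _).le (NNReal.coe_nonneg _)

lemma mem_jobsPresent_iff (hmu : ∀ i, 0 < mu i) (t : ℝ≥0) (n : ℕ) (ω : Ω) :
    n ∈ jobsPresent A S t ω ↔ ω ∈ presentEvent mu J A S t t n := by
  simp only [jobsPresent, presentEvent, Set.mem_ofPred_eq]
  refine and_congr_right fun h => ?_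
  have h1 : (A n ω).toNNReal ≤ t := by simpa using ENNReal.toNNReal_mono ENNReal.coe_ne_top h
  simp only [threshold, normDuration, arrivalMark]
  -- The truncated subtraction in `threshold` is genuine here because the job has arrived by time
  -- `t`.
  rw [mul_lt_mul_iff_right₀ (hmu _), NNReal.coe_sub h1, sub_lt_iff_lt_add']
  rfl

lemma encard_jobsPresent (hmu : ∀ i, 0 < mu i) (t : ℝ≥0) (ω : Ω) :
    ((jobsPresent A S t ω).encard : ℝ≥0∞) =
      ∑' n, (presentEvent mu J A S t t n).indicator (1 : Ω → ℝ≥0∞) ω := by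
  rw [← ENNReal.tsum_set_one,
    tsum_subtype (jobsPresent A S t ω) (fun _ => (1 : ℝ≥0∞))]
  refine tsum_congr fun n => ?_
  by_cases h : n ∈ jobsPresent A S t ω
  · rw [Set.indicator_of_mem h, Set.indicator_of_mem ((mem_jobsPresent_iff hmu t n ω).1 h)]
    rfl
  · rw [Set.indicator_of_notMem h,
      Set.indicator_of_notMem fun h' => h ((mem_jobsPresent_iff hmu t n ω).2 h')]

lemma numJobs_eq_toReal (hmu : ∀ i, 0 < mu i) (t : ℝ≥0) (ω : Ω) :
    numJobs A S t ω =
      (∑' n, (presentEvent mu J A S t t n).indicator (1 : Ω → ℝ≥0∞) ω).toReal := by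
  rw [← encard_jobsPresent hmu, numJobs, Set.ncard]
  generalize (jobsPresent A S t ω).encard = x
  -- An infinite set gives `0` on both sides, by the conventions for `ncard` and `toReal`.
  cases x <;> simp

lemma jobsPresent_subset (t : ℝ≥0) (ω : Ω) : jobsPresent A S t ω ⊆ {n | A n ω ≤ t} :=
  fun _ hn => hn.1

lemma ofReal_numJobs (hmu : ∀ i, 0 < mu i) {t : ℝ≥0} {ω : Ω} (h : {n | A n ω ≤ t}.Finite) :
    ENNReal.ofReal (numJobs A S t ω) =
      ∑' n, (presentEvent mu J A S t t n).indicator (1 : Ω → ℝ≥0∞) ω := by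
  rw [numJobs_eq_toReal (J := J) hmu, ENNReal.ofReal_toReal]
  rw [← encard_jobsPresent hmu]
  have h2 : (jobsPresent A S t ω).encard ≠ ⊤ :=
    Set.encard_ne_top_iff.2 (h.subset (jobsPresent_subset t ω))
  simpa using h2

lemma numJobs_le (hpos : ∀ n ω, 0 < A n ω) {t : ℝ≥0} {ω : Ω} (h : {n | A n ω ≤ t}.Finite) :
    numJobs A S t ω ≤ natArrivals A 0 t ω := by
  rw [numJobs, natArrivals_zero_eq_card hpos h, ← Set.ncard_eq_toFinset_card _ h]
  exact_mod_cast Set.ncard_le_ncard (jobsPresent_subset t ω) h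

lemma IsModelII.measurable_arrivalMark (hM : IsModelII Q ϖ lam mu P J A S) (n : ℕ) :
    Measurable (arrivalMark J A n) :=
  ModulatedQueue.measurable_arrivalMark _ hM.background.measurable
    hM.background.right_continuous hM.measurable_arrival n

lemma IsModelII.measurable_normDuration (hM : IsModelII Q ϖ lam mu P J A S) (n : ℕ) :
    Measurable (normDuration mu J A S n) :=
  ((measurable_of_finite mu).comp (measurable_snd.comp (hM.measurable_arrivalMark n))).mul
    (hM.measurable_duration n)

lemma IsModelII.indepFun_marks (hM : IsModelII Q ϖ lam mu P J A S) :
    IndepFun (fun ω n => normDuration mu J A S n ω) (fun ω n => arrivalMark J A n ω) P := by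
  have h := hM.duration_indep
  rw [IndepFun_iff_Indep] at h ⊢
  refine indep_of_indep_of_le_right h ?_
  exact (@measurable_pi_lambda Ω _ _ (arrivalSigma J A) _ (fun ω n => arrivalMark J A n ω)
    fun n => measurable_arrivalMark_arrivalSigma hM.background.right_continuous n).comap_le

lemma IsModelII.measurableSet_presentEvent (hM : IsModelII Q ϖ lam mu P J A S) (t T : ℝ≥0)
    (n : ℕ) : MeasurableSet (presentEvent mu J A S t T n) :=
  (measurableSet_le (hM.measurable_arrival n) measurable_const).inter
    (measurableSet_lt ((measurable_threshold mu T).comp (hM.measurable_arrivalMark n))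
      (hM.measurable_normDuration n))

lemma measurableSet_fst_le (t : ℝ≥0) : MeasurableSet {z : ℝ≥0∞ × Fin d | z.1 ≤ t} :=
  measurableSet_le measurable_fst measurable_const

lemma IsModelII.measurable_presentProb (hM : IsModelII Q ϖ lam mu P J A S) (t T : ℝ≥0)
    (n : ℕ) : Measurable (presentProb mu J A t T n) :=
  ((measurable_threshold mu T).neg.exp.ennreal_ofReal.indicator (measurableSet_fst_le t)).comp
    (hM.measurable_arrivalMark n)

lemma IsModelII.measure_presentEvent (hM : IsModelII Q ϖ lam mu P J A S) (hmu : ∀ i, 0 < mu i)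
    (t T : ℝ≥0) (n : ℕ) :
    P (presentEvent mu J A S t T n) = ∫⁻ ω, presentProb mu J A t T n ω ∂P :=
  measure_lt_exp (hM.measurable_arrivalMark n) (hM.duration_exp n)
    (hM.indepFun_marks.comp (measurable_pi_apply n) (measurable_pi_apply n))
    (measurableSet_fst_le t) (measurable_threshold mu T) (threshold_nonneg hmu T)

lemma IsModelII.measure_presentEvent_inter (hM : IsModelII Q ϖ lam mu P J A S)
    (hmu : ∀ i, 0 < mu i) (t T : ℝ≥0) {n m : ℕ} (hnm : n ≠ m) :
    P (presentEvent mu J A S t t n ∩ presentEvent mu J A S T T m) =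
      ∫⁻ ω, presentProb mu J A t t n ω * presentProb mu J A T T m ω ∂P := by
  have h := measure_lt_exp_and_lt_exp (P := P)
    (Z := fun ω => (arrivalMark J A n ω, arrivalMark J A m ω))
    (B := {z : ℝ≥0∞ × Fin d | z.1 ≤ t} ×ˢ {z : ℝ≥0∞ × Fin d | z.1 ≤ T})
    (f := fun z => threshold mu t z.1) (g := fun z => threshold mu T z.2)
    ((hM.measurable_arrivalMark n).prodMk (hM.measurable_arrivalMark m))
    (hM.duration_exp n) (hM.duration_exp m) (hM.duration_iIndep.indepFun hnm)
    (hM.indepFun_marks.comp (φ := fun x => (x n, x m)) (ψ := fun x => (x n, x m))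
      ((measurable_pi_apply n).prodMk (measurable_pi_apply m))
      ((measurable_pi_apply n).prodMk (measurable_pi_apply m)))
    ((measurableSet_fst_le t).prod (measurableSet_fst_le T))
    ((measurable_threshold mu t).comp measurable_fst) (fun z => threshold_nonneg hmu t z.1)
    ((measurable_threshold mu T).comp measurable_snd) (fun z => threshold_nonneg hmu T z.2)
  convert h using 1
  · congr 1
    ext ω
    simp only [presentEvent, Set.mem_inter_iff, Set.mem_ofPred_eq, Set.mem_prod, arrivalMark,
      normDuration]
    tauto
  · refine lintegral_congr fun ω => ?_
    simp only [presentProb, Set.indicator_apply, Set.mem_prod]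
    split_ifs <;> simp_all

/-- The required duration increases with the observation time, so survival to `T` implies survival
to `t`. -/
lemma presentEvent_inter_self (hmu : ∀ i, 0 < mu i) {t T : ℝ≥0} (htT : t ≤ T) (n : ℕ) :
    presentEvent mu J A S t t n ∩ presentEvent mu J A S T T n = presentEvent mu J A S t T n := by
  ext ω
  simp only [presentEvent, Set.mem_inter_iff, Set.mem_ofPred_eq]
  constructor
  · rintro ⟨⟨h1, _⟩, _, h4⟩
    exact ⟨h1, h4⟩
  · rintro ⟨h1, h2⟩
    refine ⟨⟨h1, lt_of_le_of_lt ?_ h2⟩, h1.trans (by exact_mod_cast htT), h2⟩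
    exact mul_le_mul_of_nonneg_left (NNReal.coe_le_coe.2 (tsub_le_tsub_right htT _)) (hmu _).le

lemma IsModelII.lintegral_present (hM : IsModelII Q ϖ lam mu P J A S)
    (hmu : ∀ i, 0 < mu i) (t : ℝ≥0) :
    ∫⁻ ω, ∑' n, (presentEvent mu J A S t t n).indicator (1 : Ω → ℝ≥0∞) ω ∂P =
      ∫⁻ ω, ∑' n, presentProb mu J A t t n ω ∂P := by
  rw [lintegral_tsum fun n =>
      (measurable_one.indicator (hM.measurableSet_presentEvent t t n)).aemeasurable,
    lintegral_tsum fun n => (hM.measurable_presentProb t t n).aemeasurable]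
  refine tsum_congr fun n => ?_
  rw [lintegral_indicator_one (hM.measurableSet_presentEvent t t n),
    hM.measure_presentEvent hmu]

/-- Expand both products into double sums over jobs. Off the diagonal, conditional independence
makes the terms agree. The two diagonals differ, and each is added to the opposite side so that no
subtraction in `ℝ≥0∞` occurs. -/
lemma IsModelII.lintegral_present_mul (hM : IsModelII Q ϖ lam mu P J A S)
    (hmu : ∀ i, 0 < mu i) {t T : ℝ≥0} (htT : t ≤ T) :
    ∫⁻ ω, (∑' n, (presentEvent mu J A S t t n).indicator (1 : Ω → ℝ≥0∞) ω) *
        (∑' n, (presentEvent mu J A S T T n).indicator (1 : Ω → ℝ≥0∞) ω) ∂P +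
      ∫⁻ ω, ∑' n, presentProb mu J A t t n ω * presentProb mu J A T T n ω ∂P =
    ∫⁻ ω, (∑' n, presentProb mu J A t t n ω) * (∑' n, presentProb mu J A T T n ω) ∂P +
      ∫⁻ ω, ∑' n, presentProb mu J A t T n ω ∂P := by
  have hE : ∀ n, Measurable ((presentEvent mu J A S t t n).indicator (1 : Ω → ℝ≥0∞)) :=
    fun n => measurable_one.indicator (hM.measurableSet_presentEvent t t n)
  have hE' : ∀ n, Measurable ((presentEvent mu J A S T T n).indicator (1 : Ω → ℝ≥0∞)) :=
    fun n => measurable_one.indicator (hM.measurableSet_presentEvent T T n)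
  have hG := hM.measurable_presentProb t t
  have hG' := hM.measurable_presentProb T T
  have hdouble : ∀ {f g : ℕ → Ω → ℝ≥0∞}, (∀ n, Measurable (f n)) → (∀ n, Measurable (g n)) →
      ∫⁻ ω, (∑' n, f n ω) * (∑' n, g n ω) ∂P = ∑' n, ∑' m, ∫⁻ ω, f n ω * g m ω ∂P := by
    intro f g hf hg
    simp_rw [← ENNReal.tsum_mul_right, ← ENNReal.tsum_mul_left]
    rw [lintegral_tsum (f := fun n ω => ∑' m, f n ω * g m ω)
      fun n => (Measurable.tsum fun m => (hf n).mul (hg m)).aemeasurable]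
    exact tsum_congr fun n => lintegral_tsum fun m => ((hf n).mul (hg m)).aemeasurable
  rw [hdouble hE hE', hdouble hG hG',
    lintegral_tsum (f := fun n ω => presentProb mu J A t t n ω * presentProb mu J A T T n ω)
      fun n => ((hG n).mul (hG' n)).aemeasurable,
    lintegral_tsum fun n => (hM.measurable_presentProb t T n).aemeasurable,
    ← ENNReal.tsum_add, ← ENNReal.tsum_add]
  refine tsum_congr fun n => ?_
  -- Isolates the diagonal term `m = n`.
  have hsplit : ∀ f : ℕ → ℝ≥0∞, ∑' m, f m = f n + ∑' m, if m = n then 0 else f m := by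
    intro f
    rw [ENNReal.tsum_eq_add_tsum_ite n]
    congr!
  rw [hsplit, hsplit fun m =>
    ∫⁻ ω, presentProb mu J A t t n ω * presentProb mu J A T T m ω ∂P]
  have hEE : ∀ m, ∫⁻ ω, (presentEvent mu J A S t t n).indicator (1 : Ω → ℝ≥0∞) ω *
      (presentEvent mu J A S T T m).indicator (1 : Ω → ℝ≥0∞) ω ∂P =
      P (presentEvent mu J A S t t n ∩ presentEvent mu J A S T T m) := by
    intro m
    rw [← lintegral_indicator_one ((hM.measurableSet_presentEvent t t n).inter
      (hM.measurableSet_presentEvent T T m)), Set.inter_indicator_one]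
    rfl
  have hoff : ∀ m, (if m = n then (0 : ℝ≥0∞) else
      ∫⁻ ω, (presentEvent mu J A S t t n).indicator (1 : Ω → ℝ≥0∞) ω *
      (presentEvent mu J A S T T m).indicator (1 : Ω → ℝ≥0∞) ω ∂P) = if m = n then 0 else
      ∫⁻ ω, presentProb mu J A t t n ω * presentProb mu J A T T m ω ∂P := by
    intro m
    split_ifs with h
    · rfl
    · rw [hEE, hM.measure_presentEvent_inter hmu t T (Ne.symm h)]
  rw [tsum_congr hoff, hEE, presentEvent_inter_self hmu htT, hM.measure_presentEvent hmu]
  ring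

end Jobs

/-! ### Moments of the number of jobs as moments of rate integrals -/

section JobMoments

variable {d : ℕ} {Q : Matrix (Fin d) (Fin d) ℝ} {ϖ lam mu : Fin d → ℝ}
  {Ω : Type*} [MeasurableSpace Ω] {P : Measure Ω} [IsProbabilityMeasure P]
  {J : ℝ≥0 → Ω → Fin d} {A : ℕ → Ω → ℝ≥0∞} {S : ℕ → Ω → ℝ}

lemma survival_nonneg (mu : Fin d → ℝ) (t s : ℝ≥0) (i : Fin d) : 0 ≤ survival mu t s i :=
  (Real.exp_pos _).le

lemma abs_survival_le (hmu : ∀ i, 0 < mu i) (t s : ℝ≥0) (i : Fin d) :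
    |survival mu t s i| ≤ 1 := by
  rw [abs_of_nonneg (survival_nonneg mu t s i), survival, Real.exp_le_one_iff, neg_nonpos]
  exact mul_nonneg (hmu i).le (NNReal.coe_nonneg _)

lemma continuous_survival (mu : Fin d → ℝ) (t : ℝ≥0) (i : Fin d) :
    Continuous fun s => survival mu t s i := by
  unfold survival
  have : Continuous fun s : ℝ≥0 => t - s := by fun_prop
  fun_prop

lemma ofReal_arrivalSum {F : ℝ≥0 → Ω → ℝ} {R : ℝ≥0} {ω : Ω} (hF : ∀ s, 0 ≤ F s ω)
    (h : {n | A n ω ≤ R}.Finite) :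
    ENNReal.ofReal (arrivalSum A F R ω) =
      ∑' n, ENNReal.ofReal (if A n ω ≤ R then F (A n ω).toNNReal ω else 0) := by
  refine ENNReal.ofReal_tsum_of_nonneg (fun n => ?_) ?_
  · split_ifs
    · exact hF _
    · exact le_rfl
  · refine summable_of_hasFiniteSupport (h.subset fun n hn => ?_)
    by_contra h'
    exact hn (if_neg h')

/-- Conditional probabilities of presence become the terms of an `arrivalSum`, the form to which
Campbell's formulas apply. A common horizon `R` allows different cut-offs `t` to be combined. -/
lemma presentProb_eq {t R : ℝ≥0} (htR : t ≤ R) (T : ℝ≥0) (n : ℕ) (ω : Ω) :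
    presentProb mu J A t T n ω =
      ENNReal.ofReal (if A n ω ≤ R then cutFun J (survival mu T) t (A n ω).toNNReal ω else 0) := by
  by_cases h : A n ω ≤ t
  · have h1 : (A n ω).toNNReal ≤ t := by simpa using ENNReal.toNNReal_mono ENNReal.coe_ne_top h
    have h2 : A n ω ≤ R := h.trans (by exact_mod_cast htR)
    rw [presentProb, Set.indicator_of_mem (show arrivalMark J A n ω ∈ _ from h), if_pos h2,
      cutFun, if_pos h1]
    rfl
  · rw [presentProb, Set.indicator_of_notMem (show arrivalMark J A n ω ∉ _ from h)]
    split_ifs with h2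
    · rw [cutFun, if_neg, ENNReal.ofReal_zero]
      intro h3
      refine h ?_
      rw [← ENNReal.coe_toNNReal (ne_top_of_le_ne_top ENNReal.coe_ne_top h2)]
      exact_mod_cast h3
    · simp

lemma cutFun_nonneg {φ : ℝ≥0 → Fin d → ℝ} (hφ : ∀ s i, 0 ≤ φ s i) (t s : ℝ≥0) (ω : Ω) :
    0 ≤ cutFun J φ t s ω := by
  unfold cutFun
  split_ifs
  · exact hφ _ _
  · exact le_rfl

lemma abs_cutFun_le {φ : ℝ≥0 → Fin d → ℝ} (hφ : ∀ s i, |φ s i| ≤ 1) (t s : ℝ≥0) (ω : Ω) :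
    |cutFun J φ t s ω| ≤ 1 := by
  unfold cutFun
  split_ifs
  · exact hφ _ _
  · simp

lemma arrivalSum_nonneg {F : ℝ≥0 → Ω → ℝ} {R : ℝ≥0} {ω : Ω} (hF : ∀ s, 0 ≤ F s ω) :
    0 ≤ arrivalSum A F R ω := by
  refine tsum_nonneg fun n => ?_
  split_ifs
  · exact hF _
  · exact le_rfl

lemma IsModelII.memLp_arrivalSum (hM : IsModelII Q ϖ lam mu P J A S)
    (hlam : ∀ i, 0 ≤ lam i) {φ : ℝ≥0 → Fin d → ℝ} (hφ : ∀ s i, |φ s i| ≤ 1)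
    (hφc : ∀ i, Continuous fun s => φ s i) {t R : ℝ≥0} (ht : t ≤ R) :
    MemLp (arrivalSum A (cutFun J φ t) R) 2 P := by
  refine (hM.memLp_natArrivals hlam R).mono ?_ ?_
  · refine aestronglyMeasurable_of_tendsto_ae atTop
      (fun k => hM.aestronglyMeasurable_arrivalSum_gridFun hlam φ ht k) ?_
    filter_upwards [hM.ae_finite hlam] with ω hω
    exact tendsto_arrivalSum hM.arrival_pos
      (fun s hs => tendsto_gridFun hφc hM.background.right_continuous t hs ω) (hω R)
  · filter_upwards [hM.ae_finite hlam] with ω hω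
    rw [Real.norm_natCast]
    exact abs_arrivalSum_le hM.arrival_pos (fun s _ => abs_cutFun_le hφ t s ω) (hω R)

lemma IsModelII.memLp_numJobs (hM : IsModelII Q ϖ lam mu P J A S)
    (hlam : ∀ i, 0 ≤ lam i) (hmu : ∀ i, 0 < mu i) (t : ℝ≥0) : MemLp (numJobs A S t) 2 P := by
  refine (hM.memLp_natArrivals hlam t).mono ?_ ?_
  · have : numJobs A S t = fun ω =>
        (∑' n, (presentEvent mu J A S t t n).indicator (1 : Ω → ℝ≥0∞) ω).toReal :=
      funext fun ω => numJobs_eq_toReal hmu t ω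
    rw [this]
    exact (Measurable.tsum fun n => measurable_one.indicator
      (hM.measurableSet_presentEvent t t n)).ennreal_toReal.aestronglyMeasurable
  · filter_upwards [hM.ae_finite hlam] with ω hω
    rw [Real.norm_natCast, Real.norm_of_nonneg (show 0 ≤ numJobs A S t ω from Nat.cast_nonneg _)]
    exact numJobs_le hM.arrival_pos (hω t)

lemma cutFun_mul_cutFun {φ ψ : ℝ≥0 → Fin d → ℝ} {t T : ℝ≥0} (htT : t ≤ T) :
    (fun s ω => cutFun J φ t s ω * cutFun J ψ T s ω) =
      cutFun J (fun s i => φ s i * ψ s i) t := by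
  ext s ω
  unfold cutFun
  split_ifs with h1 h2
  · rfl
  · exact absurd (h1.trans htT) h2
  · simp
  · simp

lemma IsModelII.integral_numJobs (hM : IsModelII Q ϖ lam mu P J A S)
    (hlam : ∀ i, 0 ≤ lam i) (hmu : ∀ i, 0 < mu i) {t R : ℝ≥0} (ht : t ≤ R) :
    ∫ ω, numJobs A S t ω ∂P = ∫ ω, rateIntegral lam J (cutFun J (survival mu t) t) R ω ∂P := by
  rw [← hM.integral_arrivalSum hlam (abs_survival_le hmu t) (continuous_survival mu t) ht]
  have i1 := (hM.memLp_numJobs hlam hmu t).integrable (by norm_num)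
  have i2 := (hM.memLp_arrivalSum hlam (abs_survival_le hmu t)
    (continuous_survival mu t) ht).integrable (by norm_num)
  have n1 : ∀ ω, 0 ≤ numJobs A S t ω := fun ω => Nat.cast_nonneg _
  have n2 : ∀ ω, 0 ≤ arrivalSum A (cutFun J (survival mu t) t) R ω := fun ω =>
    arrivalSum_nonneg fun s => cutFun_nonneg (survival_nonneg mu t) t s ω
  rw [← ENNReal.ofReal_eq_ofReal_iff (integral_nonneg n1) (integral_nonneg n2),
    ofReal_integral_eq_lintegral_ofReal i1 (ae_of_all _ n1),
    ofReal_integral_eq_lintegral_ofReal i2 (ae_of_all _ n2)]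
  refine Eq.trans ?_ ((hM.lintegral_present hmu t).trans ?_)
  · refine lintegral_congr_ae ?_
    filter_upwards [hM.ae_finite hlam] with ω hω
    exact ofReal_numJobs hmu (hω t)
  · refine lintegral_congr_ae ?_
    filter_upwards [hM.ae_finite hlam] with ω hω
    rw [ofReal_arrivalSum (fun s => cutFun_nonneg (survival_nonneg mu t) t s ω) (hω R)]
    exact tsum_congr fun n => presentProb_eq ht t n ω

lemma IsModelII.measurable_uncurry_cutFun (hM : IsModelII Q ϖ lam mu P J A S)
    {φ : ℝ≥0 → Fin d → ℝ} (hφc : ∀ i, Continuous fun s => φ s i) (t : ℝ≥0) :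
    Measurable fun p : ℝ≥0 × Ω => cutFun J φ t p.1 p.2 := by
  unfold cutFun
  have h1 : Measurable fun q : ℝ≥0 × Fin d => φ q.1 q.2 :=
    measurable_from_prod_countable_left fun i => (hφc i).measurable
  refine Measurable.ite (measurable_fst measurableSet_Iic) (h1.comp (measurable_fst.prodMk
    (measurable_uncurry_of_right_continuous _ hM.background.measurable
      hM.background.right_continuous))) measurable_const

lemma IsModelII.memLp_rateIntegral (hM : IsModelII Q ϖ lam mu P J A S)
    (hlam : ∀ i, 0 ≤ lam i) {φ : ℝ≥0 → Fin d → ℝ} (hφ : ∀ s i, |φ s i| ≤ 1)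
    (hφc : ∀ i, Continuous fun s => φ s i) (t R : ℝ≥0) :
    MemLp (rateIntegral lam J (cutFun J φ t) R) 2 P :=
  MemLp.of_bound (hM.measurable_rateIntegral
    (hM.measurable_uncurry_cutFun hφc t) R).aestronglyMeasurable (R * ∑ i, lam i)
    (ae_of_all _ fun ω => abs_rateIntegral_le hlam fun s _ => abs_cutFun_le hφ t s ω)

/-- The integral of `φ ψ λ` in the second Campbell formula equals the mean of the diagonal added in
`IsModelII.lintegral_present_mul`, so these terms cancel. -/
lemma IsModelII.integral_numJobs_mul (hM : IsModelII Q ϖ lam mu P J A S)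
    (hlam : ∀ i, 0 ≤ lam i) (hmu : ∀ i, 0 < mu i) {t T : ℝ≥0} (htT : t ≤ T) :
    ∫ ω, numJobs A S t ω * numJobs A S T ω ∂P =
      ∫ ω, rateIntegral lam J (cutFun J (survival mu t) t) T ω *
        rateIntegral lam J (cutFun J (survival mu T) T) T ω ∂P +
      ∫ ω, rateIntegral lam J (cutFun J (survival mu T) t) T ω ∂P := by
  have b1 := abs_survival_le hmu
  have c1 := continuous_survival mu
  have b2 : ∀ s i, |survival mu t s i * survival mu T s i| ≤ 1 := fun s i => by
    rw [abs_mul]; exact mul_le_one₀ (b1 t s i) (abs_nonneg _) (b1 T s i)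
  have c2 : ∀ i, Continuous fun s => survival mu t s i * survival mu T s i := fun i =>
    (c1 t i).mul (c1 T i)
  have s0 := survival_nonneg mu
  have s2 : ∀ s i, 0 ≤ survival mu t s i * survival mu T s i := fun s i =>
    mul_nonneg (s0 t s i) (s0 T s i)
  have e1 := hM.integral_arrivalSum hlam (b1 T) (c1 T) htT
  have e2 := hM.integral_arrivalSum hlam b2 c2 htT
  have e3 := hM.integral_arrivalSum_mul hlam (b1 t) (c1 t) (b1 T) (c1 T) htT le_rfl
  have ea := integral_add ((hM.memLp_rateIntegral hlam (b1 t) (c1 t) t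
    T).integrable_mul (hM.memLp_rateIntegral hlam (b1 T) (c1 T) T T))
    ((hM.memLp_rateIntegral hlam b2 c2 t T).integrable (by norm_num))
  simp only [Pi.mul_apply] at ea
  rw [cutFun_mul_cutFun htT, ea, ← e2] at e3
  rw [← e1]
  have i0 : Integrable (fun ω => numJobs A S t ω * numJobs A S T ω) P :=
    (hM.memLp_numJobs hlam hmu t).integrable_mul (hM.memLp_numJobs hlam hmu T)
  have i1 := (hM.memLp_arrivalSum hlam (b1 T) (c1 T) htT).integrable (by norm_num)
  have i2 := (hM.memLp_arrivalSum hlam b2 c2 htT).integrable (by norm_num)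
  have i3 : Integrable (fun ω => arrivalSum A (cutFun J (survival mu t) t) T ω *
      arrivalSum A (cutFun J (survival mu T) T) T ω) P :=
    (hM.memLp_arrivalSum hlam (b1 t) (c1 t) htT).integrable_mul
    (hM.memLp_arrivalSum hlam (b1 T) (c1 T) (le_refl T))
  have n0 : ∀ ω, 0 ≤ numJobs A S t ω * numJobs A S T ω := fun ω =>
    mul_nonneg (Nat.cast_nonneg _) (Nat.cast_nonneg _)
  have n1 : ∀ ω, 0 ≤ arrivalSum A (cutFun J (survival mu T) t) T ω := fun ω =>
    arrivalSum_nonneg fun s => cutFun_nonneg (s0 T) t s ω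
  have n2 : ∀ ω, 0 ≤ arrivalSum A
      (cutFun J (fun s i => survival mu t s i * survival mu T s i) t) T ω := fun ω =>
    arrivalSum_nonneg fun s => cutFun_nonneg s2 t s ω
  have n3 : ∀ ω, 0 ≤ arrivalSum A (cutFun J (survival mu t) t) T ω *
      arrivalSum A (cutFun J (survival mu T) T) T ω := fun ω =>
    mul_nonneg (arrivalSum_nonneg fun s => cutFun_nonneg (s0 t) t s ω)
      (arrivalSum_nonneg fun s => cutFun_nonneg (s0 T) T s ω)
  -- The identity in `ℝ≥0∞` is transferred to real integrals; the four terms correspond one by one.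
  have key : ∫ ω, numJobs A S t ω * numJobs A S T ω ∂P +
      ∫ ω, arrivalSum A (cutFun J (fun s i => survival mu t s i * survival mu T s i) t) T ω ∂P =
      ∫ ω, arrivalSum A (cutFun J (survival mu t) t) T ω *
        arrivalSum A (cutFun J (survival mu T) T) T ω ∂P +
      ∫ ω, arrivalSum A (cutFun J (survival mu T) t) T ω ∂P := by
    rw [← ENNReal.ofReal_eq_ofReal_iff (add_nonneg (integral_nonneg n0) (integral_nonneg n2))
      (add_nonneg (integral_nonneg n3) (integral_nonneg n1)),
      ENNReal.ofReal_add (integral_nonneg n0) (integral_nonneg n2),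
      ENNReal.ofReal_add (integral_nonneg n3) (integral_nonneg n1),
      ofReal_integral_eq_lintegral_ofReal i0 (ae_of_all _ n0),
      ofReal_integral_eq_lintegral_ofReal i1 (ae_of_all _ n1),
      ofReal_integral_eq_lintegral_ofReal i2 (ae_of_all _ n2),
      ofReal_integral_eq_lintegral_ofReal i3 (ae_of_all _ n3)]
    refine Eq.trans (congrArg₂ (· + ·) ?_ ?_) ((hM.lintegral_present_mul hmu htT).trans
      (congrArg₂ (· + ·) ?_ ?_))
    · refine lintegral_congr_ae ?_
      filter_upwards [hM.ae_finite hlam] with ω hω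
      rw [ENNReal.ofReal_mul (show 0 ≤ numJobs A S t ω from Nat.cast_nonneg _),
        ofReal_numJobs (J := J) hmu (hω t),
        ofReal_numJobs (J := J) hmu (hω T)]
    · refine lintegral_congr_ae ?_
      filter_upwards [hM.ae_finite hlam] with ω hω
      rw [ofReal_arrivalSum (fun s => cutFun_nonneg s2 t s ω) (hω T)]
      refine tsum_congr fun n => ?_
      rw [presentProb_eq htT t n ω, presentProb_eq le_rfl T n ω, ← ENNReal.ofReal_mul,
        ← cutFun_mul_cutFun htT]
      · congr 1
        split_ifs <;> simp
      · split_ifs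
        · exact cutFun_nonneg (s0 t) _ _ _
        · exact le_rfl
    · refine lintegral_congr_ae ?_
      filter_upwards [hM.ae_finite hlam] with ω hω
      rw [ENNReal.ofReal_mul (arrivalSum_nonneg fun s => cutFun_nonneg (s0 t) t s ω),
        ofReal_arrivalSum (fun s => cutFun_nonneg (s0 t) t s ω) (hω T),
        ofReal_arrivalSum (fun s => cutFun_nonneg (s0 T) T s ω) (hω T)]
      exact congrArg₂ (· * ·) (tsum_congr fun n => presentProb_eq htT t n ω)
        (tsum_congr fun n => presentProb_eq le_rfl T n ω)
    · refine lintegral_congr_ae ?_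
      filter_upwards [hM.ae_finite hlam] with ω hω
      rw [ofReal_arrivalSum (fun s => cutFun_nonneg (s0 T) t s ω) (hω T)]
      exact tsum_congr fun n => presentProb_eq htT T n ω
  linarith

end JobMoments

/-! ### Averaging over the stationary chain -/

section Expectations

variable {d : ℕ} {Q : Matrix (Fin d) (Fin d) ℝ} {ϖ lam mu : Fin d → ℝ}
  {Ω : Type*} [MeasurableSpace Ω] {P : Measure Ω} [IsProbabilityMeasure P]
  {J : ℝ≥0 → Ω → Fin d} {A : ℕ → Ω → ℝ≥0∞} {S : ℕ → Ω → ℝ}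

/-- The covariance of the indicators of `J r = i` and `J s = j`. -/
noncomputable def covKernel (Q : Matrix (Fin d) (Fin d) ℝ) (ϖ : Fin d → ℝ) (i j : Fin d)
    (s r : ℝ) : ℝ :=
  ϖ i * transProb Q i j (max (s - r) 0) + ϖ j * transProb Q j i (max (r - s) 0) -
    (if i = j then ϖ i else 0) - ϖ i * ϖ j

/-- On either side of the diagonal, one transition probability is taken at time `0` and cancels the
Kronecker term. The truncated formula combines both sides in one jointly continuous function, which
settles the integrability questions below. -/
lemma covKernel_of_le {s r : ℝ} (h : r ≤ s) (i j : Fin d) :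
    covKernel Q ϖ i j s r = ϖ i * (transProb Q i j (s - r) - ϖ j) := by
  rw [covKernel, max_eq_left (by linarith), max_eq_right (by linarith), transProb_zero]
  rcases eq_or_ne i j with rfl | hij
  · simp; ring
  · simp [hij, hij.symm]; ring

lemma covKernel_of_ge {s r : ℝ} (h : s ≤ r) (i j : Fin d) :
    covKernel Q ϖ i j s r = ϖ j * (transProb Q j i (r - s) - ϖ i) := by
  rw [covKernel, max_eq_right (by linarith), max_eq_left (by linarith), transProb_zero]
  rcases eq_or_ne i j with rfl | hij
  · simp; ring
  · simp [hij]; ring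

@[fun_prop]
lemma continuous_transProb_comp {X : Type*} [TopologicalSpace X] {f : X → ℝ} (hf : Continuous f)
    (Q : Matrix (Fin d) (Fin d) ℝ) (i j : Fin d) : Continuous fun x => transProb Q i j (f x) :=
  (continuous_transProb Q i j).comp hf

lemma continuous_covKernel (Q : Matrix (Fin d) (Fin d) ℝ) (ϖ : Fin d → ℝ) (i j : Fin d) :
    Continuous fun p : ℝ × ℝ => covKernel Q ϖ i j p.1 p.2 := by
  unfold covKernel
  fun_prop

lemma IsMarkovChain.prob_and_eq_covKernel (h : IsMarkovChain Q ϖ P J) (hϖ : IsInvariantProb Q ϖ)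
    {s r : ℝ} (hs : 0 ≤ s) (hr : 0 ≤ r) (i j : Fin d) :
    P.real {ω | J s.toNNReal ω = j ∧ J r.toNNReal ω = i} =
      covKernel Q ϖ i j s r + ϖ i * ϖ j := by
  lift s to ℝ≥0 using hs
  lift r to ℝ≥0 using hr
  simp only [Real.toNNReal_coe]
  rcases le_total r s with hrs | hrs
  · rw [covKernel_of_le (NNReal.coe_le_coe.2 hrs)]
    have := h.prob_and hϖ hrs i j
    simp only [and_comm (a := J r _ = i)] at this
    rw [this]
    ring
  · rw [covKernel_of_ge (NNReal.coe_le_coe.2 hrs), h.prob_and hϖ hrs j i]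
    ring

lemma integral_comp_state {X : Ω → Fin d} (hX : Measurable X) (f : Fin d → ℝ) :
    ∫ ω, f (X ω) ∂P = ∑ i, f i * P.real {ω | X ω = i} := by
  have : IsProbabilityMeasure (P.map X) := Measure.isProbabilityMeasure_map hX.aemeasurable
  rw [← integral_map (f := f) hX.aemeasurable (measurable_of_finite f).aestronglyMeasurable,
    integral_fintype (Integrable.of_finite)]
  refine Finset.sum_congr rfl fun i _ => ?_
  rw [map_measureReal_apply hX (measurableSet_singleton i), smul_eq_mul, mul_comm]
  rfl

lemma integral_comp_state_mul {X Y : Ω → Fin d} (hX : Measurable X) (hY : Measurable Y)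
    (f g : Fin d → ℝ) :
    ∫ ω, f (X ω) * g (Y ω) ∂P = ∑ i, ∑ j, f i * g j * P.real {ω | X ω = i ∧ Y ω = j} := by
  have hXY := hX.prodMk hY
  have : IsProbabilityMeasure (P.map fun ω => (X ω, Y ω)) :=
    Measure.isProbabilityMeasure_map hXY.aemeasurable
  rw [← integral_map (f := fun p : Fin d × Fin d => f p.1 * g p.2) hXY.aemeasurable
    (measurable_of_finite _).aestronglyMeasurable,
    integral_fintype (Integrable.of_finite), Fintype.sum_prod_type]
  refine Finset.sum_congr rfl fun i _ => Finset.sum_congr rfl fun j _ => ?_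
  rw [map_measureReal_apply hXY (measurableSet_singleton _), smul_eq_mul, mul_comm]
  congr 2
  ext ω
  simp

lemma integral_intervalIntegral_swap {h : ℝ → Ω → ℝ}
    (hm : Measurable fun p : ℝ × Ω => h p.1 p.2) {C : ℝ} (hC : ∀ s ω, |h s ω| ≤ C) (a b : ℝ) :
    ∫ ω, (∫ s in a..b, h s ω) ∂P = ∫ s in a..b, ∫ ω, h s ω ∂P := by
  refine (intervalIntegral_integral_swap ?_).symm
  have : IsFiniteMeasure (volume.restrict (Set.uIoc a b)) := by
    unfold Set.uIoc; infer_instance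
  exact Integrable.of_bound hm.aestronglyMeasurable C (ae_of_all _ fun p => hC p.1 p.2)

/-- The contribution of the jobs that arrive at time `s` to the conditional mean number of jobs
at time `T`. -/
noncomputable def jobRate (lam mu : Fin d → ℝ) (T : ℝ≥0) (s : ℝ) (i : Fin d) : ℝ :=
  survival mu T s.toNNReal i * lam i

lemma rateIntegral_cutFun_survival {t R : ℝ≥0} (htR : t ≤ R) (T : ℝ≥0) (ω : Ω) :
    rateIntegral lam J (cutFun J (survival mu T) t) R ω =
      ∫ s in (0 : ℝ)..t, jobRate lam mu T s (J s.toNNReal ω) := by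
  rw [rateIntegral, ← integral_ite_toNNReal_le htR]
  simp only [cutFun, ite_mul, zero_mul, jobRate]

lemma abs_jobRate_le (hlam : ∀ i, 0 ≤ lam i) (hmu : ∀ i, 0 < mu i) (T : ℝ≥0) (s : ℝ)
    (i : Fin d) : |jobRate lam mu T s i| ≤ ∑ i, lam i := by
  rw [jobRate, abs_mul, abs_of_nonneg (hlam i)]
  calc _ ≤ 1 * lam i := mul_le_mul_of_nonneg_right (abs_survival_le hmu T _ i) (hlam i)
    _ ≤ _ := by rw [one_mul]; exact le_sum_rate hlam i

lemma jobRate_of_le {T : ℝ≥0} {s : ℝ} (hs : 0 ≤ s) (hsT : s ≤ T) (i : Fin d) :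
    jobRate lam mu T s i = Real.exp (-mu i * (T - s)) * lam i := by
  lift s to ℝ≥0 using hs
  rw [jobRate, survival, Real.toNNReal_coe, NNReal.coe_sub (by exact_mod_cast hsT), neg_mul]

lemma IsMarkovChain.measurable_jobRate (h : IsMarkovChain Q ϖ P J) (lam mu : Fin d → ℝ)
    (T : ℝ≥0) : Measurable fun p : ℝ × Ω => jobRate lam mu T p.1 (J p.1.toNNReal p.2) := by
  have h1 : Measurable fun q : ℝ × Fin d => jobRate lam mu T q.1 q.2 := by
    refine measurable_from_prod_countable_left fun i => ?_
    change Measurable fun s : ℝ => survival mu T s.toNNReal i * lam i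
    exact ((continuous_survival mu T i).measurable.comp measurable_real_toNNReal).mul_const _
  exact h1.comp (measurable_fst.prodMk
    ((measurable_uncurry_of_right_continuous _ h.measurable h.right_continuous).comp
    ((measurable_real_toNNReal.comp measurable_fst).prodMk measurable_snd)))

lemma IsMarkovChain.integral_jobRate (h : IsMarkovChain Q ϖ P J) (hϖ : IsInvariantProb Q ϖ)
    (hlam : ∀ i, 0 ≤ lam i) (hmu : ∀ i, 0 < mu i) {t T : ℝ≥0} (htT : t ≤ T) :
    ∫ ω, (∫ s in (0 : ℝ)..t, jobRate lam mu T s (J s.toNNReal ω)) ∂P =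
      ∫ s in (0 : ℝ)..t, ∑ i, Real.exp (-mu i * (T - s)) * lam i * ϖ i := by
  rw [integral_intervalIntegral_swap (h.measurable_jobRate lam mu T)
    fun s ω => abs_jobRate_le hlam hmu T s _]
  refine intervalIntegral.integral_congr fun s hs => ?_
  rw [Set.uIcc_of_le t.coe_nonneg] at hs
  rw [integral_comp_state (h.measurable _) (jobRate lam mu T s)]
  refine Finset.sum_congr rfl fun i _ => ?_
  rw [h.prob_eq hϖ, jobRate_of_le hs.1 (hs.2.trans htT)]

/-- Fubini is applied twice: first in `s`, with the whole `r`-integral as a bounded random factor,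
then in `r` for fixed `s`. The two-time law of the chain finishes. -/
lemma IsMarkovChain.integral_jobRate_mul (h : IsMarkovChain Q ϖ P J) (hϖ : IsInvariantProb Q ϖ)
    (hlam : ∀ i, 0 ≤ lam i) (hmu : ∀ i, 0 < mu i) (t T : ℝ≥0) :
    ∫ ω, (∫ s in (0 : ℝ)..t, jobRate lam mu t s (J s.toNNReal ω)) *
        (∫ r in (0 : ℝ)..T, jobRate lam mu T r (J r.toNNReal ω)) ∂P =
      ∫ s in (0 : ℝ)..t, ∫ r in (0 : ℝ)..T, ∑ j, ∑ i,
        (Real.exp (-mu j * (t - s)) * lam j) * (Real.exp (-mu i * (T - r)) * lam i) *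
          (covKernel Q ϖ i j s r + ϖ i * ϖ j) := by
  have hm := h.measurable_jobRate lam mu t
  have hm' := h.measurable_jobRate lam mu T
  have hb := abs_jobRate_le hlam hmu t
  have hb' := abs_jobRate_le hlam hmu T
  have hc0 : 0 ≤ ∑ i, lam i := Finset.sum_nonneg fun i _ => hlam i
  have hG : Measurable fun ω => ∫ r in (0 : ℝ)..T, jobRate lam mu T r (J r.toNNReal ω) := by
    simp only [intervalIntegral.integral_of_le T.coe_nonneg]
    exact ((hm'.comp measurable_swap).stronglyMeasurable.integral_prod_right'
      (ν := volume.restrict (Set.Ioc (0 : ℝ) T))).measurable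
  have hGb : ∀ ω, |∫ r in (0 : ℝ)..T, jobRate lam mu T r (J r.toNNReal ω)| ≤
      (∑ i, lam i) * |(T : ℝ) - 0| := fun ω => by
    rw [← Real.norm_eq_abs]
    exact intervalIntegral.norm_integral_le_of_norm_le_const fun r _ => hb' r _
  simp only [← intervalIntegral.integral_mul_const]
  rw [integral_intervalIntegral_swap (C := (∑ i, lam i) * ((∑ i, lam i) * |(T : ℝ) - 0|))
    (hm.mul (hG.comp measurable_snd)) fun s ω => by
      rw [abs_mul]; exact mul_le_mul (hb s _) (hGb ω) (abs_nonneg _) hc0]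
  refine intervalIntegral.integral_congr fun s hs => ?_
  rw [Set.uIcc_of_le t.coe_nonneg] at hs
  simp only [← intervalIntegral.integral_const_mul]
  rw [integral_intervalIntegral_swap (C := (∑ i, lam i) * ∑ i, lam i)
    (((hm.comp (measurable_const.prodMk measurable_snd) :
      Measurable fun p : ℝ × Ω => jobRate lam mu t s (J s.toNNReal p.2))).mul hm')
    fun r ω => by rw [abs_mul]; exact mul_le_mul (hb s _) (hb' r _) (abs_nonneg _) hc0]
  refine intervalIntegral.integral_congr fun r hr => ?_
  rw [Set.uIcc_of_le T.coe_nonneg] at hr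
  rw [integral_comp_state_mul (h.measurable _) (h.measurable _) (jobRate lam mu t s)
    (jobRate lam mu T r)]
  refine Finset.sum_congr rfl fun j _ => Finset.sum_congr rfl fun i _ => ?_
  rw [h.prob_and_eq_covKernel hϖ hs.1 hr.1, jobRate_of_le hs.1 hs.2, jobRate_of_le hr.1 hr.2]

end Expectations

/-! ### Assembling the covariance -/

section CovarianceFormula

variable {d : ℕ} {Q : Matrix (Fin d) (Fin d) ℝ} {ϖ lam mu : Fin d → ℝ}

lemma integral_exp_shift {a : ℝ} (ha : 0 < a) (t u : ℝ) :
    ∫ s in (0 : ℝ)..t, Real.exp (-a * (t + u - s)) =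
      1 / a * (1 - Real.exp (-a * t)) * Real.exp (-a * u) := by
  have h : ∀ s : ℝ, Real.exp (-a * (t + u - s)) = Real.exp (-a * (t + u)) * Real.exp (a * s) := by
    intro s; rw [← Real.exp_add]; ring_nf
  simp only [h]
  rw [intervalIntegral.integral_const_mul, intervalIntegral.integral_eq_sub_of_hasDerivAt
    (fun s _ => hasDerivAt_exp_const_mul_div ha.ne' s)
    (Continuous.intervalIntegrable (by fun_prop) _ _)]
  have e1 : Real.exp (-a * (t + u)) = Real.exp (-a * t) * Real.exp (-a * u) := by
    rw [← Real.exp_add]; ring_nf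
  have e2 : Real.exp (-a * t) * Real.exp (a * t) = 1 := by
    rw [← Real.exp_add, ← Real.exp_zero]; ring_nf
  rw [e1, mul_zero, Real.exp_zero]
  linear_combination (Real.exp (-a * u) / a) * e2

/-- For each `s` the `r`-interval is cut at `r = s`, which lies in `[0, t + u]` because `u ≥ 0`; the
two pieces are the integrands of `𝒦` and `ℒ`. -/
lemma integral_covKernel (Q : Matrix (Fin d) (Fin d) ℝ) (ϖ mu : Fin d → ℝ) (i j : Fin d)
    {t u : ℝ} (ht : 0 ≤ t) (hu : 0 ≤ u) :
    ∫ s in (0 : ℝ)..t, ∫ r in (0 : ℝ)..(t + u),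
      Real.exp (-mu i * (t + u - r)) * Real.exp (-mu j * (t - s)) * covKernel Q ϖ i j s r =
      kMatrix Q ϖ mu t u i j + lMatrix Q ϖ mu t u i j := by
  set F : ℝ → ℝ → ℝ := fun s r =>
    Real.exp (-mu i * (t + u - r)) * Real.exp (-mu j * (t - s)) * covKernel Q ϖ i j s r with hF
  have hγ := continuous_covKernel Q ϖ i j
  have hFc : Continuous (Function.uncurry F) := by
    unfold Function.uncurry
    simp only [hF]
    exact Continuous.mul (by fun_prop) hγ
  have hFs : ∀ s, Continuous (F s) := fun s => hFc.comp (by fun_prop : Continuous fun r => (s, r))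
  have hk : kMatrix Q ϖ mu t u i j = ∫ s in (0 : ℝ)..t, ∫ r in (0 : ℝ)..s, F s r := by
    rw [kMatrix, Matrix.of_apply]
    refine intervalIntegral.integral_congr fun s hs => ?_
    rw [Set.uIcc_of_le ht] at hs
    refine intervalIntegral.integral_congr fun r hr => ?_
    rw [Set.uIcc_of_le hs.1] at hr
    simp only [hF]
    rw [covKernel_of_le hr.2]
  have hl : lMatrix Q ϖ mu t u i j = ∫ s in (0 : ℝ)..t, ∫ r in s..(t + u), F s r := by
    rw [lMatrix, Matrix.of_apply]
    refine intervalIntegral.integral_congr fun s hs => ?_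
    rw [Set.uIcc_of_le ht] at hs
    refine intervalIntegral.integral_congr fun r hr => ?_
    rw [Set.uIcc_of_le (by linarith [hs.2])] at hr
    simp only [hF]
    rw [covKernel_of_ge hr.1]
  have hsplit : ∀ s, ∫ r in s..(t + u), F s r =
      (∫ r in (0 : ℝ)..(t + u), F s r) - ∫ r in (0 : ℝ)..s, F s r := fun s =>
    (intervalIntegral.integral_interval_sub_left ((hFs s).intervalIntegrable _ _)
      ((hFs s).intervalIntegrable _ _)).symm
  rw [hk, hl]
  simp only [hsplit]
  rw [intervalIntegral.integral_sub]
  · ring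
  · exact (intervalIntegral.continuous_parametric_intervalIntegral_of_continuous' hFc _ _
      ).intervalIntegrable _ _
  · exact (intervalIntegral.continuous_parametric_intervalIntegral_of_continuous hFc
      continuous_id).intervalIntegrable _ _

/-- The part `ϖ i * ϖ j` of the two-time law factors into the product of the two means, which the
covariance then subtracts. -/
lemma integral_sum_covKernel (Q : Matrix (Fin d) (Fin d) ℝ) (ϖ lam mu : Fin d → ℝ)
    {t u : ℝ} (ht : 0 ≤ t) (hu : 0 ≤ u) :
    ∫ s in (0 : ℝ)..t, ∫ r in (0 : ℝ)..(t + u), ∑ j, ∑ i,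
        (Real.exp (-mu j * (t - s)) * lam j) * (Real.exp (-mu i * (t + u - r)) * lam i) *
          (covKernel Q ϖ i j s r + ϖ i * ϖ j) =
      lam ⬝ᵥ (kMatrix Q ϖ mu t u).mulVec lam + lam ⬝ᵥ (lMatrix Q ϖ mu t u).mulVec lam +
        (∫ s in (0 : ℝ)..t, ∑ i, Real.exp (-mu i * (t - s)) * lam i * ϖ i) *
        ∫ r in (0 : ℝ)..(t + u), ∑ i, Real.exp (-mu i * (t + u - r)) * lam i * ϖ i := by
  have hγ := continuous_covKernel Q ϖ
  have hc : ∀ i j, Continuous (Function.uncurry fun s r : ℝ =>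
      Real.exp (-mu i * (t + u - r)) * Real.exp (-mu j * (t - s)) * covKernel Q ϖ i j s r) := by
    intro i j
    unfold Function.uncurry
    exact Continuous.mul (by fun_prop) (hγ i j)
  have hcs : ∀ i j s, Continuous fun r : ℝ =>
      Real.exp (-mu i * (t + u - r)) * Real.exp (-mu j * (t - s)) * covKernel Q ϖ i j s r :=
    fun i j s => (hc i j).comp (by fun_prop : Continuous fun r : ℝ => (s, r))
  have h1 : ∀ s r : ℝ, ∑ j, ∑ i,
        (Real.exp (-mu j * (t - s)) * lam j) * (Real.exp (-mu i * (t + u - r)) * lam i) *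
          (covKernel Q ϖ i j s r + ϖ i * ϖ j) =
      (∑ j, ∑ i, lam i * lam j *
        (Real.exp (-mu i * (t + u - r)) * Real.exp (-mu j * (t - s)) * covKernel Q ϖ i j s r)) +
      (∑ j, Real.exp (-mu j * (t - s)) * lam j * ϖ j) *
        ∑ i, Real.exp (-mu i * (t + u - r)) * lam i * ϖ i := by
    intro s r
    rw [Finset.sum_mul_sum, ← Finset.sum_add_distrib]
    refine Finset.sum_congr rfl fun j _ => ?_
    rw [← Finset.sum_add_distrib]
    exact Finset.sum_congr rfl fun i _ => by ring
  simp only [h1]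
  have h2 : ∀ s, ∫ r in (0 : ℝ)..(t + u), ((∑ j, ∑ i, lam i * lam j *
        (Real.exp (-mu i * (t + u - r)) * Real.exp (-mu j * (t - s)) * covKernel Q ϖ i j s r)) +
      (∑ j, Real.exp (-mu j * (t - s)) * lam j * ϖ j) *
        ∑ i, Real.exp (-mu i * (t + u - r)) * lam i * ϖ i) =
      (∑ j, ∑ i, lam i * lam j * ∫ r in (0 : ℝ)..(t + u),
        (Real.exp (-mu i * (t + u - r)) * Real.exp (-mu j * (t - s)) * covKernel Q ϖ i j s r)) +
      (∑ j, Real.exp (-mu j * (t - s)) * lam j * ϖ j) * ∫ r in (0 : ℝ)..(t + u),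
        ∑ i, Real.exp (-mu i * (t + u - r)) * lam i * ϖ i := by
    intro s
    rw [intervalIntegral.integral_add, intervalIntegral.integral_const_mul,
      intervalIntegral.integral_finsetSum]
    · congr 1
      refine Finset.sum_congr rfl fun j _ => ?_
      rw [intervalIntegral.integral_finsetSum]
      · exact Finset.sum_congr rfl fun i _ => intervalIntegral.integral_const_mul _ _
      · exact fun i _ => ((hcs i j s).const_mul _).intervalIntegrable _ _
    · exact fun j _ => (continuous_finsetSum _ fun i _ =>
        (hcs i j s).const_mul _).intervalIntegrable _ _
    · exact (continuous_finsetSum _ fun j _ => continuous_finsetSum _ fun i _ =>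
        (hcs i j s).const_mul _).intervalIntegrable _ _
    · exact Continuous.intervalIntegrable (by fun_prop) _ _
  simp only [h2]
  have hI : ∀ i j, Continuous fun s => ∫ r in (0 : ℝ)..(t + u),
      (Real.exp (-mu i * (t + u - r)) * Real.exp (-mu j * (t - s)) * covKernel Q ϖ i j s r) :=
    fun i j => intervalIntegral.continuous_parametric_intervalIntegral_of_continuous' (hc i j) _ _
  rw [intervalIntegral.integral_add, intervalIntegral.integral_mul_const,
    intervalIntegral.integral_finsetSum]
  · congr 1
    have h3 : ∀ j, ∫ s in (0 : ℝ)..t, (∑ i, lam i * lam j * ∫ r in (0 : ℝ)..(t + u),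
        (Real.exp (-mu i * (t + u - r)) * Real.exp (-mu j * (t - s)) * covKernel Q ϖ i j s r)) =
        ∑ i, lam i * lam j * (kMatrix Q ϖ mu t u i j + lMatrix Q ϖ mu t u i j) := by
      intro j
      rw [intervalIntegral.integral_finsetSum]
      · refine Finset.sum_congr rfl fun i _ => ?_
        rw [intervalIntegral.integral_const_mul, integral_covKernel Q ϖ mu i j ht hu]
      · exact fun i _ => ((hI i j).const_mul _).intervalIntegrable _ _
    simp only [h3]
    rw [Finset.sum_comm]
    simp only [dotProduct, Matrix.mulVec, Finset.mul_sum]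
    rw [← Finset.sum_add_distrib]
    refine Finset.sum_congr rfl fun i _ => ?_
    rw [← Finset.sum_add_distrib]
    exact Finset.sum_congr rfl fun j _ => by ring
  · exact fun j _ => (continuous_finsetSum _ fun i _ =>
      (hI i j).const_mul _).intervalIntegrable _ _
  · exact (continuous_finsetSum _ fun j _ => continuous_finsetSum _ fun i _ =>
      (hI i j).const_mul _).intervalIntegrable _ _
  · exact Continuous.intervalIntegrable (by fun_prop) _ _

variable {Ω : Type*} [MeasurableSpace Ω] {P : Measure Ω} [IsProbabilityMeasure P]
  {J : ℝ≥0 → Ω → Fin d} {A : ℕ → Ω → ℝ≥0∞} {S : ℕ → Ω → ℝ}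

/-- The covariance of the numbers of jobs at two times. -/
theorem IsModelII.covariance_numJobs (hM : IsModelII Q ϖ lam mu P J A S)
    (hϖ : IsInvariantProb Q ϖ) (hlam : ∀ i, 0 ≤ lam i) (hmu : ∀ i, 0 < mu i) (t u : ℝ≥0) :
    cov[numJobs A S t, numJobs A S (t + u); P] =
      ∑ i, ϖ i * (lam i / mu i) * (1 - Real.exp (-mu i * t)) * Real.exp (-mu i * u)
        + lam ⬝ᵥ (kMatrix Q ϖ mu t u).mulVec lam + lam ⬝ᵥ (lMatrix Q ϖ mu t u).mulVec lam := by
  have htT : t ≤ t + u := le_self_add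
  have hJ := hM.background
  rw [covariance_eq_sub (hM.memLp_numJobs hlam hmu t) (hM.memLp_numJobs hlam hmu (t + u))]
  simp only [Pi.mul_apply]
  rw [hM.integral_numJobs_mul hlam hmu htT, hM.integral_numJobs hlam hmu (le_refl t),
    hM.integral_numJobs hlam hmu (le_refl (t + u))]
  simp only [rateIntegral_cutFun_survival htT, rateIntegral_cutFun_survival (le_refl t),
    rateIntegral_cutFun_survival (le_refl (t + u))]
  rw [hJ.integral_jobRate_mul hϖ hlam hmu, hJ.integral_jobRate hϖ hlam hmu htT,
    hJ.integral_jobRate hϖ hlam hmu (le_refl t), hJ.integral_jobRate hϖ hlam hmu (le_refl (t + u))]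
  simp only [NNReal.coe_add]
  rw [integral_sum_covKernel Q ϖ lam mu t.coe_nonneg u.coe_nonneg]
  have h1 : ∫ s in (0 : ℝ)..t, ∑ i, Real.exp (-mu i * (t + u - s)) * lam i * ϖ i =
      ∑ i, ϖ i * (lam i / mu i) * (1 - Real.exp (-mu i * t)) * Real.exp (-mu i * u) := by
    rw [intervalIntegral.integral_finsetSum]
    · refine Finset.sum_congr rfl fun i _ => ?_
      rw [intervalIntegral.integral_mul_const, intervalIntegral.integral_mul_const,
        integral_exp_shift (hmu i)]
      ring
    · exact fun i _ => Continuous.intervalIntegrable (by fun_prop) _ _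
  rw [h1]
  ring

end CovarianceFormula

/-! ### Single-integral forms and the limit of large time -/

section Limits

variable {d : ℕ} {Q : Matrix (Fin d) (Fin d) ℝ} {ϖ mu : Fin d → ℝ}

lemma kMatrix_apply_eq (hmu : ∀ i, 0 < mu i) (t u : ℝ) (i j : Fin d) :
    kMatrix Q ϖ mu t u i j =
      1 / (mu i + mu j) * Real.exp (-mu i * u - mu j * t) * ϖ i *
        ∫ w in (0 : ℝ)..t, (Real.exp (-mu i * w + mu j * t) - Real.exp (-mu i * t + mu j * w)) *
          (transProb Q i j w - ϖ j) :=
  integral_triangle_lower (q := fun w => transProb Q i j w - ϖ j) (by fun_prop) (hmu i) (hmu j)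
    (ϖ i) t u

lemma lMatrix_apply_eq (hmu : ∀ i, 0 < mu i) (t u : ℝ) (i j : Fin d) :
    lMatrix Q ϖ mu t u i j =
      1 / (mu i + mu j) * Real.exp (-mu i * u) * ϖ j * (1 - Real.exp (-(mu i + mu j) * t)) *
          (∫ w in (0 : ℝ)..u, Real.exp (mu i * w) * (transProb Q j i w - ϖ i))
        + 1 / (mu i + mu j) * ϖ j * ∫ w in u..(t + u),
          (Real.exp (mu j * (u - w)) - Real.exp (mu i * (w - u - t) - mu j * t)) *
            (transProb Q j i w - ϖ i) :=
  integral_triangle_upper (q := fun w => transProb Q j i w - ϖ i) (by fun_prop) (hmu i) (hmu j)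
    (ϖ j) t u

lemma tendsto_kMatrix (hmu : ∀ i, 0 < mu i)
    (hp : ∀ i j w, 0 ≤ w → |transProb Q i j w - ϖ j| ≤ 1) (u : ℝ) (i j : Fin d) :
    Tendsto (fun t : ℝ => kMatrix Q ϖ mu t u i j) atTop
      (𝓝 (ϖ i * (1 / (mu i + mu j)) * Real.exp (-mu i * u) * devMatrix Q ϖ mu i j)) := by
  simp only [kMatrix_apply_eq hmu]
  exact tendsto_triangle_lower (q := fun w => transProb Q i j w - ϖ j) (by fun_prop) (hp i j)
    (hmu i) (hmu j) (ϖ i) u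

lemma tendsto_lMatrix (hmu : ∀ i, 0 < mu i)
    (hp : ∀ i j w, 0 ≤ w → |transProb Q i j w - ϖ j| ≤ 1) {u : ℝ} (hu : 0 ≤ u) (i j : Fin d) :
    Tendsto (fun t : ℝ => lMatrix Q ϖ mu t u i j) atTop
      (𝓝 (ϖ j * (1 / (mu i + mu j)) * (∫ w in (0 : ℝ)..u,
          Real.exp (-mu i * u + mu i * w) * (transProb Q j i w - ϖ i))
        + ϖ j * (1 / (mu i + mu j)) * ∫ w in Set.Ioi u,
          Real.exp (mu j * u - mu j * w) * (transProb Q j i w - ϖ i))) := by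
  simp only [lMatrix_apply_eq hmu]
  exact tendsto_triangle_upper (q := fun w => transProb Q j i w - ϖ i) (by fun_prop) (hp j i)
    (hmu i) (hmu j) (ϖ j) hu

/-- The limit of the covariance formula for `t → ∞`. -/
lemma tendsto_covariance_formula (hmu : ∀ i, 0 < mu i)
    (hp : ∀ i j w, 0 ≤ w → |transProb Q i j w - ϖ j| ≤ 1) (lam : Fin d → ℝ) {u : ℝ}
    (hu : 0 ≤ u) :
    Tendsto (fun t : ℝ =>
      ∑ i, ϖ i * (lam i / mu i) * (1 - Real.exp (-mu i * t)) * Real.exp (-mu i * u)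
        + lam ⬝ᵥ (kMatrix Q ϖ mu t u).mulVec lam + lam ⬝ᵥ (lMatrix Q ϖ mu t u).mulVec lam) atTop
      (𝓝 (∑ i, ϖ i * (lam i / mu i) * Real.exp (-mu i * u)
        + ∑ i, ∑ j, ϖ i * (lam i * lam j / (mu i + mu j)) * Real.exp (-mu i * u) *
            devMatrix Q ϖ mu i j
        + ∑ i, ∑ j, ϖ j * (lam i * lam j / (mu i + mu j)) *
            (∫ w in (0 : ℝ)..u, Real.exp (-mu i * u + mu i * w) * (transProb Q j i w - ϖ i))
        + ∑ i, ∑ j, ϖ j * (lam i * lam j / (mu i + mu j)) *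
            (∫ w in Set.Ioi u, Real.exp (mu j * u - mu j * w) * (transProb Q j i w - ϖ i)))) := by
  rw [add_assoc (∑ i, _ + ∑ i, _)]
  simp only [dotProduct, Matrix.mulVec, Finset.mul_sum]
  refine ((tendsto_finsetSum _ fun i _ => ?_).add (tendsto_finsetSum _ fun i _ =>
    tendsto_finsetSum _ fun j _ => ?_)).add ?_
  · have h := (((tendsto_exp_neg_mul_atTop (hmu i)).const_sub 1).const_mul
      (ϖ i * (lam i / mu i))).mul_const (Real.exp (-mu i * u))
    rwa [sub_zero, mul_one] at h
  · have h := ((tendsto_kMatrix hmu hp u i j).mul_const (lam j)).const_mul (lam i)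
    convert h using 2
    ring
  · simp only [← Finset.sum_add_distrib]
    refine tendsto_finsetSum _ fun i _ => tendsto_finsetSum _ fun j _ => ?_
    have h := ((tendsto_lMatrix hmu hp hu i j).mul_const (lam j)).const_mul (lam i)
    convert h using 2
    ring

end Limits

end ModulatedQueue

theorem mainTheorem5 {d : ℕ} (Q : Matrix (Fin d) (Fin d) ℝ) (ϖ lam mu : Fin d → ℝ)
    (hQ : ModulatedQueue.IsRateMatrix Q) (hirr : ModulatedQueue.IsIrreducibleRate Q)
    (hϖ : ModulatedQueue.IsInvariantProb Q ϖ)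
    (hlam : ∀ i, 0 ≤ lam i) (hmu : ∀ i, 0 < mu i)
    {Ω : Type*} [MeasurableSpace Ω] (P : Measure Ω) [IsProbabilityMeasure P]
    (J : ℝ≥0 → Ω → Fin d) (A : ℕ → Ω → ℝ≥0∞) (S : ℕ → Ω → ℝ)
    (hM : ModulatedQueue.IsModelII Q ϖ lam mu P J A S) :
    -- `M(t)` is a.s. finite, and square integrable
    (∀ᵐ ω ∂P, ∀ t, (ModulatedQueue.jobsPresent A S t ω).Finite) ∧
    (∀ t, MemLp (ModulatedQueue.numJobs A S t) 2 P) ∧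
    -- the covariance at finite times
    (∀ t u : ℝ≥0,
      cov[ModulatedQueue.numJobs A S t, ModulatedQueue.numJobs A S (t + u); P] =
        ∑ i, ϖ i * (lam i / mu i) * (1 - Real.exp (-mu i * t)) * Real.exp (-mu i * u)
        + lam ⬝ᵥ (ModulatedQueue.kMatrix Q ϖ mu t u).mulVec lam
        + lam ⬝ᵥ (ModulatedQueue.lMatrix Q ϖ mu t u).mulVec lam) ∧
    -- `𝒦` and `ℒ` as single integrals
    (∀ (t u : ℝ≥0) (i j : Fin d),
      ModulatedQueue.kMatrix Q ϖ mu t u i j =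
        1 / (mu i + mu j) * Real.exp (-mu i * u - mu j * t) * ϖ i *
          ∫ w in (0 : ℝ)..t,
            (Real.exp (-mu i * w + mu j * t) - Real.exp (-mu i * t + mu j * w)) *
              (ModulatedQueue.transProb Q i j w - ϖ j)) ∧
    (∀ (t u : ℝ≥0) (i j : Fin d),
      ModulatedQueue.lMatrix Q ϖ mu t u i j =
        1 / (mu i + mu j) * Real.exp (-mu i * u) * ϖ j *
            (1 - Real.exp (-(mu i + mu j) * t)) *
            (∫ w in (0 : ℝ)..u,
              Real.exp (mu i * w) * (ModulatedQueue.transProb Q j i w - ϖ i))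
        + 1 / (mu i + mu j) * ϖ j *
            ∫ w in (u : ℝ)..(t + u),
              (Real.exp (mu j * (u - w)) - Real.exp (mu i * (w - u - t) - mu j * t)) *
                (ModulatedQueue.transProb Q j i w - ϖ i)) ∧
    -- the integrals that define `D^(μ)` converge absolutely
    (∀ i j, IntegrableOn
      (fun t : ℝ => Real.exp (-mu i * t) * (ModulatedQueue.transProb Q i j t - ϖ j))
      (Set.Ioi 0)) ∧
    -- the stationary covariance
    (∀ u : ℝ≥0, Tendsto
      (fun t : ℝ≥0 =>
        cov[ModulatedQueue.numJobs A S t, ModulatedQueue.numJobs A S (t + u); P]) atTop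
      (𝓝 (∑ i, ϖ i * (lam i / mu i) * Real.exp (-mu i * u)
        + ∑ i, ∑ j, ϖ i * (lam i * lam j / (mu i + mu j)) * Real.exp (-mu i * u) *
            ModulatedQueue.devMatrix Q ϖ mu i j
        + ∑ i, ∑ j, ϖ j * (lam i * lam j / (mu i + mu j)) *
            (∫ w in (0 : ℝ)..u,
              Real.exp (-mu i * u + mu i * w) * (ModulatedQueue.transProb Q j i w - ϖ i))
        + ∑ i, ∑ j, ϖ j * (lam i * lam j / (mu i + mu j)) *
            (∫ w in Set.Ioi (u : ℝ),
              Real.exp (mu j * u - mu j * w) * (ModulatedQueue.transProb Q j i w - ϖ i))))) ∧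
    -- the stationary variance
    Tendsto (fun t : ℝ≥0 => Var[ModulatedQueue.numJobs A S t; P]) atTop
      (𝓝 (∑ i, ϖ i * (lam i / mu i)
        + 2 * ∑ i, ∑ j, ϖ i * (lam i * lam j / (mu i + mu j)) *
            ModulatedQueue.devMatrix Q ϖ mu i j)) := by

  have hpos := hϖ.pos hQ hirr
  have hp : ∀ i j w, 0 ≤ w → |ModulatedQueue.transProb Q i j w - ϖ j| ≤ 1 := by
    intro i j w hw
    have h1 := hM.background.transProb_mem_Icc (hpos i) j hw
    have h2 : ϖ j ≤ 1 :=
      (Finset.single_le_sum (fun k _ => hϖ.nonneg k) (Finset.mem_univ j)).trans hϖ.sum_eq_one.le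
    exact abs_sub_le_iff.2 ⟨by linarith [h1.2, hϖ.nonneg j], by linarith [h1.1]⟩
  have hlim : ∀ u : ℝ≥0, _ := fun u =>
    (ModulatedQueue.tendsto_covariance_formula hmu hp lam u.coe_nonneg).comp
      (NNReal.tendsto_coe_atTop.2 tendsto_id)
  have hcov := hM.covariance_numJobs hϖ hlam hmu
  refine ⟨?_, hM.memLp_numJobs hlam hmu, hcov,
    fun t u i j => ModulatedQueue.kMatrix_apply_eq hmu t u i j,
    fun t u i j => ModulatedQueue.lMatrix_apply_eq hmu t u i j, fun i j => ?_, fun u => ?_, ?_⟩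
  · filter_upwards [hM.ae_finite hlam] with ω hω t
    exact (hω t).subset (ModulatedQueue.jobsPresent_subset t ω)
  · exact ModulatedQueue.integrableOn_exp_neg_mul_bounded
      (q := fun w => ModulatedQueue.transProb Q i j w - ϖ j) (by fun_prop) (hp i j) (hmu i) 0 le_rfl
  · simp only [hcov]
    exact hlim u
  · have hvar : ∀ t : ℝ≥0, Var[ModulatedQueue.numJobs A S t; P] =
        cov[ModulatedQueue.numJobs A S t, ModulatedQueue.numJobs A S (t + 0); P] := fun t => by
      rw [add_zero, covariance_self (hM.memLp_numJobs hlam hmu t).aemeasurable]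
    simp only [hvar, hcov]
    -- At `u = 0` the integrals over `[0, u]` vanish, and those over `(u, ∞)` become the entries
    -- `(j, i)` of the deviation matrix. Exchanging the summation indices makes that sum equal to
    -- the other one, hence the factor `2`.
    refine (congrArg (Tendsto _ atTop) (congrArg 𝓝 ?_)).mp (hlim 0)
    simp only [NNReal.coe_zero, mul_zero, Real.exp_zero, mul_one, intervalIntegral.integral_same,
      Finset.sum_const_zero, add_zero, zero_sub]
    rw [two_mul, ← add_assoc, Finset.sum_comm (f := fun i j => ϖ j * _ * _)]
    congr 1
    refine Finset.sum_congr rfl fun i _ => Finset.sum_congr rfl fun j _ => ?_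
    rw [ModulatedQueue.devMatrix, Matrix.of_apply, mul_comm (lam j), add_comm (mu j)]
    simp only [neg_mul]
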